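/- \textbf{Setting.} Let $\Gamma$ be a finite group with unit $e$. \emph{Graded spaces.} For a finite set $J$, let $\mathcal{E}^{\boxtimes J}$ be the category of finite-dimensional complex inner product spaces $U=\bigoplus_{\mathbf x\in\Gamma^J}U_{\mathbf x}$ (orthogonal sum) with a unitary left action of $\Gamma^J$ such that $\mathbf g\,U_{\mathbf x}=U_{\mathbf g\mathbf x\mathbf g^{-1}}$; morphisms are the equivariant linear maps preserving the grading, and an isometry is an isomorphism preserving inner products. A bijection $J\cong J'$ identifies $\mathcal{E}^{\boxtimes J}$ with $\mathcal{E}^{\boxtimes J'}$. For $U\in\mathcal{E}^{\boxtimes J}$, $W\in\mathcal{E}^{\boxtimes J'}$ let $U\boxtimes W\in\mathcal{E}^{\boxtimes (J\sqcup J')}$ be the tensor product with $(U\boxtimes W)_{(\mathbf x,\mathbf y)}=U_{\mathbf x}\otimes W_{\mathbf y}$. For $c>0$, $c\cdot U$ is $U$ with its inner product multiplied by $c$. For functors $F:\mathcal{E}^{\boxtimes I}\to\mathcal{E}^{\boxtimes O}$ and $G:\mathcal{E}^{\boxtimes I'}\to\mathcal{E}^{\boxtimes O'}$, a functor $H:\mathcal{E}^{\boxtimes(I\sqcup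 I')}\to\mathcal{E}^{\boxtimes(O\sqcup O')}$ is said to be isomorphic to $F\boxtimes G$ if it is linear on morphisms and $H(U\boxtimes W)\cong F(U)\boxtimes G(W)$ naturally in $U$ and $W$. \emph{Surfaces.} A surface $B$ is a compact oriented smooth 2-manifold, possibly disconnected, empty or with empty boundary, each of whose boundary components is equipped with a label, that is, a diffeomorphism to $S^1=\{z\in\mathbb C:|z|=1\}$; the preimage of $1$ is the base point of the component. Write $\partial^-B$ (resp. $\partial^+B$) for the union of the components whose label reverses (resp. preserves) the boundary orientation, and $p=\#\pi_0(\partial^-B)$. \emph{DW invariants.} Let $\Pi_1(X)$ be the fundamental groupoid of $X$. A $\Gamma$-bundle on $B$ is a functor $\rho:\Pi_1(B)\to\Gamma$. A map of sets $\eta:B\to\Gamma$ takes $\rho$ to the bundle $\eta\cdot\rho$ with $(\eta\cdot\rho)([\gamma])=\eta(\gamma(1))\rho([\gamma])\eta(\gamma(0))^{-1}$. Isomorphisms $\rho\to\rho'$ are the maps $\eta$ with $\eta\cdot\rho=\rho'$ whose value is $e$ at the base point of every boundary component; let $[\rho]$ be the isomorphism class of $\rho$ and $\mathrm{Aut}\,\rho$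 its (finite) group of automorphisms. Define $Z(B)\in\mathcal{E}^{\boxtimes\pi_0(\partial B)}$ by $$Z(B)=\bigoplus_{[\rho]}\frac{1}{\#\mathrm{Aut}\,\rho}\cdot\mathbb{C}[\rho],$$ where $[\rho]$ is homogeneous of degree the tuple of the holonomies of $\rho$ along the boundary components, each taken from its base point and in the boundary orientation, and $\mathbf g\in\Gamma^{\pi_0(\partial B)}$ sends $[\rho]$ to $[\eta_{\mathbf g}\cdot\rho]$, where $\eta_{\mathbf g}$ has the constant value $g_i$ on the $i$-th boundary component and the value $e$ elsewhere. (There are finitely many classes; if every component of $B$ has non-empty boundary, then $\mathrm{Aut}\,\rho$ is trivial.) Define $\hat Z(B):\mathcal{E}^{\boxtimes\pi_0(\partial^-B)}\to\mathcal{E}^{\boxtimes\pi_0(\partial^+B)}$ by $$(\hat Z(B)(U))_{\mathbf y}=\frac{1}{(\#\Gamma)^{p}}\cdot\Big(\bigoplus_{\mathbf x\in\Gamma^p}U_{\mathbf x}\otimes Z(B)_{\mathbf x^{-1},\mathbf y}\Big)^{\Gamma^p}.$$ \emph{Cutting and gluing.} Let $A\subset B$ be a closed 1-dimensional submanifold of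 the interior with labelled components. Let $B^{\mathrm{cut}}$ be the surface obtained by cutting $B$ along $A$, so $\partial B^{\mathrm{cut}}=-A\sqcup A\sqcup\partial B$ with labels induced from $A$ and $B$, and let $q:B^{\mathrm{cut}}\to B$ be the natural map. The functor $\mathrm{gl}_A:\mathcal{E}^{\boxtimes\pi_0(\partial B^{\mathrm{cut}})}\to\mathcal{E}^{\boxtimes\pi_0(\partial B)}$ is given by $$\mathrm{gl}_A(U)_{\mathbf y,\mathbf z}=\frac{1}{(\#\Gamma)^{\#\pi_0(A)}}\cdot\Big(\bigoplus_{\mathbf x\in\Gamma^{\pi_0(A)}}U_{(\mathbf y,\mathbf x^{-1}),(\mathbf x,\mathbf z)}\Big)^{\Gamma^{\pi_0(A)}},$$ where $\Gamma^{\pi_0(A)}$ acts diagonally through the indices belonging to $-A\sqcup A$. \textbf{Theorem.} (a) (Functoriality) Every diffeomorphism $f:B\to B'$ preserving orientations and labels induces an isometry $f_*:Z(B)\cong Z(B')$, $[\rho]\mapsto[\rho\circ f^{-1}]$, in $\mathcal{E}^{\boxtimes\pi_0(\partial B)}$ (with $\pi_0(\partial B)$ and $\pi_0(\partial B')$ identified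 by $f$), and the maps $\mathrm{id}_U\otimes f_*$ induce a natural isomorphism $\hat Z(B)\cong\hat Z(B')$. Moreover $\mathrm{id}_*=\mathrm{id}$ and $(g\circ f)_*=g_*\circ f_*$. (b) (Multiplicativity) For all surfaces $B,B'$ there is an isometry $Z(B\sqcup B')\cong Z(B)\boxtimes Z(B')$, $[\rho]\mapsto[\rho|_B]\otimes[\rho|_{B'}]$, natural with respect to diffeomorphisms as in (a), and $\hat Z(B\sqcup B')\cong\hat Z(B)\boxtimes\hat Z(B')$. (c) (Gluing) If $A\subset B$ is as above, there is an isometry $\Phi:Z(B)\cong\mathrm{gl}_A(Z(B^{\mathrm{cut}}))$, characterized by the property that for every $v\in Z(B)$ and every $\Gamma$-bundle $\tau$ on $B$ the coefficient of $[q^*\tau]$ in $\Phi(v)$ is the coefficient of $[\tau]$ in $v$; it is natural with respect to diffeomorphisms of $B$ and $B^{\mathrm{cut}}$ compatible with the maps $q$. In particular, if $B=B_1\cup B_2$ is obtained by gluing surfaces $B_1,B_2$ along $\partial^+B_1=-\partial^-B_2$, so that cutting $B$ along $A=\partial^+B_1$ gives $B_1\sqcup B_2$, then there is an isometry $Z(B)\cong\mathrm{gl}_{\partial^+B_1}(Z(B_2)\boxtimes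 Z(B_1))$, under which likewise the coefficient of $[\tau|_{B_2}]\otimes[\tau|_{B_1}]$ is that of $[\tau]$, natural with respect to diffeomorphisms of $B_1$, $B_2$ and $B$ compatible with the gluing, and there is a natural isomorphism of functors $\hat Z(B)\cong\hat Z(B_2)\circ\hat Z(B_1)$. -/

import Mathlib

open CategoryTheory TensorProduct
open scoped Manifold ContDiff

universe u

noncomputable section

/-! ### Graded inner product spaces with unitary action -/

/-- An object of `ℰ^{⊠J}`: a finite-dimensional inner product space with an orthogonal
decomposition `V = ⨁ V_x`, `x ∈ Γ^J`, and a unitary action of `Γ^J` such that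
`g V_x = V_{g x g⁻¹}`. For `J` a one-point set this is an object of `ℰ`, and for `J` empty it is
just an inner product space. -/
structure EObj (Γ : Type u) [Group Γ] (J : Type) where
  V : Type u
  [instNormed : NormedAddCommGroup V]
  [instInner : InnerProductSpace ℂ V]
  [instFin : FiniteDimensional ℂ V]
  grade : (J → Γ) → Submodule ℂ V
  ortho : ∀ x y, x ≠ y → grade x ⟂ grade y
  span : ⨆ x, grade x = ⊤
  act : Representation ℂ (J → Γ) V
  act_inner : ∀ g v w, inner ℂ (act g v) (act g w) = inner ℂ v w
  act_grade : ∀ g x v, v ∈ grade x → act g v ∈ grade (g * x * g⁻¹)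

attribute [instance] EObj.instNormed EObj.instInner EObj.instFin

/-- A morphism of `ℰ^{⊠J}`: a linear map respecting the grading and commuting with the action. -/
@[ext]
structure EHom {Γ : Type u} [Group Γ] {J : Type} (U W : EObj Γ J) where
  lin : U.V →ₗ[ℂ] W.V
  map_grade : ∀ x v, v ∈ U.grade x → lin v ∈ W.grade x
  map_act : ∀ g v, lin (U.act g v) = W.act g (lin v)

instance {Γ : Type u} [Group Γ] {J : Type} : Category (EObj Γ J) where
  Hom U W := EHom U W
  id U := ⟨LinearMap.id, fun _ _ h => h, fun _ _ => rfl⟩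
  comp f g := ⟨g.lin ∘ₗ f.lin, fun x v h => g.map_grade x _ (f.map_grade x v h),
    fun a v => by simp [f.map_act, g.map_act]⟩

/-- The underlying linear map of a morphism. -/
def EObj.lin {Γ : Type u} [Group Γ] {J : Type} {U W : EObj Γ J} (f : U ⟶ W) : U.V →ₗ[ℂ] W.V :=
  EHom.lin f

theorem EObj.hom_ext {Γ : Type u} [Group Γ] {J : Type} {U W : EObj Γ J} {f g : U ⟶ W}
    (h : EObj.lin f = EObj.lin g) : f = g :=
  EHom.ext h

/-- A morphism which preserves inner products; an isomorphism with this property is an isometry. -/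
def IsIsometric {Γ : Type u} [Group Γ] {J : Type} {U W : EObj Γ J} (f : U ⟶ W) : Prop :=
  ∀ v w, inner ℂ (EObj.lin f v) (EObj.lin f w) = inner ℂ v w

/-- Transport of `ℰ^{⊠J}` to `ℰ^{⊠J'}` along a bijection of the index sets. -/
def EObj.reindex {Γ : Type u} [Group Γ] {J J' : Type} (e : J ≃ J') (U : EObj Γ J) :
    EObj Γ J' where
  V := U.V
  grade x := U.grade (x ∘ e)
  ortho x y h := U.ortho _ _ fun h' => h (e.surjective.injective_comp_right h')
  span := by
    rw [← U.span]
    exact (e.arrowCongr (Equiv.refl Γ)).symm.iSup_congr fun x => rfl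
  act := U.act.comp (MonoidHom.mk' (fun g : J' → Γ => g ∘ e) fun _ _ => rfl)
  act_inner g v w := U.act_inner _ v w
  act_grade g x v h := U.act_grade (g ∘ e) (x ∘ e) v h

/-- Reindexing as a functor; it does not change the underlying linear maps. -/
def reindexFunctor (Γ : Type u) [Group Γ] {J J' : Type} (e : J ≃ J') :
    EObj Γ J ⥤ EObj Γ J' where
  obj U := U.reindex e
  map {U W} f := EHom.mk (U := U.reindex e) (W := W.reindex e) (EObj.lin (U := U) (W := W) f)
    (fun x v h => EHom.map_grade f (x ∘ e) v h) (fun g v => EHom.map_act f (g ∘ e) v)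

/-- The external tensor product `U ⊠ W`, with `(U ⊠ W)_{(x,y)} = U_x ⊗ W_y`. -/
def EObj.ext {Γ : Type u} [Group Γ] {J J' : Type} (U : EObj Γ J) (W : EObj Γ J') :
    EObj Γ (J ⊕ J') where
  V := U.V ⊗[ℂ] W.V
  grade z := Submodule.map₂ (TensorProduct.mk ℂ U.V W.V) (U.grade (z ∘ Sum.inl))
    (W.grade (z ∘ Sum.inr))
  ortho := by
    intro z z' hz
    rw [Submodule.isOrtho_iff_le, Submodule.map₂_le]
    intro a ha b hb
    have key : Submodule.map₂ (TensorProduct.mk ℂ U.V W.V) (U.grade (z' ∘ Sum.inl))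
        (W.grade (z' ∘ Sum.inr)) ≤ (ℂ ∙ (a ⊗ₜ[ℂ] b))ᗮ := by
      rw [Submodule.map₂_le]
      intro a' ha' b' hb'
      rw [Submodule.mem_orthogonal_singleton_iff_inner_right, TensorProduct.mk_apply,
        TensorProduct.inner_tmul]
      by_cases h : z ∘ Sum.inl = z' ∘ (Sum.inl : J → J ⊕ J')
      · have h2 : z ∘ Sum.inr ≠ z' ∘ (Sum.inr : J' → J ⊕ J') := fun h2 =>
          hz (by rw [← Sum.elim_comp_inl_inr z, h, h2, Sum.elim_comp_inl_inr])
        rw [(W.ortho _ _ h2).inner_eq hb hb', mul_zero]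
      · rw [(U.ortho _ _ h).inner_eq ha ha', zero_mul]
    rw [Submodule.mem_orthogonal]
    intro t ht
    exact Submodule.mem_orthogonal_singleton_iff_inner_left.1 (key ht)
  span := by
    rw [eq_top_iff, ← TensorProduct.map₂_mk_top_top_eq_top, ← U.span, ← W.span,
      Submodule.map₂_iSup_left]
    refine iSup_le fun x => ?_
    rw [Submodule.map₂_iSup_right]
    refine iSup_le fun y => ?_
    exact le_iSup_of_le (Sum.elim x y) le_rfl
  act :=
    { toFun := fun g => TensorProduct.map (U.act (g ∘ Sum.inl)) (W.act (g ∘ Sum.inr))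
      map_one' := by
        have h1 : (1 : J ⊕ J' → Γ) ∘ Sum.inl = 1 := rfl
        have h2 : (1 : J ⊕ J' → Γ) ∘ Sum.inr = 1 := rfl
        rw [h1, h2, map_one, map_one]; exact TensorProduct.map_one
      map_mul' := fun g h => by
        have h1 : (g * h) ∘ Sum.inl = (g ∘ Sum.inl) * (h ∘ (Sum.inl : J → J ⊕ J')) := rfl
        have h2 : (g * h) ∘ Sum.inr = (g ∘ Sum.inr) * (h ∘ (Sum.inr : J' → J ⊕ J')) := rfl
        rw [h1, h2, map_mul, map_mul]; exact TensorProduct.map_mul _ _ _ _ }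
  act_inner g v w := TensorProduct.inner_map_map
    ((U.act (g ∘ Sum.inl)).isometryOfInner (U.act_inner _))
    ((W.act (g ∘ Sum.inr)).isometryOfInner (W.act_inner _)) v w
  act_grade g x v h := by
    have key : Submodule.map₂ (TensorProduct.mk ℂ U.V W.V) (U.grade (x ∘ Sum.inl))
        (W.grade (x ∘ Sum.inr)) ≤ (Submodule.map₂ (TensorProduct.mk ℂ U.V W.V)
          (U.grade ((g * x * g⁻¹) ∘ Sum.inl)) (W.grade ((g * x * g⁻¹) ∘ Sum.inr))).comap
          (TensorProduct.map (U.act (g ∘ Sum.inl)) (W.act (g ∘ Sum.inr))) := by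
      rw [Submodule.map₂_le]
      intro a ha b hb
      exact Submodule.apply_mem_map₂ _ (U.act_grade (g ∘ Sum.inl) _ a ha)
        (W.act_grade (g ∘ Sum.inr) _ b hb)
    exact key h

/-- The external tensor product of morphisms. -/
def EObj.extMap {Γ : Type u} [Group Γ] {J J' : Type} {U U' : EObj Γ J} {W W' : EObj Γ J'}
    (f : U ⟶ U') (g : W ⟶ W') : U.ext W ⟶ U'.ext W' :=
  EHom.mk (U := U.ext W) (W := U'.ext W') (TensorProduct.map (EObj.lin f) (EObj.lin g))
    (fun x v h => by
      have key : Submodule.map₂ (TensorProduct.mk ℂ U.V W.V) (U.grade (x ∘ Sum.inl))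
          (W.grade (x ∘ Sum.inr)) ≤ (Submodule.map₂ (TensorProduct.mk ℂ U'.V W'.V)
            (U'.grade (x ∘ Sum.inl)) (W'.grade (x ∘ Sum.inr))).comap
            (TensorProduct.map (EObj.lin f) (EObj.lin g)) := by
        rw [Submodule.map₂_le]
        intro a ha b hb
        exact Submodule.apply_mem_map₂ _ (EHom.map_grade f _ a ha) (EHom.map_grade g _ b hb)
      exact key h)
    (fun a v => by
      have key : TensorProduct.map (EObj.lin f) (EObj.lin g) ∘ₗ
          TensorProduct.map (U.act (a ∘ Sum.inl)) (W.act (a ∘ Sum.inr)) =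
          TensorProduct.map (U'.act (a ∘ Sum.inl)) (W'.act (a ∘ Sum.inr)) ∘ₗ
          TensorProduct.map (EObj.lin f) (EObj.lin g) := by
        rw [← TensorProduct.map_comp, ← TensorProduct.map_comp]
        congr 1
        · exact LinearMap.ext fun v => EHom.map_act f _ v
        · exact LinearMap.ext fun v => EHom.map_act g _ v
      exact LinearMap.congr_fun key v)

/-- The external tensor product as a functor of both variables. -/
def extFunctor (Γ : Type u) [Group Γ] (J J' : Type) :
    EObj Γ J × EObj Γ J' ⥤ EObj Γ (J ⊕ J') where
  obj P := P.1.ext P.2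
  map f := EObj.extMap f.1 f.2
  map_id _ := EObj.hom_ext (TensorProduct.map_id)
  map_comp _ _ := EObj.hom_ext (TensorProduct.map_comp _ _ _ _)

/-- `Scaled c V` is the inner product space `c · V`: the vector space `V` with its inner product
multiplied by the positive real number `c`. -/
def Scaled (_c : {c : ℝ // 0 < c}) (V : Type u) : Type u := V

namespace Scaled

variable (c : {c : ℝ // 0 < c}) (V : Type u) [NormedAddCommGroup V] [InnerProductSpace ℂ V]

instance : AddCommGroup (Scaled c V) := inferInstanceAs (AddCommGroup V)
instance : Module ℂ (Scaled c V) := inferInstanceAs (Module ℂ V)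
instance [h : FiniteDimensional ℂ V] : FiniteDimensional ℂ (Scaled c V) := h

/-- The identity map `V → c · V`. -/
def equiv : V ≃ₗ[ℂ] Scaled c V := LinearEquiv.refl ℂ V

/-- The inner product of `c · V`. -/
@[reducible]
def core : InnerProductSpace.Core ℂ (Scaled c V) where
  inner v w := (c : ℂ) * inner ℂ ((equiv c V).symm v) ((equiv c V).symm w)
  conj_inner_symm v w := by simp
  re_inner_nonneg v := by
    rw [inner_self_eq_norm_sq_to_K]
    simp only [RCLike.ofReal_eq_complex_ofReal, ← Complex.ofReal_pow, ← Complex.ofReal_mul]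
    exact mul_nonneg c.2.le (by positivity)
  add_left u v w := by simp [mul_add]
  smul_left v w r := by simp; ring
  definite v h := by
    have hc : ((c : ℝ) : ℂ) ≠ 0 := by exact_mod_cast c.2.ne'
    have := inner_self_eq_zero.1 ((mul_eq_zero.1 h).resolve_left hc)
    exact (LinearEquiv.map_eq_zero_iff _).1 this

instance : NormedAddCommGroup (Scaled c V) := (core c V).toNormedAddCommGroup
instance : InnerProductSpace ℂ (Scaled c V) := .ofCore (core c V).toCore

theorem inner_def (v w : Scaled c V) :
    inner ℂ v w = (c : ℂ) * inner ℂ ((equiv c V).symm v) ((equiv c V).symm w) := rfl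

end Scaled

/-- The object `c · U`. -/
def EObj.scale {Γ : Type u} [Group Γ] {J : Type} (c : {c : ℝ // 0 < c}) (U : EObj Γ J) :
    EObj Γ J where
  V := Scaled c U.V
  grade x := (U.grade x).comap (Scaled.equiv c U.V).symm.toLinearMap
  ortho x y h := by
    rw [Submodule.isOrtho_iff_inner_eq]
    intro v hv w hw
    exact (congrArg ((c : ℂ) * ·) ((U.ortho x y h).inner_eq hv hw)).trans (mul_zero _)
  span := by
    have := U.span
    exact this
  act := U.act
  act_inner g v w := congrArg ((c : ℂ) * ·) (U.act_inner g _ _)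
  act_grade g x v h := U.act_grade g x _ h

namespace EObj

variable {Γ : Type u} [Group Γ] {J K : Type}

/-- The part `⨁_x U_{y,x⁻¹,x}` of an object of `ℰ^{⊠(J ⊔ K ⊔ K)}`. -/
def matched (U : EObj Γ (J ⊕ (K ⊕ K))) (y : J → Γ) : Submodule ℂ U.V :=
  ⨆ x : K → Γ, U.grade (Sum.elim y (Sum.elim x⁻¹ x))

/-- The vectors invariant under the diagonal subgroup `Γ^K` of `Γ^K × Γ^K`. -/
def diagInv (U : EObj Γ (J ⊕ (K ⊕ K))) : Submodule ℂ U.V where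
  carrier := {v | ∀ h : K → Γ, U.act (Sum.elim 1 (Sum.elim h h)) v = v}
  add_mem' ha hb h := by rw [map_add, ha h, hb h]
  zero_mem' h := map_zero _
  smul_mem' c v hv h := by rw [map_smul, hv h]

/-- The vector space `⨁_y (⨁_x U_{y,x⁻¹,x})^{Γ^K}`. -/
def contractSpace (U : EObj Γ (J ⊕ (K ⊕ K))) : Submodule ℂ U.V :=
  (⨆ y : J → Γ, U.matched y) ⊓ U.diagInv

theorem act_mem_matched (U : EObj Γ (J ⊕ (K ⊕ K))) (g y : J → Γ) (h : K → Γ) {v : U.V}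
    (hv : v ∈ U.matched y) :
    U.act (Sum.elim g (Sum.elim h h)) v ∈ U.matched (g * y * g⁻¹) := by
  have key : U.matched y ≤
      (U.matched (g * y * g⁻¹)).comap (U.act (Sum.elim g (Sum.elim h h))) := by
    refine iSup_le fun x => ?_
    intro v hv
    refine Submodule.mem_iSup_of_mem (h * x * h⁻¹) ?_
    have := U.act_grade (Sum.elim g (Sum.elim h h)) _ v hv
    convert this using 2
    funext j
    rcases j with j | j | j <;> simp [mul_assoc]
  exact key hv

theorem act_mem_contractSpace (U : EObj Γ (J ⊕ (K ⊕ K))) (g : J → Γ) {v : U.V}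
    (hv : v ∈ U.contractSpace) : U.act (Sum.elim g 1) v ∈ U.contractSpace := by
  have e : (Sum.elim g 1 : J ⊕ (K ⊕ K) → Γ) = Sum.elim g (Sum.elim 1 1) := by
    funext j; rcases j with j | j | j <;> rfl
  refine ⟨?_, fun h => ?_⟩
  · have key : (⨆ y : J → Γ, U.matched y) ≤
        (⨆ y : J → Γ, U.matched y).comap (U.act (Sum.elim g 1)) := by
      refine iSup_le fun y v hv => ?_
      refine Submodule.mem_iSup_of_mem (g * y * g⁻¹) ?_
      rw [e]
      exact U.act_mem_matched g y 1 hv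
    exact key hv.1
  · have hcomm : (Sum.elim 1 (Sum.elim h h) : J ⊕ (K ⊕ K) → Γ) * (Sum.elim g 1 : _ → Γ) =
        (Sum.elim g 1 : J ⊕ (K ⊕ K) → Γ) * (Sum.elim 1 (Sum.elim h h) : _ → Γ) := by
      funext j; rcases j with j | j | j <;> simp
    rw [← Module.End.mul_apply, ← map_mul, hcomm, map_mul, Module.End.mul_apply, hv.2 h]

theorem matched_ortho (U : EObj Γ (J ⊕ (K ⊕ K))) {y y' : J → Γ} (h : y ≠ y') :
    U.matched y ⟂ U.matched y' := by
  simp only [matched, Submodule.isOrtho_iSup_left, Submodule.isOrtho_iSup_right]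
  intro x x'
  refine U.ortho _ _ fun h' => h ?_
  have := congrArg (· ∘ Sum.inl) h'
  simpa using this

theorem contract_span [Finite Γ] [Finite K] (U : EObj Γ (J ⊕ (K ⊕ K))) :
    U.contractSpace ≤ ⨆ y : J → Γ, U.matched y ⊓ U.diagInv := by
  classical
  have := Fintype.ofFinite (K → Γ)
  let P : U.V →ₗ[ℂ] U.V := (Fintype.card (K → Γ) : ℂ)⁻¹ •
    ∑ h : K → Γ, U.act (Sum.elim 1 (Sum.elim h h))
  have hP : ∀ v, P v = (Fintype.card (K → Γ) : ℂ)⁻¹ •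
      ∑ h : K → Γ, U.act (Sum.elim 1 (Sum.elim h h)) v := fun v => by
    simp [P]
  have hinv : ∀ v, P v ∈ U.diagInv := by
    intro v k
    rw [hP, map_smul, map_sum]
    congr 1
    refine Fintype.sum_equiv (Equiv.mulLeft k) _ _ fun h => ?_
    rw [← Module.End.mul_apply, ← map_mul]
    congr 2
    funext j; rcases j with j | j | j <;> simp
  have hfix : ∀ v ∈ U.diagInv, P v = v := by
    intro v hv
    rw [hP, Finset.sum_congr rfl fun h _ => hv h, Finset.sum_const, Finset.card_univ,
      ← Nat.cast_smul_eq_nsmul ℂ, smul_smul, inv_mul_cancel₀, one_smul]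
    exact_mod_cast Fintype.card_ne_zero
  have key : (⨆ y : J → Γ, U.matched y) ≤
      (⨆ y : J → Γ, U.matched y ⊓ U.diagInv).comap P := by
    refine iSup_le fun y v hv => ?_
    refine Submodule.mem_iSup_of_mem y ⟨?_, hinv v⟩
    rw [hP]
    refine Submodule.smul_mem _ _ (Submodule.sum_mem _ fun h _ => ?_)
    simpa using U.act_mem_matched 1 y h hv
  intro v hv
  rw [← hfix v hv.2]
  exact key hv.1

theorem lin_mem_matched {U W : EObj Γ (J ⊕ (K ⊕ K))} (f : U ⟶ W) (y : J → Γ) {v : U.V}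
    (hv : v ∈ U.matched y) : lin f v ∈ W.matched y := by
  have key : U.matched y ≤ (W.matched y).comap (lin f) :=
    iSup_le fun x v hv => Submodule.mem_iSup_of_mem x (EHom.map_grade f _ v hv)
  exact key hv

theorem lin_mem_contractSpace {U W : EObj Γ (J ⊕ (K ⊕ K))} (f : U ⟶ W) {v : U.V}
    (hv : v ∈ U.contractSpace) : lin f v ∈ W.contractSpace := by
  refine ⟨?_, fun h => ?_⟩
  · have key : (⨆ y : J → Γ, U.matched y) ≤ (⨆ y : J → Γ, W.matched y).comap (lin f) :=
      iSup_le fun y v hv => Submodule.mem_iSup_of_mem y (lin_mem_matched f y hv)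
    exact key hv.1
  · exact (EHom.map_act f _ v).symm.trans (congrArg (lin f) (hv.2 h))

/-- The unscaled contraction: `y ↦ (⨁_x U_{y,x⁻¹,x})^{Γ^K}`, as an object of `ℰ^{⊠J}`. -/
def contractRaw [Finite Γ] [Finite K] (U : EObj Γ (J ⊕ (K ⊕ K))) : EObj Γ J where
  V := U.contractSpace
  grade y := (U.matched y).comap U.contractSpace.subtype
  ortho y y' h := by
    rw [Submodule.isOrtho_iff_inner_eq]
    intro v hv w hw
    exact (U.matched_ortho h).inner_eq hv hw
  span := by
    rw [eq_top_iff]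
    have h1 : U.contractSpace ≤ (⨆ y : J → Γ,
        (U.matched y).comap U.contractSpace.subtype).map U.contractSpace.subtype := by
      refine U.contract_span.trans ?_
      rw [Submodule.map_iSup]
      refine iSup_mono fun y v hv => ?_
      exact ⟨⟨v, Submodule.mem_iSup_of_mem y hv.1, hv.2⟩, hv.1, rfl⟩
    intro v _
    obtain ⟨w, hw, hwv⟩ := h1 v.2
    rwa [← Subtype.ext hwv]
  act :=
    { toFun := fun g => (U.act (Sum.elim g 1)).restrict fun v hv => U.act_mem_contractSpace g hv
      map_one' := by
        ext v
        have : (Sum.elim 1 1 : J ⊕ (K ⊕ K) → Γ) = 1 := by funext j; rcases j with j | j <;> rfl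
        simp [this]
      map_mul' := fun g h => by
        ext v
        have : (Sum.elim (g * h) 1 : J ⊕ (K ⊕ K) → Γ) = Sum.elim g 1 * Sum.elim h 1 := by
          funext j; rcases j with j | j <;> simp
        simp [this] }
  act_inner g v w := U.act_inner _ _ _
  act_grade g y v h := by
    have e : (Sum.elim g 1 : J ⊕ (K ⊕ K) → Γ) = Sum.elim g (Sum.elim 1 1) := by
      funext j; rcases j with j | j | j <;> rfl
    change U.act (Sum.elim g 1) v ∈ U.matched (g * y * g⁻¹)
    rw [e]
    exact U.act_mem_matched g y 1 h

end EObj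

/-- The factor `1 / (#Γ)^{#K}`. -/
def contractFactor (Γ : Type u) [Group Γ] [Finite Γ] (K : Type) : {c : ℝ // 0 < c} :=
  ⟨1 / (Nat.card Γ : ℝ) ^ Nat.card K,
    one_div_pos.2 (pow_pos (by exact_mod_cast Nat.card_pos) _)⟩

/-- The contraction functor `ℰ^{⊠(J ⊔ K ⊔ K)} → ℰ^{⊠J}`,
`(contract U)_y = (#Γ)^{-#K} · (⨁_x U_{y,x⁻¹,x})^{Γ^K}`. -/
def contractFunctor (Γ : Type u) [Group Γ] [Finite Γ] (J K : Type) [Finite K] :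
    EObj Γ (J ⊕ (K ⊕ K)) ⥤ EObj Γ J where
  obj U := U.contractRaw.scale (contractFactor Γ K)
  map {U W} f := EHom.mk (U := U.contractRaw.scale (contractFactor Γ K))
    (W := W.contractRaw.scale (contractFactor Γ K))
    ((EObj.lin f).restrict (p := U.contractSpace) (q := W.contractSpace)
      fun _ hv => EObj.lin_mem_contractSpace f hv)
    (fun y _ hv => EObj.lin_mem_matched f y hv)
    (fun g _ => Subtype.ext (EHom.map_act f (Sum.elim g 1) _))
  map_id _ := rfl
  map_comp _ _ := rfl


/-- A `Γ`-bundle on `X`, in its holonomy description: a functor from the fundamental groupoid of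
`X` to the one-object groupoid `Γ`. -/
abbrev GBundle (Γ X : Type u) [Group Γ] [TopologicalSpace X] : Type u :=
  FundamentalGroupoid X ⥤ SingleObj Γ

namespace GBundle

variable {Γ X : Type u} [Group Γ] [TopologicalSpace X]

/-- The holonomy of a bundle along a path; it satisfies
`hol ρ (p.trans q) = hol ρ q * hol ρ p`. -/
def hol (ρ : GBundle Γ X) {x y : X} (p : Path x y) : Γ :=
  ρ.map (FundamentalGroupoid.fromPath (Path.Homotopic.Quotient.mk p))

theorem hol_trans (ρ : GBundle Γ X) {x y z : X} (p : Path x y) (q : Path y z) :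
    ρ.hol (p.trans q) = ρ.hol q * ρ.hol p :=
  ρ.map_comp (FundamentalGroupoid.fromPath (Path.Homotopic.Quotient.mk p))
    (FundamentalGroupoid.fromPath (Path.Homotopic.Quotient.mk q))

theorem hol_refl (ρ : GBundle Γ X) (x : X) : ρ.hol (Path.refl x) = 1 :=
  ρ.map_id ⟨x⟩

theorem hol_congr (ρ : GBundle Γ X) {x y : X} {p q : Path x y} (h : p.Homotopic q) :
    ρ.hol p = ρ.hol q :=
  congrArg (fun r => (ρ.map (FundamentalGroupoid.fromPath r) : Γ)) (Quotient.sound h)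

theorem hol_symm (ρ : GBundle Γ X) {x y : X} (p : Path x y) : ρ.hol p.symm = (ρ.hol p)⁻¹ := by
  rw [eq_inv_iff_mul_eq_one, ← hol_trans, ← hol_refl ρ x]
  exact (hol_congr ρ ⟨Path.Homotopy.reflTransSymm p⟩).symm

theorem ext_hol {ρ σ : GBundle Γ X} (h : ∀ (x y : X) (p : Path x y), ρ.hol p = σ.hol p) :
    ρ = σ := by
  refine CategoryTheory.Functor.hext (fun _ => rfl) fun x y p => heq_of_eq ?_
  induction p using Quotient.inductionOn with
  | h p => exact h x.as y.as p

/-- The action of a map `η : X → Γ` on bundles: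
`(η · ρ)(γ) = η(γ(1)) ρ(γ) η(γ(0))⁻¹`. Thus `η` is a morphism `ρ → η · ρ`. -/
def gauge (η : X → Γ) (ρ : GBundle Γ X) : GBundle Γ X where
  obj _ := SingleObj.star Γ
  map {x y} p := (η y.as * ρ.map p * (η x.as)⁻¹ : Γ)
  map_id x := by
    rw [ρ.map_id]; change η x.as * 1 * (η x.as)⁻¹ = 1; simp
  map_comp {x y z} p q := by
    rw [ρ.map_comp]
    change η z.as * ((ρ.map q : Γ) * (ρ.map p : Γ)) * (η x.as)⁻¹ =
      (η z.as * (ρ.map q : Γ) * (η y.as)⁻¹) * (η y.as * (ρ.map p : Γ) * (η x.as)⁻¹)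
    group

theorem hol_gauge (η : X → Γ) (ρ : GBundle Γ X) {x y : X} (p : Path x y) :
    (gauge η ρ).hol p = η y * ρ.hol p * (η x)⁻¹ := rfl

instance : MulAction (X → Γ) (GBundle Γ X) where
  smul := gauge
  one_smul ρ := ext_hol fun x y p => by
    change (gauge 1 ρ).hol p = _; simp [hol_gauge]
  mul_smul η ζ ρ := ext_hol fun x y p => by
    change (gauge (η * ζ) ρ).hol p = (gauge η (gauge ζ ρ)).hol p
    simp [hol_gauge, mul_assoc]

theorem hol_smul (η : X → Γ) (ρ : GBundle Γ X) {x y : X} (p : Path x y) :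
    (η • ρ).hol p = η y * ρ.hol p * (η x)⁻¹ := rfl

/-- The pull-back of a bundle along a continuous map. -/
def pull {Y : Type u} [TopologicalSpace Y] (f : C(X, Y)) (ρ : GBundle Γ Y) : GBundle Γ X :=
  FundamentalGroupoid.map f ⋙ ρ

theorem hol_pull {Y : Type u} [TopologicalSpace Y] (f : C(X, Y)) (ρ : GBundle Γ Y) {x y : X}
    (p : Path x y) : (pull f ρ).hol p = ρ.hol (p.map f.continuous) := rfl

theorem pull_smul {Y : Type u} [TopologicalSpace Y] (f : C(X, Y)) (η : Y → Γ) (ρ : GBundle Γ Y) :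
    pull f (η • ρ) = (η ∘ f) • pull f ρ := rfl

/-- The maps `η : X → Γ` with value `e` at the base points `b j`. -/
def basedGauge (Γ : Type u) [Group Γ] {J : Type} (b : J → X) : Subgroup (X → Γ) where
  carrier := {η | ∀ j, η (b j) = 1}
  mul_mem' h k j := by simp [h j, k j]
  one_mem' _ := rfl
  inv_mem' h j := by simp [h j]


open Set Topology in
theorem homotopic_of_subset {U : Set X} [ContractibleSpace U] {x y : X} {p q : Path x y}
    (hp : range p ⊆ U) (hq : range q ⊆ U) : p.Homotopic q := by
  have lift : ∀ r : Path x y, range r ⊆ U → ∃ r' : Path (⟨x, hp ⟨0, p.source⟩⟩ : U)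
      ⟨y, hp ⟨1, p.target⟩⟩, r = r'.map continuous_subtype_val := by
    intro r hr
    refine ⟨⟨⟨fun t => ⟨r t, hr ⟨t, rfl⟩⟩, by fun_prop⟩, Subtype.ext r.source,
      Subtype.ext r.target⟩, ?_⟩
    ext t; rfl
  obtain ⟨p', hp'⟩ := lift p hp
  obtain ⟨q', hq'⟩ := lift q hq
  rw [hp', hq']
  exact (SimplyConnectedSpace.paths_homotopic p' q').map ⟨_, continuous_subtype_val⟩

open Set Topology in
theorem exists_path_subset {U : Set X} [ContractibleSpace U] {x y : X} (hx : x ∈ U) (hy : y ∈ U) :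
    ∃ p : Path x y, range p ⊆ U := by
  let p := PathConnectedSpace.somePath (⟨x, hx⟩ : U) ⟨y, hy⟩
  refine ⟨p.map continuous_subtype_val, ?_⟩
  rintro _ ⟨t, rfl⟩
  exact (p t).2

open Set Topology in
/-- On a compact, locally contractible, metrizable space a bundle is determined up to gauge by
finitely many holonomies. -/
theorem exists_finite_data [CompactSpace X] [TopologicalSpace.MetrizableSpace X] [Finite Γ]
    (hX : ∀ x : X, ∀ N ∈ 𝓝 x, ∃ U ∈ 𝓝 x, U ⊆ N ∧ ContractibleSpace U)
    {J : Type} [Finite J] (b : J → X) :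
    ∃ (P : Set X) (k : X → X) (c : ∀ x, Path (k x) x) (D : GBundle Γ X → P × P → Γ),
      P.Finite ∧ (∀ x, k x ∈ P) ∧ (∀ (j : J) (ρ : GBundle Γ X), ρ.hol (c (b j)) = 1) ∧
      ∀ ρ σ : GBundle Γ X, D ρ = D σ → ∀ (x y : X) (p : Path x y),
        (ρ.hol (c y))⁻¹ * ρ.hol p * ρ.hol (c x) = (σ.hol (c y))⁻¹ * σ.hol p * σ.hol (c x) := by
  classical
  let _ := TopologicalSpace.metrizableSpaceMetric X
  choose U hU _ hUc using fun x : X => hX x univ Filter.univ_mem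
  obtain ⟨δ, hδ, hball⟩ := lebesgue_number_lemma_of_metric (isCompact_univ (X := X))
    (c := fun x => interior (U x)) (fun x => isOpen_interior)
    (fun x _ => mem_iUnion.2 ⟨x, mem_interior_iff_mem_nhds.2 (hU x)⟩)
  choose w hw using fun x : X => hball x (mem_univ x)
  have hW : ∀ x, Metric.ball x δ ⊆ U (w x) := fun x => (hw x).trans interior_subset
  have hε : 0 < δ / 4 := by positivity
  choose V hV hVb hVc using fun x : X => hX x _ (Metric.ball_mem_nhds x hε)
  obtain ⟨t, ht⟩ := CompactSpace.elim_nhds_subcover V hV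
  have hcov : ∀ x : X, ∃ p ∈ t, x ∈ V p := fun x => by
    have : x ∈ ⋃ p ∈ t, V p := ht ▸ mem_univ x
    simpa using this
  have hk : ∀ x : X, ∃ (p : X) (c : Path p x), p ∈ (t : Set X) ∪ range b ∧
      range c ⊆ Metric.ball p (δ / 4) ∧ (x ∈ range b → ∀ ρ : GBundle Γ X, ρ.hol c = 1) := by
    intro x
    by_cases hx : x ∈ range b
    · refine ⟨x, Path.refl x, Or.inr hx, ?_, fun _ ρ => hol_refl ρ x⟩
      rintro _ ⟨s, rfl⟩
      exact Metric.mem_ball_self hε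
    · obtain ⟨p, hp, hxp⟩ := hcov x
      obtain ⟨c, hc⟩ := exists_path_subset (mem_of_mem_nhds (hV p)) hxp
      exact ⟨p, c, Or.inl hp, hc.trans (hVb p), fun h => absurd h hx⟩
  choose k c hkP hc hcb using hk
  let D : GBundle Γ X → ((t : Set X) ∪ range b : Set X) × ((t : Set X) ∪ range b : Set X) → Γ :=
    fun ρ pq => if h : ∃ r : Path pq.1.1 pq.2.1, range r ⊆ U (w pq.1.1) then ρ.hol h.choose else 1
  refine ⟨_, k, c, D, t.finite_toSet.union (finite_range b), hkP,
    fun j ρ => hcb _ ⟨j, rfl⟩ ρ, ?_⟩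
  intro ρ σ hρσ
  -- short paths
  have short : ∀ (x y : X) (p : Path x y), range p ⊆ Metric.ball x (δ / 4) → ∀ τ : GBundle Γ X,
      (τ.hol (c y))⁻¹ * τ.hol p * τ.hol (c x) = D τ (⟨k x, hkP x⟩, ⟨k y, hkP y⟩) := by
    intro x y p hp τ
    let r : Path (k x) (k y) := ((c x).trans p).trans (c y).symm
    have hr : range r ⊆ U (w (k x)) := by
      refine Subset.trans ?_ (hW (k x))
      have h1 : dist x (k x) < δ / 4 := Metric.mem_ball.1 (hc x ⟨1, (c x).target⟩)
      have h2 : ∀ z ∈ range p, dist z (k x) < δ / 2 := fun z hz => by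
        have := Metric.mem_ball.1 (hp hz)
        linarith [dist_triangle z x (k x)]
      have h3 : dist y (k x) < δ / 2 := h2 y ⟨1, p.target⟩
      have h4 : dist y (k y) < δ / 4 := Metric.mem_ball.1 (hc y ⟨1, (c y).target⟩)
      rw [Path.trans_range, Path.trans_range, Path.symm_range]
      rintro z ((hz | hz) | hz)
      · have := Metric.mem_ball.1 (hc x hz)
        exact Metric.mem_ball.2 (by linarith)
      · exact Metric.mem_ball.2 (by linarith [h2 z hz])
      · have := Metric.mem_ball.1 (hc y hz)
        refine Metric.mem_ball.2 ?_
        linarith [dist_triangle z (k y) (k x), dist_triangle (k y) y (k x), dist_comm (k y) y]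
    have hex : ∃ r : Path (k x) (k y), range r ⊆ U (w (k x)) := ⟨r, hr⟩
    have hD : D τ (⟨k x, hkP x⟩, ⟨k y, hkP y⟩) = τ.hol hex.choose := dif_pos hex
    have := hUc (w (k x))
    rw [hD, hol_congr τ (homotopic_of_subset hex.choose_spec hr), hol_trans, hol_trans, hol_symm]
    simp [mul_assoc]
  have good_cast : ∀ (x y x' y' : X) (p : Path x y) (hx : x' = x) (hy : y' = y),
      (ρ.hol (c y'))⁻¹ * ρ.hol (p.cast hx hy) * ρ.hol (c x') =
        (σ.hol (c y'))⁻¹ * σ.hol (p.cast hx hy) * σ.hol (c x') →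
      (ρ.hol (c y))⁻¹ * ρ.hol p * ρ.hol (c x) = (σ.hol (c y))⁻¹ * σ.hol p * σ.hol (c x) := by
    rintro x y _ _ p rfl rfl h
    exact h
  intro x y p
  obtain ⟨s, hs0, hmono, ⟨n, hn⟩, hs⟩ := exists_monotone_Icc_subset_open_cover_unitInterval
    (c := fun r => p ⁻¹' Metric.ball (p r) (δ / 8))
    (fun r => Metric.isOpen_ball.preimage p.continuous)
    (fun r _ => mem_iUnion.2 ⟨r, Metric.mem_ball_self (by positivity)⟩)
  have main : ∀ m, (ρ.hol (c (p (s m))))⁻¹ * ρ.hol (p.subpath 0 (s m)) * ρ.hol (c (p 0)) =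
      (σ.hol (c (p (s m))))⁻¹ * σ.hol (p.subpath 0 (s m)) * σ.hol (c (p 0)) := by
    intro m
    induction m with
    | zero =>
      rw [hs0, Path.subpath_self, hol_refl, hol_refl]; simp
    | succ m ih =>
      have hstep := fun τ : GBundle Γ X => short _ _ (p.subpath (s m) (s (m + 1))) (by
        obtain ⟨r, hr⟩ := hs m
        rw [Path.range_subpath_of_le _ _ _ (hmono m.le_succ)]
        rintro _ ⟨a, ha, rfl⟩
        have h1 := Metric.mem_ball.1 (hr ha)
        have h2 := Metric.mem_ball.1 (hr (left_mem_Icc.2 (hmono m.le_succ)))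
        refine Metric.mem_ball.2 ?_
        linarith [dist_triangle_right (p a) (p (s m)) (p r)]) τ
      have hh : ∀ τ : GBundle Γ X, τ.hol (p.subpath 0 (s (m + 1))) =
          τ.hol (p.subpath (s m) (s (m + 1))) * τ.hol (p.subpath 0 (s m)) := fun τ => by
        rw [← hol_trans]
        exact (hol_congr τ ⟨Path.Homotopy.subpathTransSubpath p _ _ _⟩).symm
      have e : ∀ τ : GBundle Γ X, (τ.hol (c (p (s (m + 1)))))⁻¹ *
          τ.hol (p.subpath 0 (s (m + 1))) * τ.hol (c (p 0)) =
          ((τ.hol (c (p (s (m + 1)))))⁻¹ * τ.hol (p.subpath (s m) (s (m + 1))) *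
            τ.hol (c (p (s m)))) *
          ((τ.hol (c (p (s m))))⁻¹ * τ.hol (p.subpath 0 (s m)) * τ.hol (c (p 0))) := fun τ => by
        rw [hh]; group
      rw [e, e, ih, hstep, hstep, hρσ]
  have h1 := main n
  rw [hn n le_rfl, Path.subpath_zero_one] at h1
  exact good_cast _ _ _ _ p _ _ h1

/-- The isomorphism classes of bundles, where isomorphisms are trivial at the base points. -/
abbrev Cls (Γ : Type u) [Group Γ] {J : Type} (b : J → X) : Type u :=
  MulAction.orbitRel.Quotient (basedGauge Γ b) (GBundle Γ X)

open Topology in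
theorem finite_cls [CompactSpace X] [TopologicalSpace.MetrizableSpace X] [Finite Γ]
    (hX : ∀ x : X, ∀ N ∈ 𝓝 x, ∃ U ∈ 𝓝 x, U ⊆ N ∧ ContractibleSpace U)
    {J : Type} [Finite J] (b : J → X) : Finite (Cls Γ b) := by
  obtain ⟨P, k, c, D, hP, -, hb, hD⟩ := exists_finite_data (Γ := Γ) hX b
  have := hP.to_subtype
  refine Finite.of_injective (fun q : Cls Γ b => D q.out) fun q q' h => ?_
  rw [← Quotient.out_eq q, ← Quotient.out_eq q']
  refine (Quotient.sound ?_).symm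
  refine ⟨⟨fun x => (Quotient.out q').hol (c x) * ((Quotient.out q).hol (c x))⁻¹, fun j => ?_⟩, ?_⟩
  · simp [hb]
  · refine ext_hol fun x y p => ?_
    have := hD _ _ h x y p
    change ((Quotient.out q').hol (c y) * ((Quotient.out q).hol (c y))⁻¹) *
      (Quotient.out q).hol p * ((Quotient.out q').hol (c x) * ((Quotient.out q).hol (c x))⁻¹)⁻¹ = _
    rw [mul_inv_rev, inv_inv]
    calc _ = (Quotient.out q').hol (c y) * (((Quotient.out q).hol (c y))⁻¹ *
          (Quotient.out q).hol p * (Quotient.out q).hol (c x)) *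
          ((Quotient.out q').hol (c x))⁻¹ := by group
      _ = _ := by rw [this]; group

open Topology in
theorem finite_aut [CompactSpace X] [TopologicalSpace.MetrizableSpace X] [Finite Γ]
    (hX : ∀ x : X, ∀ N ∈ 𝓝 x, ∃ U ∈ 𝓝 x, U ⊆ N ∧ ContractibleSpace U)
    {J : Type} [Finite J] (b : J → X) (ρ : GBundle Γ X) :
    Finite (MulAction.stabilizer (basedGauge Γ b) ρ) := by
  obtain ⟨P, k, c, -, hP, hk, -, -⟩ := exists_finite_data (Γ := Γ) hX b
  have := hP.to_subtype
  refine Finite.of_injective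
    (fun (η : MulAction.stabilizer (basedGauge Γ b) ρ) (p : P) => η.1.1 p.1) fun η ζ h => ?_
  refine Subtype.ext (Subtype.ext (funext fun x => ?_))
  have e : ∀ η : MulAction.stabilizer (basedGauge Γ b) ρ,
      η.1.1 x = ρ.hol (c x) * η.1.1 (k x) * (ρ.hol (c x))⁻¹ := fun η => by
    have := congrArg (fun σ : GBundle Γ X => σ.hol (c x)) η.2
    change η.1.1 x * ρ.hol (c x) * (η.1.1 (k x))⁻¹ = ρ.hol (c x) at this
    rw [mul_inv_eq_iff_eq_mul] at this
    rw [← this]; group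
  rw [e η, e ζ]
  have := congrFun h ⟨k x, hk x⟩
  simp only at this
  rw [this]

end GBundle

open Topology Set in
/-- A surface with boundary is locally contractible. -/
theorem exists_contractible_nhds {X : Type u} [TopologicalSpace X]
    [ChartedSpace (EuclideanHalfSpace 2) X] (x : X) (N : Set X) (hN : N ∈ 𝓝 x) :
    ∃ U ∈ 𝓝 x, U ⊆ N ∧ ContractibleSpace U := by
  set e := chartAt (EuclideanHalfSpace 2) x
  have hx : x ∈ e.source := mem_chart_source _ x
  have h1 : e.target ∩ e.symm ⁻¹' N ∈ 𝓝 (e x) := by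
    refine Filter.inter_mem (e.open_target.mem_nhds (e.map_source hx)) ?_
    exact (e.continuousAt_symm (e.map_source hx)).preimage_mem_nhds (by rwa [e.left_inv hx])
  rw [(𝓡∂ 2).isClosedEmbedding.isEmbedding.nhds_eq_comap, Filter.mem_comap] at h1
  obtain ⟨t, ht, hts⟩ := h1
  obtain ⟨r, hr, hrt⟩ := Metric.mem_nhds_iff.1 ht
  set S : Set (EuclideanHalfSpace 2) := (𝓡∂ 2) ⁻¹' Metric.ball ((𝓡∂ 2) (e x)) r
  have hS : S ⊆ e.target ∩ e.symm ⁻¹' N := (preimage_mono hrt).trans hts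
  have hSo : IsOpen S := Metric.isOpen_ball.preimage (𝓡∂ 2).continuous
  refine ⟨e.symm '' S, ?_, ?_, ?_⟩
  · have : e.symm '' S ∈ 𝓝 (e.symm (e x)) := e.symm.image_mem_nhds (e.map_source hx)
      (hSo.mem_nhds (Metric.mem_ball_self hr))
    rwa [e.left_inv hx] at this
  · rintro _ ⟨s, hs, rfl⟩
    exact (hS hs).2
  · let f : S ≃ₜ e.symm '' S := e.symm.homeomorphOfImageSubsetSource
      (fun s hs => (hS hs).1) rfl
    let g : S ≃ₜ (𝓡∂ 2) '' S := (𝓡∂ 2).isClosedEmbedding.isEmbedding.homeomorphImage S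
    have hconv : Convex ℝ ((𝓡∂ 2) '' S) := by
      rw [image_preimage_eq_inter_range]
      exact (convex_ball _ _).inter (𝓡∂ 2).convex_range
    have hne : ((𝓡∂ 2) '' S).Nonempty := ⟨_, e x, Metric.mem_ball_self hr, rfl⟩
    have := hconv.contractibleSpace hne
    exact (f.symm.trans g).contractibleSpace


/-- `(v, w)` is a basis belonging to the orientation `o`. -/
def IsPositive {V : Type u} [AddCommGroup V] [Module ℝ V] (o : Orientation ℝ V (Fin 2))
    (v w : V) : Prop :=
  ∃ b : Module.Basis (Fin 2) ℝ V, b 0 = v ∧ b 1 = w ∧ b.orientation = o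

/-- The velocity at time `t` of the curve `s ↦ c (exp (i s))`, for a map `c` from the circle. -/
def velocity {X : Type u} [TopologicalSpace X] [ChartedSpace (EuclideanHalfSpace 2) X]
    (c : Circle → X) (t : ℝ) : TangentSpace (𝓡∂ 2) (c (Circle.exp t)) :=
  mfderiv 𝓘(ℝ, ℝ) (𝓡∂ 2) (fun s : ℝ => c (Circle.exp s)) t (1 : ℝ)

/-- A tangent vector at a boundary point is outward if its `0`-th coordinate, in the chart at
that point with values in `{x | 0 ≤ x 0}`, is negative. -/
def IsOutward {X : Type u} [TopologicalSpace X] [ChartedSpace (EuclideanHalfSpace 2) X]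
    {x : X} (w : TangentSpace (𝓡∂ 2) x) : Prop :=
  (show EuclideanSpace ℝ (Fin 2) from w) 0 < 0

/-- A compact oriented smooth surface with labelled boundary. The components of the boundary
are indexed by `I ⊕ O`; the label of the `j`-th component is recorded by its inverse, a
parametrization `label j` of the component by the unit circle. The components in `I` are those whose
label reverses the boundary orientation (`∂⁻`), the components in `O` are those whose label preserves
it (`∂⁺`); the boundary orientation is the one with the outward normal first. -/
structure Surface (I O : Type) where
  carrier : Type u
  [top : TopologicalSpace carrier]
  [t2 : T2Space carrier]
  [compact : CompactSpace carrier]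
  [charted : ChartedSpace (EuclideanHalfSpace 2) carrier]
  [smooth : IsManifold (𝓡∂ 2) ∞ carrier]
  orient : ∀ x : carrier, Orientation ℝ (TangentSpace (𝓡∂ 2) x) (Fin 2)
  orient_cont : ∀ x₀ : carrier, ∀ᶠ x in nhds x₀, ∀ v w : TangentSpace (𝓡∂ 2) x,
    IsPositive (orient x) v w → IsPositive (orient x₀)
      (tangentCoordChange (𝓡∂ 2) x x₀ x v) (tangentCoordChange (𝓡∂ 2) x x₀ x w)
  label : I ⊕ O → Circle → carrier
  label_smooth : ∀ j, ContMDiff (𝓡 1) (𝓡∂ 2) ∞ (label j)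
  label_inj : Function.Injective fun p : (I ⊕ O) × Circle => label p.1 p.2
  label_range : ⋃ j, Set.range (label j) = (𝓡∂ 2).boundary carrier
  label_in : ∀ (i : I) (t : ℝ) (w : TangentSpace (𝓡∂ 2) (label (Sum.inl i) (Circle.exp t))),
    IsOutward w → IsPositive (orient (label (Sum.inl i) (Circle.exp t)))
      w (-velocity (label (Sum.inl i)) t)
  label_out : ∀ (o : O) (t : ℝ) (w : TangentSpace (𝓡∂ 2) (label (Sum.inr o) (Circle.exp t))),
    IsOutward w → IsPositive (orient (label (Sum.inr o) (Circle.exp t)))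
      w (velocity (label (Sum.inr o)) t)

namespace Surface

attribute [instance] top t2 compact charted smooth

variable {I O I' O' : Type}

instance (B : Surface.{u} I O) : TopologicalSpace.MetrizableSpace B.carrier :=
  Manifold.metrizableSpace (𝓡∂ 2) B.carrier

/-- The base point of a boundary component. -/
def base (B : Surface.{u} I O) (j : I ⊕ O) : B.carrier := B.label j 1

theorem label_eq_iff (B : Surface.{u} I O) {j k : I ⊕ O} {z w : Circle} :
    B.label j z = B.label k w ↔ j = k ∧ z = w := by
  rw [← Prod.mk.injEq]
  exact B.label_inj.eq_iff (a := (j, z)) (b := (k, w))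

/-- Renaming of the boundary components. -/
def relabel (B : Surface.{u} I O) (a : I' ≃ I) (b : O' ≃ O) : Surface.{u} I' O' where
  carrier := B.carrier
  orient := B.orient
  orient_cont := B.orient_cont
  label j := B.label (Sum.map a b j)
  label_smooth j := B.label_smooth _
  label_inj p q h := by
    obtain ⟨h1, h2⟩ := B.label_eq_iff.1 h
    exact Prod.ext ((Sum.map_injective.2 ⟨a.injective, b.injective⟩) h1) h2
  label_range := by
    rw [← B.label_range]
    exact (Equiv.sumCongr a b).surjective.iUnion_comp fun j => Set.range (B.label j)
  label_in i := B.label_in (a i)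
  label_out o := B.label_out (b o)

theorem tangentCoordChange_inl {X Y : Type u} [TopologicalSpace X]
    [ChartedSpace (EuclideanHalfSpace 2) X] [IsManifold (𝓡∂ 2) ∞ X] [TopologicalSpace Y]
    [ChartedSpace (EuclideanHalfSpace 2) Y] [IsManifold (𝓡∂ 2) ∞ Y] (x y : X) :
    tangentCoordChange (𝓡∂ 2) (Sum.inl x : X ⊕ Y) (Sum.inl y) (Sum.inl x) =
      tangentCoordChange (𝓡∂ 2) x y x := by
  rw [tangentCoordChange_def, tangentCoordChange_def]
  have h : (extChartAt (𝓡∂ 2) (Sum.inl y : X ⊕ Y)) ∘ (extChartAt (𝓡∂ 2) (Sum.inl x : X ⊕ Y)).symm =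
      (extChartAt (𝓡∂ 2) y) ∘ (extChartAt (𝓡∂ 2) x).symm := by
    funext v
    simp [extChartAt, ChartedSpace.sum_chartAt_inl, Sum.inl_injective.extend_apply]
  rw [h]
  congr 1
  simp

theorem tangentCoordChange_inr {X Y : Type u} [TopologicalSpace X]
    [ChartedSpace (EuclideanHalfSpace 2) X] [IsManifold (𝓡∂ 2) ∞ X] [TopologicalSpace Y]
    [ChartedSpace (EuclideanHalfSpace 2) Y] [IsManifold (𝓡∂ 2) ∞ Y] (x y : Y) :
    tangentCoordChange (𝓡∂ 2) (Sum.inr x : X ⊕ Y) (Sum.inr y) (Sum.inr x) =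
      tangentCoordChange (𝓡∂ 2) x y x := by
  rw [tangentCoordChange_def, tangentCoordChange_def]
  have h : (extChartAt (𝓡∂ 2) (Sum.inr y : X ⊕ Y)) ∘ (extChartAt (𝓡∂ 2) (Sum.inr x : X ⊕ Y)).symm =
      (extChartAt (𝓡∂ 2) y) ∘ (extChartAt (𝓡∂ 2) x).symm := by
    funext v
    simp [extChartAt, ChartedSpace.sum_chartAt_inr, Sum.inr_injective.extend_apply]
  rw [h]
  congr 1
  simp

theorem velocity_inl {X Y : Type u} [TopologicalSpace X]
    [ChartedSpace (EuclideanHalfSpace 2) X] [TopologicalSpace Y]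
    [ChartedSpace (EuclideanHalfSpace 2) Y] {c : Circle → X} (hc : ContMDiff (𝓡 1) (𝓡∂ 2) ∞ c)
    (t : ℝ) : velocity (fun z => (Sum.inl (c z) : X ⊕ Y)) t = velocity c t := by
  have h1 : MDifferentiableAt 𝓘(ℝ, ℝ) (𝓡∂ 2) (fun s : ℝ => c (Circle.exp s)) t :=
    ((hc.comp contMDiff_circleExp).mdifferentiable (by simp)) t
  have h2 := HasMFDerivAt.comp t (hasMFDerivAt_inl (I := 𝓡∂ 2) (M := X) (M' := Y)
    (q := c (Circle.exp t))) h1.hasMFDerivAt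
  exact congrArg (fun L => L (1 : ℝ)) h2.mfderiv

theorem velocity_inr {X Y : Type u} [TopologicalSpace X]
    [ChartedSpace (EuclideanHalfSpace 2) X] [TopologicalSpace Y]
    [ChartedSpace (EuclideanHalfSpace 2) Y] {c : Circle → Y} (hc : ContMDiff (𝓡 1) (𝓡∂ 2) ∞ c)
    (t : ℝ) : velocity (fun z => (Sum.inr (c z) : X ⊕ Y)) t = velocity c t := by
  have h1 : MDifferentiableAt 𝓘(ℝ, ℝ) (𝓡∂ 2) (fun s : ℝ => c (Circle.exp s)) t :=
    ((hc.comp contMDiff_circleExp).mdifferentiable (by simp)) t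
  have h2 := HasMFDerivAt.comp t (hasMFDerivAt_inr (I := 𝓡∂ 2) (M := X) (M' := Y)
    (q' := c (Circle.exp t))) h1.hasMFDerivAt
  exact congrArg (fun L => L (1 : ℝ)) h2.mfderiv

/-- The disjoint union of two surfaces with labelled boundary. -/
def disjUnion (B : Surface.{u} I O) (B' : Surface.{u} I' O') :
    Surface.{u} (I ⊕ I') (O ⊕ O') where
  carrier := B.carrier ⊕ B'.carrier
  orient
    | Sum.inl x => B.orient x
    | Sum.inr x => B'.orient x
  orient_cont := by
    rintro (x₀ | x₀)
    · have := B.orient_cont x₀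
      rw [nhds_inl, Filter.eventually_map]
      filter_upwards [this] with x hx v w h
      rw [tangentCoordChange_inl]
      exact hx v w h
    · have := B'.orient_cont x₀
      rw [nhds_inr, Filter.eventually_map]
      filter_upwards [this] with x hx v w h
      rw [tangentCoordChange_inr]
      exact hx v w h
  label
    | Sum.inl (Sum.inl i), z => Sum.inl (B.label (Sum.inl i) z)
    | Sum.inl (Sum.inr i), z => Sum.inr (B'.label (Sum.inl i) z)
    | Sum.inr (Sum.inl o), z => Sum.inl (B.label (Sum.inr o) z)
    | Sum.inr (Sum.inr o), z => Sum.inr (B'.label (Sum.inr o) z)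
  label_smooth := by
    rintro ((i | i) | (o | o))
    · exact ContMDiff.inl.comp (B.label_smooth _)
    · exact ContMDiff.inr.comp (B'.label_smooth _)
    · exact ContMDiff.inl.comp (B.label_smooth _)
    · exact ContMDiff.inr.comp (B'.label_smooth _)
  label_inj := by
    rintro ⟨(i | i) | (o | o), z⟩ ⟨(i' | i') | (o' | o'), z'⟩ h <;>
    simp_all [label_eq_iff]
  label_range := by
    rw [ModelWithCorners.boundary_disjointUnion, ← B.label_range, ← B'.label_range]
    ext x
    simp only [Set.mem_iUnion, Set.mem_union, Set.mem_image, Set.mem_range]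
    constructor
    · rintro ⟨(i | i) | (o | o), z, rfl⟩
      · exact Or.inl ⟨_, ⟨_, z, rfl⟩, rfl⟩
      · exact Or.inr ⟨_, ⟨_, z, rfl⟩, rfl⟩
      · exact Or.inl ⟨_, ⟨_, z, rfl⟩, rfl⟩
      · exact Or.inr ⟨_, ⟨_, z, rfl⟩, rfl⟩
    · rintro (⟨_, ⟨i | o, z, rfl⟩, rfl⟩ | ⟨_, ⟨i | o, z, rfl⟩, rfl⟩)
      · exact ⟨Sum.inl (Sum.inl i), z, rfl⟩
      · exact ⟨Sum.inr (Sum.inl o), z, rfl⟩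
      · exact ⟨Sum.inl (Sum.inr i), z, rfl⟩
      · exact ⟨Sum.inr (Sum.inr o), z, rfl⟩
  label_in := by
    rintro (i | i) t w hw
    · have h := B.label_in i t w hw
      rw [← velocity_inl (Y := B'.carrier) (B.label_smooth _)] at h
      exact h
    · have h := B'.label_in i t w hw
      rw [← velocity_inr (X := B.carrier) (B'.label_smooth _)] at h
      exact h
  label_out := by
    rintro (o | o) t w hw
    · have h := B.label_out o t w hw
      rw [← velocity_inl (Y := B'.carrier) (B.label_smooth _)] at h
      exact h
    · have h := B'.label_out o t w hw
      rw [← velocity_inr (X := B.carrier) (B'.label_smooth _)] at h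
      exact h

end Surface


/-! ### Diffeomorphisms, submanifolds and cutting -/

/-- An orientation and label preserving diffeomorphism; it induces bijections of the sets of
incoming and of outgoing boundary components. -/
structure LDiffeo {I O I' O' : Type} (B : Surface.{u} I O) (B' : Surface.{u} I' O') where
  toDiffeo : Diffeomorph (𝓡∂ 2) (𝓡∂ 2) B.carrier B'.carrier ∞
  inEquiv : I ≃ I'
  outEquiv : O ≃ O'
  label_eq : ∀ j z, toDiffeo (B.label j z) = B'.label (Sum.map inEquiv outEquiv j) z
  orient_eq : ∀ (x : B.carrier) (v w : TangentSpace (𝓡∂ 2) x), IsPositive (B.orient x) v w →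
    IsPositive (B'.orient (toDiffeo x)) (mfderiv (𝓡∂ 2) (𝓡∂ 2) toDiffeo x v)
      (mfderiv (𝓡∂ 2) (𝓡∂ 2) toDiffeo x w)

/-- The induced bijection between the sets of boundary components. -/
def LDiffeo.bdry {I O I' O' : Type} {B : Surface.{u} I O} {B' : Surface.{u} I' O'}
    (f : LDiffeo B B') : I ⊕ O ≃ I' ⊕ O' :=
  Equiv.sumCongr f.inEquiv f.outEquiv

/-- The underlying continuous map of a diffeomorphism. -/
def LDiffeo.toContinuousMap {I O I' O' : Type} {B : Surface.{u} I O} {B' : Surface.{u} I' O'}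
    (f : LDiffeo B B') : C(B.carrier, B'.carrier) :=
  ⟨f.toDiffeo, f.toDiffeo.continuous⟩

/-- A closed 1-dimensional submanifold `A` of the interior of a surface, with components indexed
by `K`. As for boundary components, the label `A_k → S¹` of a component is recorded by its inverse,
the parametrization `curve k`. -/
structure CurveSystem {I O : Type} (B : Surface.{u} I O) (K : Type) where
  curve : K → Circle → B.carrier
  curve_smooth : ∀ k, ContMDiff (𝓡 1) (𝓡∂ 2) ∞ (curve k)
  curve_inj : Function.Injective fun p : K × Circle => curve p.1 p.2
  curve_immersed : ∀ k t, velocity (curve k) t ≠ 0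
  curve_interior : ∀ k z, curve k z ∈ (𝓡∂ 2).interior B.carrier

/-- `M` is the surface obtained by cutting `B` along `A`, with `∂M = -A ⊔ A ⊔ ∂B`: there is an
orientation preserving local diffeomorphism `M → B` onto `B` which respects the labels of `∂B`, maps
the two boundary components of `M` with index `k ∈ K` (an incoming and an outgoing one) to `A_k`,
compatibly with the labels, and is injective up to this identification. -/
structure Cut {I O K : Type} (B : Surface.{u} I O) (A : CurveSystem B K)
    (M : Surface.{u} (I ⊕ K) (O ⊕ K)) where
  map : M.carrier → B.carrier
  map_smooth : ContMDiff (𝓡∂ 2) (𝓡∂ 2) ∞ map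
  map_surjective : Function.Surjective map
  map_orient : ∀ (x : M.carrier) (v w : TangentSpace (𝓡∂ 2) x), IsPositive (M.orient x) v w →
    IsPositive (B.orient (map x)) (mfderiv (𝓡∂ 2) (𝓡∂ 2) map x v)
      (mfderiv (𝓡∂ 2) (𝓡∂ 2) map x w)
  map_in : ∀ i z, map (M.label (Sum.inl (Sum.inl i)) z) = B.label (Sum.inl i) z
  map_out : ∀ o z, map (M.label (Sum.inr (Sum.inl o)) z) = B.label (Sum.inr o) z
  map_curve_in : ∀ k z, map (M.label (Sum.inl (Sum.inr k)) z) = A.curve k z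
  map_curve_out : ∀ k z, map (M.label (Sum.inr (Sum.inr k)) z) = A.curve k z
  map_eq : ∀ x y, map x = map y → x = y ∨ ∃ k z,
    (x = M.label (Sum.inl (Sum.inr k)) z ∧ y = M.label (Sum.inr (Sum.inr k)) z) ∨
    (y = M.label (Sum.inl (Sum.inr k)) z ∧ x = M.label (Sum.inr (Sum.inr k)) z)

/-- The underlying continuous map of a cutting. -/
def Cut.toContinuousMap {I O K : Type} {B : Surface.{u} I O} {A : CurveSystem B K}
    {M : Surface.{u} (I ⊕ K) (O ⊕ K)} (q : Cut B A M) : C(M.carrier, B.carrier) :=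
  ⟨q.map, q.map_smooth.continuous⟩

/-- `B = B₁ ∪ B₂`, glued along `A = ∂⁺B₁ = -∂⁻B₂`: cutting `B` along `A` yields `B₁ ⊔ B₂`, where
the outgoing copy of `A_j` is the `j`-th outgoing component of `B₁`, and its incoming copy is the
`j`-th incoming component of `B₂`. -/
abbrev Gluing {I J L : Type} (B₁ : Surface.{u} I J) (B₂ : Surface.{u} J L) (B : Surface.{u} I L)
    (A : CurveSystem B J) : Type u :=
  Cut B A ((B₁.disjUnion B₂).relabel (Equiv.refl (I ⊕ J)) (Equiv.sumComm L J))

/-- The inclusion of the first summand of a disjoint union. -/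
def Surface.inlMap {I O I' O' : Type} (B : Surface.{u} I O) (B' : Surface.{u} I' O') :
    C(B.carrier, (B.disjUnion B').carrier) :=
  ⟨Sum.inl, continuous_inl⟩

/-- The inclusion of the second summand of a disjoint union. -/
def Surface.inrMap {I O I' O' : Type} (B : Surface.{u} I O) (B' : Surface.{u} I' O') :
    C(B'.carrier, (B.disjUnion B').carrier) :=
  ⟨Sum.inr, continuous_inr⟩

/-- The map `B₁ → B` of a gluing. -/
def Gluing.left {I J L : Type} {B₁ : Surface.{u} I J} {B₂ : Surface.{u} J L}
    {B : Surface.{u} I L} {A : CurveSystem B J} (q : Gluing B₁ B₂ B A) :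
    C(B₁.carrier, B.carrier) :=
  (Cut.toContinuousMap q).comp (Surface.inlMap B₁ B₂)

/-- The map `B₂ → B` of a gluing. -/
def Gluing.right {I J L : Type} {B₁ : Surface.{u} I J} {B₂ : Surface.{u} J L}
    {B : Surface.{u} I L} {A : CurveSystem B J} (q : Gluing B₁ B₂ B A) :
    C(B₂.carrier, B.carrier) :=
  (Cut.toContinuousMap q).comp (Surface.inrMap B₁ B₂)

/-! ### The DW invariant of a surface -/

section DW

variable (Γ : Type u) [Group Γ] {I O : Type} (B : Surface.{u} I O)

namespace Surface

/-- The loop at the base point running along the `j`-th boundary component in the direction given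
by its label. -/
def loop (j : I ⊕ O) : Path (B.base j) (B.base j) where
  toFun t := B.label j (Circle.exp (2 * Real.pi * t))
  continuous_toFun := (B.label_smooth j).continuous.comp (by fun_prop)
  source' := by simp [base]
  target' := by simp [base]

/-- The holonomies of a bundle along the boundary components, each with its boundary
orientation. -/
def bdryHol (ρ : GBundle Γ B.carrier) : I ⊕ O → Γ
  | Sum.inl i => (ρ.hol (B.loop (Sum.inl i)))⁻¹
  | Sum.inr o => ρ.hol (B.loop (Sum.inr o))

open Classical in
/-- The map `η_g : B → Γ` with value `g j` on the `j`-th boundary component and `e` elsewhere. -/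
def bdryGauge : (I ⊕ O → Γ) →* (B.carrier → Γ) where
  toFun g x := if h : ∃ (j : I ⊕ O) (z : Circle), B.label j z = x then g h.choose else 1
  map_one' := by funext x; simp
  map_mul' g h := by funext x; simp only [Pi.mul_apply]; split_ifs <;> simp

theorem bdryGauge_label (g : I ⊕ O → Γ) (j : I ⊕ O) (z : Circle) :
    B.bdryGauge Γ g (B.label j z) = g j := by
  have h : ∃ (k : I ⊕ O) (w : Circle), B.label k w = B.label j z := ⟨j, z, rfl⟩
  obtain ⟨w, hw⟩ := h.choose_spec
  exact (dif_pos h).trans (congrArg g (B.label_eq_iff.1 hw).1)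

theorem bdryHol_smul (η : B.carrier → Γ) (ρ : GBundle Γ B.carrier) :
    B.bdryHol Γ (η • ρ) = (η ∘ B.base) * B.bdryHol Γ ρ * (η ∘ B.base)⁻¹ := by
  funext j
  rcases j with i | o <;> simp [bdryHol, GBundle.hol_smul, mul_assoc]

/-- The isomorphism classes of bundles on `B`; isomorphisms are required to be trivial at the base
points of the boundary components. -/
abbrev Classes : Type u := GBundle.Cls Γ B.base

/-- The class of a bundle. -/
def cls (ρ : GBundle Γ B.carrier) : B.Classes Γ := Quotient.mk _ ρ

variable {Γ B} in
theorem cls_eq {ρ σ : GBundle Γ B.carrier} (η : B.carrier → Γ) (hη : ∀ j, η (B.base j) = 1)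
    (h : η • ρ = σ) : B.cls Γ ρ = B.cls Γ σ :=
  (Quotient.sound ⟨⟨η, hη⟩, h⟩ : B.cls Γ σ = B.cls Γ ρ).symm

/-- The boundary holonomies of a class. -/
def clsHol (c : B.Classes Γ) : I ⊕ O → Γ :=
  Quotient.lift (B.bdryHol Γ) (by
    rintro _ σ ⟨η, rfl⟩
    have h : (η.1 ∘ B.base) = 1 := funext η.2
    exact (B.bdryHol_smul Γ η.1 σ).trans (by simp [h])) c

/-- The order of the automorphism group of (a representative of) a class. -/
def clsAut (c : B.Classes Γ) : ℕ :=
  Quotient.lift (fun ρ : GBundle Γ B.carrier =>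
    Nat.card (MulAction.stabilizer (GBundle.basedGauge Γ B.base) ρ))
    (fun _ _ h => Nat.card_congr (MulAction.stabilizerEquivStabilizerOfOrbitRel h).toEquiv) c

/-- The action of `Γ^{π₀(∂B)}` on classes, `g · [ρ] = [η_g · ρ]`. -/
instance : MulAction (I ⊕ O → Γ) (B.Classes Γ) where
  smul g c := Quotient.map (fun ρ => B.bdryGauge Γ g • ρ) (by
    rintro _ σ ⟨η, rfl⟩
    refine ⟨⟨B.bdryGauge Γ g * η.1 * (B.bdryGauge Γ g)⁻¹, fun j => ?_⟩, ?_⟩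
    · have := η.2 j
      simp [this]
    · change (B.bdryGauge Γ g * η.1 * (B.bdryGauge Γ g)⁻¹) • B.bdryGauge Γ g • σ =
        B.bdryGauge Γ g • η.1 • σ
      simp [smul_smul]) c
  one_smul c := by
    induction c using Quotient.inductionOn with
    | h ρ => exact congrArg (B.cls Γ) (show B.bdryGauge Γ 1 • ρ = ρ by rw [map_one, one_smul])
  mul_smul g h c := by
    induction c using Quotient.inductionOn with
    | h ρ => exact congrArg (B.cls Γ) (show B.bdryGauge Γ (g * h) • ρ =
      B.bdryGauge Γ g • B.bdryGauge Γ h • ρ by rw [map_mul, mul_smul])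

theorem smul_cls (g : I ⊕ O → Γ) (ρ : GBundle Γ B.carrier) :
    g • B.cls Γ ρ = B.cls Γ (B.bdryGauge Γ g • ρ) := rfl

theorem clsHol_smul (g : I ⊕ O → Γ) (c : B.Classes Γ) :
    B.clsHol Γ (g • c) = g * B.clsHol Γ c * g⁻¹ := by
  induction c using Quotient.inductionOn with
  | h ρ =>
    have h : B.bdryGauge Γ g ∘ B.base = g := funext fun j => B.bdryGauge_label Γ g j 1
    exact (B.bdryHol_smul Γ _ ρ).trans (by rw [h]; rfl)

theorem clsAut_smul (g : I ⊕ O → Γ) (c : B.Classes Γ) : B.clsAut Γ (g • c) = B.clsAut Γ c := by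
  induction c using Quotient.inductionOn with
  | h ρ =>
    set η := B.bdryGauge Γ g
    have key : ∀ (ζ θ : B.carrier → Γ) (σ : GBundle Γ B.carrier), θ • σ = σ →
        (ζ * θ * ζ⁻¹) • ζ • σ = ζ • σ := fun ζ θ σ h => by
      rw [smul_smul, inv_mul_cancel_right, mul_smul, h]
    have mem : ∀ (ζ θ : B.carrier → Γ), (∀ j, θ (B.base j) = 1) →
        ∀ j, (ζ * θ * ζ⁻¹) (B.base j) = 1 := fun ζ θ h j => by simp [h j]
    let e : MulAction.stabilizer (GBundle.basedGauge Γ B.base) ρ ≃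
        MulAction.stabilizer (GBundle.basedGauge Γ B.base) (η • ρ) :=
      { toFun := fun θ => ⟨⟨η * θ.1.1 * η⁻¹, mem η _ θ.1.2⟩, key η _ ρ θ.2⟩
        invFun := fun θ => ⟨⟨η⁻¹ * θ.1.1 * η⁻¹⁻¹, mem η⁻¹ _ θ.1.2⟩, by
          have := key η⁻¹ _ _ θ.2
          rw [inv_smul_smul] at this
          exact this⟩
        left_inv := fun θ => Subtype.ext (Subtype.ext (by simp [mul_assoc]))
        right_inv := fun θ => Subtype.ext (Subtype.ext (by simp [mul_assoc])) }
    exact (Nat.card_congr e).symm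

instance [Finite Γ] [Finite I] [Finite O] : Finite (B.Classes Γ) :=
  GBundle.finite_cls exists_contractible_nhds B.base

instance [Finite Γ] [Finite I] [Finite O] : Fintype (B.Classes Γ) := Fintype.ofFinite _

theorem clsAut_pos [Finite Γ] [Finite I] [Finite O] (c : B.Classes Γ) : 0 < B.clsAut Γ c := by
  induction c using Quotient.inductionOn with
  | h ρ =>
    have := GBundle.finite_aut (Γ := Γ) exists_contractible_nhds B.base ρ
    exact Nat.card_pos

end Surface

/-- The vector space with basis the classes `[ρ]`, realized as the functions on the set of classes
(`[ρ]` corresponds to the function that is `1` at `[ρ]` and `0` elsewhere). -/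
def ZSpace : Type u := B.Classes Γ → ℂ

namespace ZSpace

instance : AddCommGroup (ZSpace Γ B) := inferInstanceAs (AddCommGroup (B.Classes Γ → ℂ))
instance : Module ℂ (ZSpace Γ B) := inferInstanceAs (Module ℂ (B.Classes Γ → ℂ))

/-- The coefficient of `[ρ]`. -/
def coeff (ρ : GBundle Γ B.carrier) : ZSpace Γ B →ₗ[ℂ] ℂ := LinearMap.proj (B.cls Γ ρ)

variable [Finite Γ] [Finite I] [Finite O]

instance : FiniteDimensional ℂ (ZSpace Γ B) :=
  inferInstanceAs (FiniteDimensional ℂ (B.Classes Γ → ℂ))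

/-- The inner product of `⨁_{[ρ]} (1 / #Aut ρ) · ℂ[ρ]`. -/
@[reducible]
def core : InnerProductSpace.Core ℂ (ZSpace Γ B) where
  inner v w := ∑ c : B.Classes Γ, (1 / (B.clsAut Γ c : ℂ)) * inner ℂ (v c) (w c)
  conj_inner_symm v w := by simp [map_sum, mul_comm]
  re_inner_nonneg v := by
    rw [map_sum]
    refine Finset.sum_nonneg fun c _ => ?_
    rw [inner_self_eq_norm_sq_to_K]
    simp only [RCLike.ofReal_eq_complex_ofReal, ← Complex.ofReal_pow, ← Complex.ofReal_natCast,
      ← Complex.ofReal_one, ← Complex.ofReal_div, ← Complex.ofReal_mul]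
    exact mul_nonneg (by positivity) (by positivity)
  add_left u v w := by
    rw [← Finset.sum_add_distrib]
    refine Finset.sum_congr rfl fun c _ => ?_
    rw [← mul_add, ← inner_add_left]
    rfl
  smul_left v w r := by
    rw [Finset.mul_sum]
    refine Finset.sum_congr rfl fun c _ => ?_
    have : (r • v) c = r • v c := rfl
    rw [this, inner_smul_left]
    ring
  definite v h := by
    have h1 : ∑ c : B.Classes Γ, (1 / (B.clsAut Γ c : ℝ)) * ‖v c‖ ^ 2 = 0 := by
      have h2 : ((∑ c : B.Classes Γ, (1 / (B.clsAut Γ c : ℝ)) * ‖v c‖ ^ 2 : ℝ) : ℂ) = 0 := by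
        rw [← h]
        push_cast
        refine Finset.sum_congr rfl fun c _ => ?_
        rw [inner_self_eq_norm_sq_to_K]
        rfl
      exact_mod_cast h2
    rw [Finset.sum_eq_zero_iff_of_nonneg (fun c _ => by positivity)] at h1
    funext c
    have h3 := (mul_eq_zero.1 (h1 c (Finset.mem_univ c))).resolve_left
      (one_div_ne_zero (by exact_mod_cast (B.clsAut_pos Γ c).ne'))
    exact norm_eq_zero.1 (pow_eq_zero_iff two_ne_zero |>.1 h3)

instance : NormedAddCommGroup (ZSpace Γ B) := (core Γ B).toNormedAddCommGroup
instance : InnerProductSpace ℂ (ZSpace Γ B) := .ofCore (core Γ B).toCore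

theorem inner_def (v w : ZSpace Γ B) :
    inner ℂ v w = ∑ c : B.Classes Γ, (1 / (B.clsAut Γ c : ℂ)) * inner ℂ (v c) (w c) := rfl

end ZSpace

variable [Finite Γ] [Finite I] [Finite O]

/-- The DW invariant `Z(B)`, an object of `ℰ^{⊠π₀(∂B)}`: the space
`⨁_{[ρ]} (1 / #Aut ρ) · ℂ[ρ]`, where `[ρ]` is homogeneous of degree the tuple of its boundary
holonomies, and `g [ρ] = [η_g · ρ]`. If every component of `B` has nonempty boundary, all the
groups `Aut ρ` (of automorphisms trivial at the base points) are trivial. -/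
def Z : EObj Γ (I ⊕ O) where
  V := ZSpace Γ B
  grade x :=
    { carrier := {v | ∀ c, B.clsHol Γ c ≠ x → v c = 0}
      add_mem' := fun {v w} hv hw c hc => by
        change v c + w c = 0
        rw [hv c hc, hw c hc, add_zero]
      zero_mem' := fun _ _ => rfl
      smul_mem' := fun a v hv c hc => by
        change a * v c = 0
        rw [hv c hc, mul_zero] }
  ortho x y h := by
    rw [Submodule.isOrtho_iff_inner_eq]
    intro v hv w hw
    rw [ZSpace.inner_def]
    refine Finset.sum_eq_zero fun c _ => ?_
    by_cases hc : B.clsHol Γ c = x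
    · rw [hw c (hc ▸ h), inner_zero_right, mul_zero]
    · rw [hv c hc, inner_zero_left, mul_zero]
  span := by
    classical
    rw [eq_top_iff]
    intro v _
    have hv : v = ∑ c : B.Classes Γ, (Pi.single c (v c) : B.Classes Γ → ℂ) :=
      (Finset.univ_sum_single v).symm
    rw [hv]
    refine Submodule.sum_mem _ fun c _ => Submodule.mem_iSup_of_mem (B.clsHol Γ c) ?_
    intro d hd
    exact Pi.single_eq_of_ne (fun h : d = c => hd (congrArg (B.clsHol Γ) h)) _
  act :=
    { toFun := fun g => LinearMap.funLeft ℂ ℂ fun c : B.Classes Γ => g⁻¹ • c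
      map_one' := by
        refine LinearMap.ext fun v => funext fun c => ?_
        exact congrArg v (show (1 : I ⊕ O → Γ)⁻¹ • c = c by rw [inv_one, one_smul])
      map_mul' := fun g h => by
        refine LinearMap.ext fun v => funext fun c => ?_
        exact congrArg v (show (g * h)⁻¹ • c = h⁻¹ • g⁻¹ • c by rw [mul_inv_rev, mul_smul]) }
  act_inner g v w := by
    rw [ZSpace.inner_def, ZSpace.inner_def]
    refine Fintype.sum_equiv (MulAction.toPerm g⁻¹) _ _ fun c => ?_
    rw [MulAction.toPerm_apply, Surface.clsAut_smul]
    rfl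
  act_grade g x v h c hc := by
    refine h _ fun h' => hc ?_
    rw [Surface.clsHol_smul] at h'
    rw [← h']
    group

end DW

/-! ### The DW functor, gluing, and induced maps -/

/-- The pull-back of classes of bundles along a label preserving diffeomorphism. -/
def LDiffeo.pullCls (Γ : Type u) [Group Γ] {I O I' O' : Type} {B : Surface.{u} I O}
    {B' : Surface.{u} I' O'} (f : LDiffeo B B') : B'.Classes Γ → B.Classes Γ :=
  Quotient.map (GBundle.pull f.toContinuousMap) (by
    rintro _ σ ⟨η, rfl⟩
    refine ⟨⟨η.1 ∘ f.toDiffeo, fun j => ?_⟩, rfl⟩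
    exact (congrArg η.1 (f.label_eq j 1)).trans (η.2 _))

/-- The map `f_* : Z(B) → Z(B')`, `[ρ] ↦ [ρ ∘ f⁻¹]`, induced by a label preserving
diffeomorphism `f : B → B'`: the coefficient of `[ρ']` in `f_* v` is that of `[ρ' ∘ f]` in `v`. -/
def ZSpace.push (Γ : Type u) [Group Γ] {I O I' O' : Type} {B : Surface.{u} I O}
    {B' : Surface.{u} I' O'} (f : LDiffeo B B') : ZSpace Γ B →ₗ[ℂ] ZSpace Γ B' :=
  LinearMap.funLeft ℂ ℂ (f.pullCls Γ)

/-- The bijection that brings `ℰ^{⊠I} ⊠ ℰ^{⊠(I ⊔ O)}` into the form required for a contraction: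
the index `x` of the first factor is paired with the index `x⁻¹` of the incoming part of the second
one. -/
def pairing (I O : Type) : I ⊕ (I ⊕ O) ≃ O ⊕ (I ⊕ I) where
  toFun
    | Sum.inl i => Sum.inr (Sum.inr i)
    | Sum.inr (Sum.inl i) => Sum.inr (Sum.inl i)
    | Sum.inr (Sum.inr o) => Sum.inl o
  invFun
    | Sum.inr (Sum.inr i) => Sum.inl i
    | Sum.inr (Sum.inl i) => Sum.inr (Sum.inl i)
    | Sum.inl o => Sum.inr (Sum.inr o)
  left_inv := by rintro (i | i | o) <;> rfl
  right_inv := by rintro (o | i | i) <;> rfl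

/-- The inclusion of `⨁_y (⨁_x U_{y,x⁻¹,x})^{Γ^K}` into `U`, as a linear map. -/
def contractVal {Γ : Type u} [Group Γ] [Finite Γ] {J K : Type} [Finite K]
    (U : EObj Γ (J ⊕ (K ⊕ K))) : ((contractFunctor Γ J K).obj U).V →ₗ[ℂ] U.V :=
  U.contractSpace.subtype ∘ₗ (Scaled.equiv (contractFactor Γ K) U.contractSpace).symm.toLinearMap

/-- The DW functor `Ẑ(B) : ℰ^{⊠I} → ℰ^{⊠O}`,
`(Ẑ(B)(U))_y = (#Γ)^{-#I} · (⨁_x U_x ⊗ Z(B)_{x⁻¹,y})^{Γ^I}`. -/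
def ZHat (Γ : Type u) [Group Γ] [Finite Γ] {I O : Type} [Finite I] [Finite O]
    (B : Surface.{u} I O) : EObj Γ I ⥤ EObj Γ O :=
  CategoryTheory.Prod.sectL (EObj Γ I) (Z Γ B) ⋙ extFunctor Γ I (I ⊕ O) ⋙
    reindexFunctor Γ (pairing I O) ⋙ contractFunctor Γ O I

/-- The inclusion of `Ẑ(B)(U)` into `U ⊗ Z(B)`, as a linear map. -/
def ZHat.val (Γ : Type u) [Group Γ] [Finite Γ] {I O : Type} [Finite I] [Finite O]
    (B : Surface.{u} I O) (U : EObj Γ I) : ((ZHat Γ B).obj U).V →ₗ[ℂ] U.V ⊗[ℂ] ZSpace Γ B :=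
  contractVal (EObj.reindex (pairing I O) (U.ext (Z Γ B)))

/-- The gluing functor
`gl(U)_{y,z} = (#Γ)^{-#K} · (⨁_{x ∈ Γ^K} U_{(y,x⁻¹),(x,z)})^{Γ^K}`. -/
def glFunctor (Γ : Type u) [Group Γ] [Finite Γ] (I O K : Type) [Finite K] :
    EObj Γ ((I ⊕ K) ⊕ (O ⊕ K)) ⥤ EObj Γ (I ⊕ O) :=
  reindexFunctor Γ (Equiv.sumSumSumComm I K O K) ⋙ contractFunctor Γ (I ⊕ O) K

/-- The inclusion of `gl(U)` into `U`, as a linear map. -/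
def glVal {Γ : Type u} [Group Γ] [Finite Γ] {I O K : Type} [Finite K]
    (U : EObj Γ ((I ⊕ K) ⊕ (O ⊕ K))) : ((glFunctor Γ I O K).obj U).V →ₗ[ℂ] U.V :=
  contractVal (EObj.reindex (Equiv.sumSumSumComm I K O K) U)

/-- For surfaces `B₁` (with boundary indexed by `I ⊔ J`) and `B₂` (with boundary indexed by
`J ⊔ L`) the tensor product `Z(B₂) ⊠ Z(B₁)`, with its index set reordered so that the incoming
components come first. -/
def Z₂ (Γ : Type u) [Group Γ] [Finite Γ] {I J L : Type} [Finite I] [Finite J] [Finite L]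
    (B₁ : Surface.{u} I J) (B₂ : Surface.{u} J L) : EObj Γ ((I ⊕ J) ⊕ (L ⊕ J)) :=
  EObj.reindex ((Equiv.sumSumSumComm J L I J).trans
    (Equiv.sumCongr (Equiv.sumComm J I) (Equiv.refl (L ⊕ J)))) ((Z Γ B₂).ext (Z Γ B₁))

/-- The coefficient of `[ρ] ⊗ [ρ']` of an element of `Z(B) ⊗ Z(B')`. -/
def coeff₂ {Γ : Type u} [Group Γ] {I O I' O' : Type} {B : Surface.{u} I O}
    {B' : Surface.{u} I' O'} (ρ : GBundle Γ B.carrier) (ρ' : GBundle Γ B'.carrier) :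
    ZSpace Γ B ⊗[ℂ] ZSpace Γ B' →ₗ[ℂ] ℂ :=
  LinearMap.mul' ℂ ℂ ∘ₗ TensorProduct.map (ZSpace.coeff Γ B ρ) (ZSpace.coeff Γ B' ρ')

/-- A functor that is linear on morphisms. -/
def IsLinearFunctor {Γ : Type u} [Group Γ] {J J' : Type} (F : EObj Γ J ⥤ EObj Γ J') : Prop :=
  ∀ (U W : EObj Γ J) (f g h : U ⟶ W) (a : ℂ), EObj.lin h = EObj.lin f + a • EObj.lin g →
    EObj.lin (F.map h) = EObj.lin (F.map f) + a • EObj.lin (F.map g)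

/-- `H ≅ F ⊠ G`: the functor `H` is linear and, naturally in both variables,
`H(U ⊠ W) ≅ F(U) ⊠ G(W)`. (Every object of `ℰ^{⊠(I ⊔ I')}` is isomorphic to a direct sum of
external tensor products, so this determines `H` up to isomorphism.) -/
def IsExtProduct {Γ : Type u} [Group Γ] {I I' O O' : Type} (F : EObj Γ I ⥤ EObj Γ O)
    (G : EObj Γ I' ⥤ EObj Γ O') (H : EObj Γ (I ⊕ I') ⥤ EObj Γ (O ⊕ O')) : Prop :=
  IsLinearFunctor H ∧
    Nonempty (extFunctor Γ I I' ⋙ H ≅ Functor.prod F G ⋙ extFunctor Γ O O')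
end

/-! A class of bundles is an orbit under gauge maps that are trivial at the base points. Each
assertion about `Z` therefore reduces to a relation between finite sets of classes that respects
boundary holonomies, the action of Γ^{π₀(∂B)} and the weights 1/#Aut. For a diffeomorphism the
relation is pull-back. For a disjoint union a class is a pair of classes and automorphism groups
multiply; `SumDecomp` records this once, for disjoint unions and for the two parts of a glued
surface.

For a cut `q : M → B` along curves indexed by K, two facts carry the proof. A bundle on M whose
holonomies along the two copies of each curve agree is, after a based gauge change, a pull-back
(`Cut.exists_cls_pull_eq`). A gauge map between pull-backs that agrees at the two copies of each
base point descends to B (`Cut.exists_gauge_eq`). Hence the classes c on M lying over a class b on B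
form one orbit of Γ^K. Evaluation at the base points of the curves maps Aut τ to Γ^K, with kernel
Aut(q^*τ) and image the stabilizer of [q^*τ]. So #(classes over b) · #Aut b = #Γ^K · #Aut c
(`Cut.Rel.card_mul`), which is the normalization that makes v ↦ (c ↦ v b) an isometry onto the
contraction.

The topological core is descent along q. Local sections with locally constant transition functions
form a principal covering, and lifting paths to it defines holonomies (`GBundle.exists_hol_eq`).
Since q is closed, data that agree near a whole fibre of q agree over a neighbourhood downstairs.
Only local contractibility is used, no collars of the curves.

For the functors, an element of `ZHat Γ B` at U is a function F from classes to U with F c of degree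
`inHol c` and equivariant under Γ^I (`ZHat.mem_contractSpace_iff`). Diffeomorphisms act by
precomposition. On a disjoint union s ⊗ t becomes c ↦ s(c₁) ⊗ t(c₂); evaluations are jointly
injective, and averages over Γ^I give surjectivity. For a gluing, a function on classes of B becomes
a function of pairs (c₂, c₁), zero where the holonomies along the common boundary disagree, and this
is exactly an element of the composite functor. -/

noncomputable section

/-! ### Bundles from local sections: parallel transport by covering spaces -/

namespace GBundle

variable {Γ X : Type u} [Group Γ]

/-- `F` is a parallel section along `p` with respect to the local sections `f b`, defined near
`b`. -/
def IsParallel {A : Type*} [TopologicalSpace A] (f : X → X → Γ) (p : A → X) (F : A → Γ) : Prop :=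
  ∀ a, ∀ᶠ s in nhds a, (f (p a) (p s))⁻¹ * F s = (f (p a) (p a))⁻¹ * F a

theorem IsParallel.comp {A A' : Type*} [TopologicalSpace A] [TopologicalSpace A'] {f : X → X → Γ}
    {p : A → X} {F : A → Γ} (h : IsParallel f p F) {g : A' → A} (hg : Continuous g) :
    IsParallel f (p ∘ g) (F ∘ g) :=
  fun a => (hg.tendsto a).eventually (h (g a))

/-- Both sections have locally constant coordinates in the same local chart, so `F⁻¹ * F'` is
locally constant and hence constant. The transport `F b * (F a)⁻¹` thus depends only on `p` and can
serve as a holonomy. -/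
theorem IsParallel.unique {A : Type*} [TopologicalSpace A] [PreconnectedSpace A] {f : X → X → Γ}
    {p : A → X} {F F' : A → Γ} (h : IsParallel f p F) (h' : IsParallel f p F') (a b : A) :
    F b * (F a)⁻¹ = F' b * (F' a)⁻¹ := by
  have hl : IsLocallyConstant fun a => (F a)⁻¹ * F' a := by
    rw [IsLocallyConstant.iff_eventually_eq]
    intro a
    filter_upwards [h a, h' a] with s hs hs'
    rw [inv_mul_eq_iff_eq_mul] at hs hs'
    rw [hs, hs']
    group
  have := hl.apply_eq_of_preconnectedSpace a b
  rw [inv_mul_eq_iff_eq_mul] at this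
  rw [this]
  group

variable [TopologicalSpace X]

/-- A bundle given by its holonomies. -/
def ofHol (h : ∀ {x y : X}, Path x y → Γ)
    (h_congr : ∀ {x y : X} {p q : Path x y}, p.Homotopic q → h p = h q)
    (h_refl : ∀ x : X, h (Path.refl x) = 1)
    (h_trans : ∀ {x y z : X} (p : Path x y) (q : Path y z), h (p.trans q) = h q * h p) :
    GBundle Γ X where
  obj _ := SingleObj.star Γ
  map {x y} p := (Quotient.lift (fun q : Path x.as y.as => h q) (fun _ _ => h_congr) p : Γ)
  map_id x := h_refl x.as
  map_comp {x y z} p q := by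
    induction p using Quotient.inductionOn
    induction q using Quotient.inductionOn
    exact h_trans _ _

theorem hol_ofHol (h : ∀ {x y : X}, Path x y → Γ) (h1 h2 h3) {x y : X} (p : Path x y) :
    (ofHol (X := X) h h1 h2 h3).hol p = h p := rfl

/-- The transition functions `(f c x)⁻¹ * f b x` are locally constant, so they glue the sets `V b ×
Γ`, with Γ discrete, to a fibre bundle that is a covering of `X`. A map from a simply connected,
locally path connected space lifts to it, and the lift is the section. -/
theorem exists_isParallel {A : Type*} [TopologicalSpace A] [SimplyConnectedSpace A]
    [LocallyPathConnectedSpace A] (V : X → Set X) (hV : ∀ b, IsOpen (V b)) (hVb : ∀ b, b ∈ V b)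
    (f : X → X → Γ) (hf : ∀ b c y, y ∈ V b → y ∈ V c →
      ∀ᶠ z in nhds y, (f c z)⁻¹ * f b z = (f c y)⁻¹ * f b y) (p : C(A, X)) :
    ∃ F : A → Γ, IsParallel f p F := by
  let _ : TopologicalSpace Γ := ⊥
  have : DiscreteTopology Γ := ⟨rfl⟩
  let Z : FiberBundleCore X X Γ :=
    { baseSet := V
      isOpen_baseSet := hV
      indexAt := id
      mem_baseSet_at := hVb
      coordChange := fun b c x v => (f c x)⁻¹ * f b x * v
      coordChange_self := fun b x _ v => by simp
      continuousOn_coordChange := fun b c => by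
        rintro ⟨y, v⟩ ⟨⟨hyb, hyc⟩, -⟩
        refine ContinuousAt.continuousWithinAt ?_
        have h1 : (fun q : X × Γ => (f c q.1)⁻¹ * f b q.1 * q.2) =ᶠ[nhds (y, v)]
            fun q => (f c y)⁻¹ * f b y * q.2 := by
          have := (continuous_fst (X := X) (Y := Γ)).tendsto (y, v) |>.eventually (hf b c y hyb hyc)
          filter_upwards [this] with q hq
          rw [hq]
        refine ContinuousAt.congr ?_ h1.symm
        exact (continuous_of_discreteTopology (f := fun w : Γ => (f c y)⁻¹ * f b y * w)).continuousAt.comp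
          continuousAt_snd
      coordChange_comp := fun b c d x _ v => by group }
  have cov : IsCoveringMap Z.proj := FiberBundle.isCoveringMap (F := Γ) (E := Z.Fiber)
  obtain ⟨a₀⟩ : Nonempty A := inferInstance
  obtain ⟨P, hP, -⟩ := cov.existsUnique_continuousMap_lifts p a₀ ⟨p a₀, (1 : Γ)⟩ rfl
  have hPp : ∀ a, (P a).1 = p a := fun a => congrFun hP.2 a
  -- The fibre over `x` is stored in the chart indexed by `x` itself, so multiplying by `f x x`
  -- recovers the value of the section. In the chart at `p a` the coordinate of the lift is
  -- continuous with discrete target, hence locally constant.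
  let val : Z.TotalSpace → Γ := fun e => f e.1 e.1 * (show Γ from e.2)
  refine ⟨fun a => val (P a), fun a => ?_⟩
  have hsrc : P a ∈ (Z.localTriv (p a)).source := by
    rw [FiberBundleCore.mem_localTriv_source, hPp]
    exact hVb _
  have h1 : ContinuousAt (fun s => ((Z.localTriv (p a)) (P s)).2) a :=
    continuousAt_snd.comp (((Z.localTriv (p a)).continuousAt hsrc).comp P.continuous.continuousAt)
  have h2 : ∀ s, ((Z.localTriv (p a)) (P s)).2 = (f (p a) (p s))⁻¹ * val (P s) := by
    intro s
    rw [FiberBundleCore.localTriv_apply, ← hPp s]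
    exact mul_assoc (f (p a) (P s).1)⁻¹ (f (P s).1 (P s).1) (show Γ from (P s).2)
  have h3 := h1.eventually_mem ((isOpen_discrete {((Z.localTriv (p a)) (P a)).2}).mem_nhds rfl)
  filter_upwards [h3] with s hs
  rw [← h2, ← h2]
  exact hs

-- Clamping the coordinates retracts the plane onto the square. The section is found over the plane
-- and restricted.
open unitInterval in
theorem exists_isParallel_square (V : X → Set X) (hV : ∀ b, IsOpen (V b)) (hVb : ∀ b, b ∈ V b)
    (f : X → X → Γ) (hf : ∀ b c y, y ∈ V b → y ∈ V c →
      ∀ᶠ z in nhds y, (f c z)⁻¹ * f b z = (f c y)⁻¹ * f b y) (p : C(I × I, X)) :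
    ∃ F : I × I → Γ, IsParallel f p F := by
  let r : ℝ × ℝ → I × I := Prod.map (Set.projIcc 0 1 zero_le_one) (Set.projIcc 0 1 zero_le_one)
  have hr : Continuous r := continuous_projIcc.prodMap continuous_projIcc
  obtain ⟨F, hF⟩ := exists_isParallel V hV hVb f hf (p.comp ⟨r, hr⟩)
  let i : I × I → ℝ × ℝ := Prod.map Subtype.val Subtype.val
  have hi : Continuous i := continuous_subtype_val.prodMap continuous_subtype_val
  refine ⟨F ∘ i, ?_⟩
  have e : p = (p ∘ r) ∘ i := by
    funext x
    simp only [Function.comp, r, i, Prod.map, Set.projIcc_val]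
  rw [e]
  exact hF.comp hi

open unitInterval in
theorem exists_isParallel_path (V : X → Set X) (hV : ∀ b, IsOpen (V b)) (hVb : ∀ b, b ∈ V b)
    (f : X → X → Γ) (hf : ∀ b c y, y ∈ V b → y ∈ V c →
      ∀ᶠ z in nhds y, (f c z)⁻¹ * f b z = (f c y)⁻¹ * f b y) {x y : X} (p : Path x y) :
    ∃ F : I → Γ, IsParallel f p F := by
  obtain ⟨F, hF⟩ := exists_isParallel_square V hV hVb f hf
    (p.toContinuousMap.comp ⟨Prod.fst, continuous_fst⟩)
  exact ⟨_, hF.comp (g := fun t => (t, 0)) (by fun_prop)⟩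

open unitInterval in
/-- Local sections with locally constant transition functions determine a bundle. -/
theorem exists_hol_eq (V : X → Set X) (hV : ∀ b, IsOpen (V b)) (hVb : ∀ b, b ∈ V b)
    (f : X → X → Γ) (hf : ∀ b c y, y ∈ V b → y ∈ V c →
      ∀ᶠ z in nhds y, (f c z)⁻¹ * f b z = (f c y)⁻¹ * f b y) :
    ∃ τ : GBundle Γ X, ∀ (b x y : X) (p : Path x y), Set.range p ⊆ V b →
      τ.hol p = f b y * (f b x)⁻¹ := by
  choose F hF using fun (x y : X) (p : Path x y) => exists_isParallel_path V hV hVb f hf p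
  -- The chosen section does not matter, by `IsParallel.unique`; `hh` allows any parallel section to
  -- be used for computing `h`.
  let h : ∀ {x y : X}, Path x y → Γ := fun {x y} p => F x y p 1 * (F x y p 0)⁻¹
  have hh : ∀ {x y : X} (p : Path x y) (G : I → Γ), IsParallel f p G → h p = G 1 * (G 0)⁻¹ :=
    fun p G hG => (hF _ _ p).unique hG 0 1
  have hconst : ∀ (x : X) (g : Γ), IsParallel f (fun _ : I => x) (fun _ => g) := fun x g a =>
    Filter.Eventually.of_forall fun s => rfl
  refine ⟨ofHol h ?_ ?_ ?_, ?_⟩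
  -- A parallel section over the square of the homotopy is constant on the two sides where `H` is
  -- constant, so its transports along the other two sides, which are `p` and `q`, agree.
  · rintro x y p q ⟨H⟩
    obtain ⟨G, hG⟩ := exists_isParallel_square V hV hVb f hf H.toContinuousMap
    have h0 := hG.comp (g := fun t : I => ((0 : I), t)) (by fun_prop)
    have h1 := hG.comp (g := fun t : I => ((1 : I), t)) (by fun_prop)
    have h2 := hG.comp (g := fun t : I => (t, (0 : I))) (by fun_prop)
    have h3 := hG.comp (g := fun t : I => (t, (1 : I))) (by fun_prop)
    have e0 : (H.toContinuousMap ∘ fun t : I => ((0 : I), t)) = p := funext fun t => H.apply_zero t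
    have e1 : (H.toContinuousMap ∘ fun t : I => ((1 : I), t)) = q := funext fun t => H.apply_one t
    have e2 : (H.toContinuousMap ∘ fun t : I => (t, (0 : I))) = fun _ => x :=
      funext fun t => H.source t
    have e3 : (H.toContinuousMap ∘ fun t : I => (t, (1 : I))) = fun _ => y :=
      funext fun t => H.target t
    rw [e0] at h0; rw [e1] at h1; rw [e2] at h2; rw [e3] at h3
    rw [hh p _ h0, hh q _ h1]
    have k2 := h2.unique (hconst x 1) 0 1
    have k3 := h3.unique (hconst y 1) 0 1
    simp only [Function.comp, mul_one, inv_one, mul_inv_eq_one] at k2 k3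
    simp only [Function.comp, k2, k3]
  · intro x
    rw [hh (Path.refl x) _ (hconst x 1)]
    simp
  · intro x y z p q
    have hG := hF x z (p.trans q)
    -- One section along the concatenation restricts to both halves; the value at the common
    -- midpoint cancels.
    let g1 : I → I := fun t => ⟨t / 2, by constructor <;> linarith [t.2.1, t.2.2]⟩
    let g2 : I → I := fun t => ⟨(t + 1) / 2, by constructor <;> linarith [t.2.1, t.2.2]⟩
    have c1 : Continuous g1 := by fun_prop
    have c2 : Continuous g2 := by fun_prop
    have e1 : (p.trans q) ∘ g1 = p := by
      funext t
      have : ((g1 t : I) : ℝ) ≤ 1 / 2 := by simp only [g1]; linarith [t.2.2]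
      simp only [Function.comp, Path.trans_apply, this, dif_pos]
      congr 1
      ext; simp [g1]; ring
    have e2 : (p.trans q) ∘ g2 = q := by
      funext t
      -- The midpoint of the concatenation belongs to the first branch of `Path.trans`, so there the
      -- end of `p` must be identified with the start of `q`.
      by_cases h0 : t = 0
      · subst h0
        have : ((g2 0 : I) : ℝ) ≤ 1 / 2 := by simp [g2]
        simp only [Function.comp, Path.trans_apply, this, dif_pos]
        rw [Path.source]
        refine Eq.trans (congrArg p ?_) p.target
        ext; simp [g2]
      have hpos : (0 : ℝ) < t := lt_of_le_of_ne t.2.1 fun h => h0 (Subtype.ext h.symm)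
      have : ¬ ((g2 t : I) : ℝ) ≤ 1 / 2 := by simp only [g2]; linarith
      simp only [Function.comp, Path.trans_apply, this, dif_neg, not_false_iff]
      congr 1
      ext; simp [g2]; ring
    have k1 := hG.comp c1
    have k2 := hG.comp c2
    rw [e1] at k1; rw [e2] at k2
    rw [hh p _ k1, hh q _ k2, hh _ _ hG]
    have f1 : g1 0 = 0 := by ext; simp [g1]
    have f2 : g2 1 = 1 := by ext; simp [g2]
    have f3 : g1 1 = g2 0 := by ext; simp [g1, g2]
    simp only [Function.comp, f1, f2, f3]
    group
  · intro b x y p hp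
    rw [hol_ofHol]
    -- Within `V b` the local section `f b` is itself parallel along `p`.
    refine (hh p (fun t => f b (p t)) fun a => ?_).trans (by simp only [p.source, p.target])
    have := hf b (p a) (p a) (hp ⟨a, rfl⟩) (hVb _)
    exact (p.continuous.tendsto a).eventually this

open Set Topology in
/-- Bundles which agree on short paths are equal. -/
theorem ext_local {ρ σ : GBundle Γ X} (h : ∀ b : X, ∃ N ∈ 𝓝 b, ∀ (x y : X) (p : Path x y),
    range p ⊆ N → ρ.hol p = σ.hol p) : ρ = σ := by
  choose N hN hρσ using h
  refine ext_hol fun x y p => ?_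
  obtain ⟨s, hs0, hmono, ⟨n, hn⟩, hs⟩ := exists_monotone_Icc_subset_open_cover_unitInterval
    (c := fun r => p ⁻¹' interior (N (p r)))
    (fun r => isOpen_interior.preimage p.continuous)
    (fun r _ => mem_iUnion.2 ⟨r, mem_interior_iff_mem_nhds.2 (hN _)⟩)
  have main : ∀ m, ρ.hol (p.subpath 0 (s m)) = σ.hol (p.subpath 0 (s m)) := by
    intro m
    induction m with
    | zero => rw [hs0, Path.subpath_self, hol_refl, hol_refl]
    | succ m ih =>
      have hh : ∀ τ : GBundle Γ X, τ.hol (p.subpath 0 (s (m + 1))) =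
          τ.hol (p.subpath (s m) (s (m + 1))) * τ.hol (p.subpath 0 (s m)) := fun τ => by
        rw [← hol_trans]
        exact (hol_congr τ ⟨Path.Homotopy.subpathTransSubpath p _ _ _⟩).symm
      rw [hh, hh, ih]
      congr 1
      obtain ⟨r, hr⟩ := hs m
      refine hρσ (p r) _ _ _ ?_
      rw [Path.range_subpath_of_le _ _ _ (hmono m.le_succ)]
      rintro _ ⟨a, ha, rfl⟩
      exact interior_subset (hr ha)
  -- The subpath from 0 to 1 is `p` only up to a cast of its endpoints.
  have good_cast : ∀ (x y x' y' : X) (p : Path x y) (hx : x' = x) (hy : y' = y),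
      ρ.hol (p.cast hx hy) = σ.hol (p.cast hx hy) → ρ.hol p = σ.hol p := by
    rintro x y _ _ p rfl rfl h
    exact h
  have h1 := main n
  rw [hn n le_rfl, Path.subpath_zero_one] at h1
  exact good_cast _ _ _ _ p _ _ h1

end GBundle

/-! ### Holonomy along closed curves and descent along a gluing of curves -/

namespace GBundle

open Set Topology

section Contractible

variable {Γ X : Type u} [Group Γ] [TopologicalSpace X]

/-- The endpoints may be merely propositionally equal, so paths coming from different constructions
can be compared pointwise. -/
theorem hol_congr_apply (ρ : GBundle Γ X) {x y x' y' : X} (p : Path x y) (p' : Path x' y')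
    (h : ∀ t, p t = p' t) : ρ.hol p = ρ.hol p' := by
  obtain rfl : x = x' := by rw [← p.source, h, p'.source]
  obtain rfl : y = y' := by rw [← p.target, h, p'.target]
  rw [Path.ext (funext h)]

/-- Paths inside a contractible set with common endpoints are homotopic, so transport from `x₀` is a
well-defined potential on `U`. Its value 1 outside `U` is a default. -/
theorem exists_primitive (ρ : GBundle Γ X) (U : Set X) [ContractibleSpace U] {x₀ : X}
    (hx₀ : x₀ ∈ U) : ∃ g : X → Γ, g x₀ = 1 ∧
      ∀ (y z : X) (p : Path y z), range p ⊆ U → ρ.hol p = g z * (g y)⁻¹ := by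
  classical
  let g : X → Γ := fun y => if hy : y ∈ U then ρ.hol (exists_path_subset hx₀ hy).choose else 1
  have hg : ∀ (y : X) (p : Path x₀ y), range p ⊆ U → g y = ρ.hol p := by
    intro y p hp
    have hy : y ∈ U := hp ⟨1, p.target⟩
    refine (dif_pos hy).trans (ρ.hol_congr (homotopic_of_subset ?_ hp))
    exact (exists_path_subset hx₀ hy).choose_spec
  refine ⟨g, ?_, fun y z p hp => ?_⟩
  · rw [hg x₀ (Path.refl x₀) (by rintro _ ⟨t, rfl⟩; exact hx₀), hol_refl]
  · obtain ⟨r, hr⟩ := exists_path_subset (U := U) hx₀ (hp ⟨0, p.source⟩)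
    rw [hg y r hr, hg z (r.trans p) (by rw [Path.trans_range]; exact union_subset hr hp), hol_trans]
    group

end Contractible

section Arc

variable {Γ X : Type u} [Group Γ] [TopologicalSpace X]

/-- The arc of the closed curve `c` between the parameters `s` and `t`. -/
def arc {c : Circle → X} (hc : Continuous c) (s t : ℝ) :
    Path (c (Circle.exp s)) (c (Circle.exp t)) :=
  (Path.segment s t).map (hc.comp Circle.exp.continuous)

/-- The arcs lift to `ℝ`, where paths with common endpoints are homotopic; no order of `r`, `s`, `t`
is needed. -/
theorem hol_arc_trans (ρ : GBundle Γ X) {c : Circle → X} (hc : Continuous c) (r s t : ℝ) :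
    ρ.hol (arc hc r t) = ρ.hol (arc hc s t) * ρ.hol (arc hc r s) := by
  rw [← hol_trans]
  refine ρ.hol_congr ?_
  have h : (Path.segment r t).Homotopic ((Path.segment r s).trans (Path.segment s t)) :=
    SimplyConnectedSpace.paths_homotopic _ _
  have := h.map ⟨c ∘ Circle.exp, hc.comp Circle.exp.continuous⟩
  rw [Path.map_trans] at this
  exact this

theorem hol_arc_self (ρ : GBundle Γ X) {c : Circle → X} (hc : Continuous c) (s : ℝ) :
    ρ.hol (arc hc s s) = 1 := by
  have := hol_arc_trans ρ hc s s s
  simpa using this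

/-- Translating the parameter by a full period does not change the arc traced on the curve. -/
theorem hol_arc_add_two_pi (ρ : GBundle Γ X) {c : Circle → X} (hc : Continuous c) (t : ℝ) :
    ρ.hol (arc hc 0 (t + 2 * Real.pi)) = ρ.hol (arc hc 0 t) * ρ.hol (arc hc 0 (2 * Real.pi)) := by
  rw [hol_arc_trans ρ hc 0 (2 * Real.pi)]
  congr 1
  refine hol_congr_apply ρ _ _ fun τ => ?_
  simp only [arc, Path.map_coe, Function.comp, Path.segment_apply, AffineMap.lineMap_apply]
  congr 1
  refine Eq.trans (congrArg Circle.exp ?_) (Circle.periodic_exp _)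
  simp only [vsub_eq_sub, smul_eq_mul, vadd_eq_add]
  ring

theorem range_arc {c : Circle → X} (hc : Continuous c) (s t : ℝ) :
    range (arc hc s t) = (c ∘ Circle.exp) '' uIcc s t := by
  rw [← segment_eq_uIcc, ← Path.range_segment, ← range_comp]
  rfl

/-- If two closed curves have the same holonomy, the holonomies along their arcs differ by a
function on the circle. -/
theorem exists_arc_gauge (ρ : GBundle Γ X) {a b : Circle → X} (ha : Continuous a)
    (hb : Continuous b)
    (h : ρ.hol (arc ha 0 (2 * Real.pi)) = ρ.hol (arc hb 0 (2 * Real.pi))) :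
    ∃ d : Circle → Γ, d 1 = 1 ∧ ∀ s t, ρ.hol (arc ha s t) =
      d (Circle.exp t) * ρ.hol (arc hb s t) * (d (Circle.exp s))⁻¹ := by
  -- `D` compares transport from parameter 0 along the two curves. A full turn contributes the same
  -- right factor to both transports, so it cancels and `D` is periodic.
  let D : ℝ → Γ := fun t => ρ.hol (arc ha 0 t) * (ρ.hol (arc hb 0 t))⁻¹
  have hD : Function.Periodic D (2 * Real.pi) := fun t => by
    simp only [D, hol_arc_add_two_pi, h]
    group
  -- The argument inverts `Circle.exp` up to a multiple of the period, so the periodic `D` descends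
  -- to the circle.
  have hd : ∀ t, D (Circle.exp t : ℂ).arg = D t := fun t => by
    obtain ⟨m, hm⟩ := Circle.exp_eq_exp.1 (Circle.exp_arg (Circle.exp t))
    rw [hm]
    exact (hD.int_mul m) t
  have h0 : D 0 = 1 := by simp [D, hol_arc_self]
  refine ⟨fun z => D (z : ℂ).arg, ?_, fun s t => ?_⟩
  · have := hd 0
    rw [Circle.exp_zero] at this
    exact this.trans h0
  · simp only [hd, D]
    rw [hol_arc_trans ρ ha 0 s t, hol_arc_trans ρ hb 0 s t]
    group

end Arc

/-- `q : M → X` identifies the disjoint simple closed curves `a k` with the curves `b k`. -/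
structure IsCurveGluing {M X : Type u} [TopologicalSpace M] [TopologicalSpace X] {K : Type}
    (q : C(M, X)) (a b : K → Circle → M) : Prop where
  surj : Function.Surjective q
  cont_left : ∀ k, Continuous (a k)
  cont_right : ∀ k, Continuous (b k)
  inj : Function.Injective fun p : (K ⊕ K) × Circle => Sum.elim a b p.1 p.2
  map_left : ∀ k z, q (a k z) = q (b k z)
  map_eq : ∀ x y, q x = q y → x = y ∨ ∃ k z, (x = a k z ∧ y = b k z) ∨ (y = a k z ∧ x = b k z)

namespace IsCurveGluing

variable {Γ M X : Type u} [Group Γ] [TopologicalSpace M] [TopologicalSpace X] {K : Type}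
  {q : C(M, X)} {a b : K → Circle → M}

theorem left_inj (h : IsCurveGluing q a b) {k l : K} {z w : Circle} (e : a k z = a l w) :
    k = l ∧ z = w := by
  have := h.inj (a₁ := (Sum.inl k, z)) (a₂ := (Sum.inl l, w)) e
  simpa using this

theorem left_ne_right (h : IsCurveGluing q a b) {k l : K} {z w : Circle} : a k z ≠ b l w := by
  intro e
  have := h.inj (a₁ := (Sum.inl k, z)) (a₂ := (Sum.inr l, w)) e
  simp at this

theorem hol_left_pull (h : IsCurveGluing q a b) (τ : GBundle Γ X) (k : K) (s t : ℝ) :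
    (τ.pull q).hol (arc (h.cont_left k) s t) = (τ.pull q).hol (arc (h.cont_right k) s t) :=
  hol_congr_apply τ _ _ fun _ => h.map_left k _

/-- Every nontrivial identification made by `q` involves a point of some `a k`. Removing just these
curves from a neighbourhood with a primitive makes `q` injective on the rest, and invariance of `g`
is automatic. -/
theorem exists_section_off_curves [Finite K] [T2Space M] (h : IsCurveGluing q a b)
    (hM : ∀ x : M, ∀ N ∈ 𝓝 x, ∃ U ∈ 𝓝 x, U ⊆ N ∧ ContractibleSpace U) (ρ : GBundle Γ M) (x₀ : M)
    (ha : ∀ k z, x₀ ≠ a k z) (hb : ∀ k z, x₀ ≠ b k z) :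
    ∃ (W : Set M) (g : M → Γ), IsOpen W ∧ (∀ x, q x = q x₀ → x ∈ W) ∧
      (∀ x ∈ W, ∀ y ∈ W, q x = q y → g x = g y) ∧
      ∀ x ∈ W, ∃ N ∈ 𝓝 x, ∀ (y z : M) (p : Path y z), range p ⊆ N → ρ.hol p = g z * (g y)⁻¹ := by
  obtain ⟨U, hU, -, hUc⟩ := hM x₀ univ Filter.univ_mem
  obtain ⟨g, -, hg⟩ := exists_primitive ρ U (mem_of_mem_nhds hU)
  have hcl : IsClosed (⋃ k, range (a k)) :=
    isClosed_iUnion_of_finite fun k => (isCompact_range (h.cont_left k)).isClosed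
  refine ⟨interior U \ ⋃ k, range (a k), g, isOpen_interior.sdiff hcl, ?_, ?_, ?_⟩
  · intro x hx
    obtain rfl : x = x₀ := by
      rcases h.map_eq _ _ hx with e | ⟨k, z, ⟨-, e⟩ | ⟨e, -⟩⟩
      · exact e
      · exact absurd e (hb k z)
      · exact absurd e (ha k z)
    refine ⟨mem_interior_iff_mem_nhds.2 hU, fun hx => ?_⟩
    obtain ⟨k, z, e⟩ := mem_iUnion.1 hx
    exact ha k z e.symm
  · rintro x ⟨-, hx⟩ y ⟨-, hy⟩ e
    rcases h.map_eq _ _ e with rfl | ⟨k, z, ⟨e, -⟩ | ⟨e, -⟩⟩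
    · rfl
    · exact (hx (mem_iUnion.2 ⟨k, z, e.symm⟩)).elim
    · exact (hy (mem_iUnion.2 ⟨k, z, e.symm⟩)).elim
  · rintro x ⟨hx, -⟩
    exact ⟨U, mem_interior_iff_mem_nhds.1 hx, hg⟩

/-- The fibre consists of one point on `a k` and one on `b k`. Primitives on disjoint neighbourhoods
of the two points, both normalized to 1 there, agree at identified points of a short arc because the
arc holonomies agree, so together they are compatible with `q`. -/
theorem exists_section_on_curve [Finite K] [T2Space M] (h : IsCurveGluing q a b)
    (hM : ∀ x : M, ∀ N ∈ 𝓝 x, ∃ U ∈ 𝓝 x, U ⊆ N ∧ ContractibleSpace U) (ρ : GBundle Γ M)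
    (hρ : ∀ k s t, ρ.hol (arc (h.cont_left k) s t) = ρ.hol (arc (h.cont_right k) s t))
    (k : K) (z₀ : Circle) :
    ∃ (W : Set M) (g : M → Γ), IsOpen W ∧ (∀ x, q x = q (a k z₀) → x ∈ W) ∧
      (∀ x ∈ W, ∀ y ∈ W, q x = q y → g x = g y) ∧
      ∀ x ∈ W, ∃ N ∈ 𝓝 x, ∀ (y z : M) (p : Path y z), range p ⊆ N → ρ.hol p = g z * (g y)⁻¹ := by
  classical
  obtain ⟨t₀, rfl⟩ := Circle.exp_surjective z₀
  obtain ⟨S, S', hS, hS', hxS, hyS', hdisj⟩ :=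
    t2_separation (h.left_ne_right (k := k) (l := k) (z := Circle.exp t₀) (w := Circle.exp t₀))
  obtain ⟨U, hU, hUS, hUc⟩ := hM _ _ (hS.mem_nhds hxS)
  obtain ⟨U', hU', hUS', hUc'⟩ := hM _ _ (hS'.mem_nhds hyS')
  obtain ⟨g, hg1, hg⟩ := exists_primitive ρ U (mem_of_mem_nhds hU)
  obtain ⟨g', hg1', hg'⟩ := exists_primitive ρ U' (mem_of_mem_nhds hU')
  have hUU : ∀ x, x ∈ U → x ∉ U' := fun x hx hx' =>
    hdisj.le_bot ⟨hUS hx, hUS' hx'⟩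
  -- The radius is small enough that both copies of the arc around `t₀` stay inside the domains of
  -- their primitives.
  obtain ⟨ε, hε, hball⟩ := Metric.mem_nhds_iff.1 (Filter.inter_mem
    (((h.cont_left k).comp Circle.exp.continuous).continuousAt (x := t₀) |>.preimage_mem_nhds hU)
    (((h.cont_right k).comp Circle.exp.continuous).continuousAt (x := t₀) |>.preimage_mem_nhds hU'))
  let J : Set Circle := Circle.exp '' Metric.ball t₀ ε
  have hJ : IsOpen J := isLocalHomeomorph_circleExp.isOpenMap _ Metric.isOpen_ball
  -- Removing all of the `a`-curves except the arc `J` of `a k` leaves only identifications along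
  -- that arc, where the two primitives are known to agree.
  let T : Set M := ⋃ l, a l '' {z | l = k → z ∉ J}
  have hT : IsClosed T := isClosed_iUnion_of_finite fun l => by
    refine (IsCompact.image (IsClosed.isCompact ?_) (h.cont_left l)).isClosed
    by_cases hl : l = k
    · simp only [hl, true_imp_iff]
      exact hJ.isClosed_compl
    · simp [hl]
  have hzJ : Circle.exp t₀ ∈ J := ⟨t₀, Metric.mem_ball_self hε, rfl⟩
  have hcurve : ∀ z ∈ J, a k z ∈ U ∧ b k z ∈ U' ∧ g (a k z) = g' (b k z) := by
    rintro _ ⟨t, ht, rfl⟩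
    have hsub : uIcc t₀ t ⊆ Metric.ball t₀ ε := by
      rw [← segment_eq_uIcc]
      exact (convex_ball t₀ ε).segment_subset (Metric.mem_ball_self hε) ht
    refine ⟨(hball ht).1, (hball ht).2, ?_⟩
    have e1 := hg _ _ (arc (h.cont_left k) t₀ t) (by
      rw [range_arc]
      rintro _ ⟨s, hs, rfl⟩
      exact (hball (hsub hs)).1)
    have e2 := hg' _ _ (arc (h.cont_right k) t₀ t) (by
      rw [range_arc]
      rintro _ ⟨s, hs, rfl⟩
      exact (hball (hsub hs)).2)
    rw [hg1, inv_one, mul_one] at e1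
    rw [hg1', inv_one, mul_one] at e2
    rw [← e1, ← e2, hρ]
  let G : M → Γ := fun x => if x ∈ U then g x else g' x
  have hG : ∀ x ∈ U, G x = g x := fun x hx => if_pos hx
  have hG' : ∀ x ∈ U', G x = g' x := fun x hx => if_neg fun hx' => hUU x hx' hx
  have key : ∀ x ∈ (interior U ∪ interior U') \ T, ∀ l z y, x = a l z → y = b l z → G x = G y := by
    rintro _ ⟨-, hx⟩ l z _ rfl rfl
    have hlz : l = k ∧ z ∈ J := by
      by_contra hlz
      refine hx (mem_iUnion.2 ⟨l, z, fun hl hz => hlz ⟨hl, hz⟩, rfl⟩)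
    obtain ⟨rfl, hz⟩ := hlz
    obtain ⟨h1, h2, h3⟩ := hcurve z hz
    rw [hG _ h1, hG' _ h2, h3]
  refine ⟨(interior U ∪ interior U') \ T, G,
    (isOpen_interior.union isOpen_interior).sdiff hT, ?_, ?_, ?_⟩
  · have h1 : a k (Circle.exp t₀) ∈ (interior U ∪ interior U') \ T := by
      refine ⟨Or.inl (mem_interior_iff_mem_nhds.2 hU), fun hx => ?_⟩
      obtain ⟨l, z, hz, e⟩ := mem_iUnion.1 hx
      obtain ⟨rfl, rfl⟩ := h.left_inj e
      exact hz rfl hzJ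
    have h2 : b k (Circle.exp t₀) ∈ (interior U ∪ interior U') \ T := by
      refine ⟨Or.inr (mem_interior_iff_mem_nhds.2 hU'), fun hx => ?_⟩
      obtain ⟨l, z, hz, e⟩ := mem_iUnion.1 hx
      exact h.left_ne_right e
    intro x hx
    rcases h.map_eq _ _ hx with rfl | ⟨l, z, ⟨rfl, e⟩ | ⟨e, rfl⟩⟩
    · exact h1
    · exact absurd e h.left_ne_right
    · obtain ⟨rfl, rfl⟩ := h.left_inj e
      exact h2
  · intro x hx y hy e
    rcases h.map_eq _ _ e with rfl | ⟨l, z, ⟨e1, e2⟩ | ⟨e1, e2⟩⟩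
    · rfl
    · exact key x hx l z y e1 e2
    · exact (key y hy l z x e1 e2).symm
  · rintro x ⟨hx | hx, -⟩
    · refine ⟨U, mem_interior_iff_mem_nhds.1 hx, fun y z p hp => ?_⟩
      rw [hG _ (hp ⟨1, p.target⟩), hG _ (hp ⟨0, p.source⟩), hg y z p hp]
    · refine ⟨U', mem_interior_iff_mem_nhds.1 hx, fun y z p hp => ?_⟩
      rw [hG' _ (hp ⟨1, p.target⟩), hG' _ (hp ⟨0, p.source⟩), hg' y z p hp]

variable [CompactSpace M] [T2Space X]

theorem isClosedMap (_ : IsCurveGluing q a b) : IsClosedMap q := q.continuous.isClosedMap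

/-- A bundle with the same holonomies along the arcs of `a k` and `b k` descends. -/
theorem exists_pull_eq [Finite K] [T2Space M] (h : IsCurveGluing q a b)
    (hM : ∀ x : M, ∀ N ∈ 𝓝 x, ∃ U ∈ 𝓝 x, U ⊆ N ∧ ContractibleSpace U) (ρ : GBundle Γ M)
    (hρ : ∀ k s t, ρ.hol (arc (h.cont_left k) s t) = ρ.hol (arc (h.cont_right k) s t)) :
    ∃ τ : GBundle Γ X, τ.pull q = ρ := by
  -- Around each fibre of `q` there is an open set with a local potential for `ρ` that takes equal
  -- values at identified points.
  have hloc : ∀ x₀ : X, ∃ (W : Set M) (g : M → Γ), IsOpen W ∧ (∀ x, q x = x₀ → x ∈ W) ∧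
      (∀ x ∈ W, ∀ y ∈ W, q x = q y → g x = g y) ∧
      ∀ x ∈ W, ∃ N ∈ 𝓝 x, ∀ (y z : M) (p : Path y z), range p ⊆ N →
        ρ.hol p = g z * (g y)⁻¹ := by
    intro x₀
    obtain ⟨x₀, rfl⟩ := h.surj x₀
    by_cases ha : ∃ k z, x₀ = a k z
    · obtain ⟨k, z, rfl⟩ := ha
      exact h.exists_section_on_curve hM ρ hρ k z
    by_cases hb : ∃ k z, x₀ = b k z
    · obtain ⟨k, z, rfl⟩ := hb
      rw [← h.map_left]
      exact h.exists_section_on_curve hM ρ hρ k z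
    push Not at ha hb
    exact h.exists_section_off_curves hM ρ x₀ ha hb
  choose W g hW hmem hinv hpath using hloc
  let r : X → M := Function.surjInv h.surj
  have hr : ∀ x, q (r x) = x := Function.surjInv_eq h.surj
  -- These are the points whose entire fibre lies in `W c`. The set is open because `q` is closed,
  -- and on it the potential `g c` descends to `X`.
  let V : X → Set X := fun c => (q '' (W c)ᶜ)ᶜ
  have hV : ∀ c x, q x ∈ V c → x ∈ W c := fun c x hx => by
    by_contra hx'
    exact hx ⟨x, hx', rfl⟩
  have hVo : ∀ c, IsOpen (V c) := fun c =>
    (h.isClosedMap _ (hW c).isClosed_compl).isOpen_compl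
  have hfg : ∀ c x, q x ∈ V c → g c (r (q x)) = g c x := fun c x hx =>
    hinv c _ (hV c _ (by rwa [hr])) _ (hV c _ hx) (hr _)
  obtain ⟨τ, hτ⟩ := exists_hol_eq V hVo (fun c => by rintro ⟨x, hx, e⟩; exact hx (hmem c x e))
    (fun c x => g c (r x)) (by
      intro c d y hc hd
      -- Local constancy of the transition function is proved upstairs near each point of the fibre,
      -- where both potentials compute the holonomy of `ρ` along one short path; closedness of `q`
      -- carries it down.
      have := h.isClosedMap.eventually_nhds_fiber y
        (p := fun x => (g d (r (q x)))⁻¹ * g c (r (q x)) = (g d (r y))⁻¹ * g c (r y)) (by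
          rintro x rfl
          obtain ⟨N, hN, hNp⟩ := hpath c x (hV c x hc)
          obtain ⟨N', hN', hNp'⟩ := hpath d x (hV d x hd)
          have hcd : q ⁻¹' (V c ∩ V d) ∈ 𝓝 x :=
            (((hVo c).inter (hVo d)).preimage q.continuous).mem_nhds ⟨hc, hd⟩
          obtain ⟨U, hU, hUs, hUc⟩ := hM x _ (Filter.inter_mem (Filter.inter_mem hN hN') hcd)
          filter_upwards [hU] with y hy
          obtain ⟨p, hp⟩ := exists_path_subset (mem_of_mem_nhds hU) hy
          have e := (hNp _ _ p fun w hw => (hUs (hp hw)).1.1).symm.trans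
            (hNp' _ _ p fun w hw => (hUs (hp hw)).1.2)
          rw [hfg _ _ (hUs hy).2.1, hfg _ _ (hUs hy).2.2, hfg _ _ hc, hfg _ _ hd]
          rw [mul_inv_eq_iff_eq_mul] at e
          rw [e]
          group)
      filter_upwards [this] with z hz
      simpa only [hr] using hz (r z) (hr z))
  -- On short paths the same potential computes the holonomies of `ρ` and of the pull-back of `τ`.
  refine ⟨τ, ext_local fun x => ?_⟩
  have hx : q x ∈ V (q x) := by rintro ⟨y, hy, e⟩; exact hy (hmem _ y e)
  obtain ⟨N, hN, hNp⟩ := hpath (q x) x (hV _ _ hx)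
  refine ⟨N ∩ q ⁻¹' V (q x), Filter.inter_mem hN
    (((hVo _).preimage q.continuous).mem_nhds hx), fun y z p hp => ?_⟩
  rw [hol_pull, hτ (q x) _ _ _ (by rintro _ ⟨t, rfl⟩; exact (hp ⟨t, rfl⟩).2),
    hfg _ _ (hp ⟨1, p.target⟩).2, hfg _ _ (hp ⟨0, p.source⟩).2,
    hNp y z p fun w hw => (hp hw).1]

/-- A path in `X` crossing the curves need not lift, so holonomies cannot be compared path by path.
Instead, potentials of the two bundles normalized at `x₀` agree after `q` near each point of the
fibre, where short paths exist upstairs; closedness and surjectivity of `q` then give agreement on a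
neighbourhood of `x₀`. -/
theorem pull_injective (h : IsCurveGluing q a b)
    (hM : ∀ x : M, ∀ N ∈ 𝓝 x, ∃ U ∈ 𝓝 x, U ⊆ N ∧ ContractibleSpace U)
    (hX : ∀ x : X, ∀ N ∈ 𝓝 x, ∃ U ∈ 𝓝 x, U ⊆ N ∧ ContractibleSpace U) :
    Function.Injective (pull (Γ := Γ) q) := by
  intro τ σ e
  refine ext_local fun x₀ => ?_
  obtain ⟨U, hU, -, hUc⟩ := hX x₀ univ Filter.univ_mem
  obtain ⟨g, hg1, hg⟩ := exists_primitive τ U (mem_of_mem_nhds hU)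
  obtain ⟨f, hf1, hf⟩ := exists_primitive σ U (mem_of_mem_nhds hU)
  have hev := h.isClosedMap.eventually_nhds_fiber x₀ (p := fun x => g (q x) = f (q x)) (by
    rintro x rfl
    obtain ⟨N, hN, hNs, hNc⟩ := hM x _ (q.continuous.continuousAt.preimage_mem_nhds hU)
    filter_upwards [hN] with y hy
    obtain ⟨p, hp⟩ := exists_path_subset (mem_of_mem_nhds hN) hy
    have hpU : range (p.map q.continuous) ⊆ U := by
      rintro _ ⟨t, rfl⟩
      exact hNs (hp ⟨t, rfl⟩)
    have h1 := hg _ _ _ hpU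
    have h2 := hf _ _ _ hpU
    rw [hg1, inv_one, mul_one] at h1
    rw [hf1, inv_one, mul_one] at h2
    rw [← h1, ← h2]
    exact congrArg (fun ρ : GBundle Γ M => ρ.hol p) e)
  have hgf : ∀ᶠ x in 𝓝 x₀, g x = f x := by
    filter_upwards [hev] with x hx
    obtain ⟨y, rfl⟩ := h.surj x
    exact hx y rfl
  refine ⟨_, Filter.inter_mem hU hgf, fun x y p hp => ?_⟩
  rw [hg _ _ p fun w hw => (hp hw).1, hf _ _ p fun w hw => (hp hw).1]
  have h1 : g x = f x := (hp ⟨0, p.source⟩).2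
  have h2 : g y = f y := (hp ⟨1, p.target⟩).2
  rw [h1, h2]

end IsCurveGluing

end GBundle

/-! ### Classes of bundles and their pull-back along diffeomorphisms -/

namespace Surface

variable {Γ : Type u} [Group Γ] {I O : Type} {B : Surface.{u} I O}

theorem bdryHol_eq (ρ : GBundle Γ B.carrier) (j : I ⊕ O) :
    B.bdryHol Γ ρ j = if j.isLeft then (ρ.hol (B.loop j))⁻¹ else ρ.hol (B.loop j) := by
  rcases j with i | o <;> rfl

/-- Two gauge maps with the same values at the base points differ by a based one. Hence only those
values matter, and `bdryGauge` may be replaced by any convenient map. -/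
theorem smul_cls_eq_iff {g : I ⊕ O → Γ} {ρ σ : GBundle Γ B.carrier} :
    g • B.cls Γ ρ = B.cls Γ σ ↔ ∃ η : B.carrier → Γ, (∀ j, η (B.base j) = g j) ∧ η • ρ = σ := by
  have hb : ∀ j, B.bdryGauge Γ g (B.base j) = g j := fun j => B.bdryGauge_label Γ g j 1
  rw [smul_cls]
  constructor
  · intro h
    obtain ⟨η, hη⟩ := Quotient.exact h.symm
    refine ⟨η.1 * B.bdryGauge Γ g, fun j => ?_, ?_⟩
    · rw [Pi.mul_apply, η.2, hb, one_mul]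
    · rw [mul_smul]
      exact hη
  · rintro ⟨η, hη, rfl⟩
    refine cls_eq (η * (B.bdryGauge Γ g)⁻¹) (fun j => ?_) ?_
    · rw [Pi.mul_apply, Pi.inv_apply, hη, hb, mul_inv_cancel]
    · rw [mul_smul, inv_smul_smul]

theorem cls_eq_iff {ρ σ : GBundle Γ B.carrier} :
    B.cls Γ ρ = B.cls Γ σ ↔ ∃ η : B.carrier → Γ, (∀ j, η (B.base j) = 1) ∧ η • ρ = σ := by
  have := smul_cls_eq_iff (g := 1) (ρ := ρ) (σ := σ)
  rwa [one_smul] at this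

theorem smul_cls_eq {g : I ⊕ O → Γ} (η : B.carrier → Γ) (hη : ∀ j, η (B.base j) = g j)
    (ρ : GBundle Γ B.carrier) : g • B.cls Γ ρ = B.cls Γ (η • ρ) :=
  smul_cls_eq_iff.2 ⟨η, hη, rfl⟩

theorem exists_rep (c : B.Classes Γ) : ∃ ρ, B.cls Γ ρ = c := Quotient.exists_rep c

/-- The automorphisms of a bundle which are trivial at the base points. -/
abbrev Aut (B : Surface.{u} I O) (ρ : GBundle Γ B.carrier) : Type u :=
  {η : B.carrier → Γ // (∀ j, η (B.base j) = 1) ∧ η • ρ = ρ}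

theorem clsAut_cls (ρ : GBundle Γ B.carrier) : B.clsAut Γ (B.cls Γ ρ) = Nat.card (B.Aut ρ) :=
  Nat.card_congr
    { toFun := fun η => ⟨η.1.1, η.1.2, η.2⟩
      invFun := fun η => ⟨⟨η.1, η.2.1⟩, η.2.2⟩
      left_inv := fun _ => rfl
      right_inv := fun _ => rfl }

end Surface

namespace LDiffeo

variable {Γ : Type u} [Group Γ] {I O I' O' : Type} {B : Surface.{u} I O} {B' : Surface.{u} I' O'}
  (f : LDiffeo B B')

theorem pullCls_cls (ρ : GBundle Γ B'.carrier) :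
    f.pullCls Γ (B'.cls Γ ρ) = B.cls Γ (ρ.pull f.toContinuousMap) := rfl

theorem apply_base (j : I ⊕ O) : f.toDiffeo (B.base j) = B'.base (f.bdry j) := f.label_eq j 1

theorem symm_apply_base (j : I ⊕ O) : f.toDiffeo.symm (B'.base (f.bdry j)) = B.base j := by
  rw [← f.apply_base]
  exact f.toDiffeo.symm_apply_apply _

/-- The inverse of a diffeomorphism as a continuous map. -/
def symmMap : C(B'.carrier, B.carrier) := ⟨f.toDiffeo.symm, f.toDiffeo.symm.continuous⟩

theorem pull_symm_pull (ρ : GBundle Γ B.carrier) :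
    (ρ.pull f.symmMap).pull f.toContinuousMap = ρ :=
  GBundle.ext_hol fun _ _ p => GBundle.hol_congr_apply ρ _ p fun _ =>
    f.toDiffeo.symm_apply_apply _

theorem pull_pull_symm (ρ : GBundle Γ B'.carrier) :
    (ρ.pull f.toContinuousMap).pull f.symmMap = ρ :=
  GBundle.ext_hol fun _ _ p => GBundle.hol_congr_apply ρ _ p fun _ =>
    f.toDiffeo.apply_symm_apply _

theorem pullCls_smul (g : I' ⊕ O' → Γ) (c : B'.Classes Γ) :
    f.pullCls Γ (g • c) = (g ∘ f.bdry) • f.pullCls Γ c := by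
  obtain ⟨ρ, rfl⟩ := Surface.exists_rep c
  rw [Surface.smul_cls, pullCls_cls, pullCls_cls, GBundle.pull_smul]
  refine (Surface.smul_cls_eq _ (fun j => ?_) _).symm
  exact (congrArg _ (f.apply_base j)).trans (B'.bdryGauge_label Γ g _ 1)

theorem clsHol_pullCls (c : B'.Classes Γ) :
    B.clsHol Γ (f.pullCls Γ c) = B'.clsHol Γ c ∘ f.bdry := by
  obtain ⟨ρ, rfl⟩ := Surface.exists_rep c
  have h : ∀ j, (ρ.pull f.toContinuousMap).hol (B.loop j) = ρ.hol (B'.loop (f.bdry j)) := fun j =>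
    GBundle.hol_congr_apply ρ _ _ fun t => f.label_eq j _
  funext j
  rcases j with i | o
  · exact congrArg (·⁻¹) (h (Sum.inl i))
  · exact h (Sum.inr o)

theorem pullCls_injective : Function.Injective (f.pullCls Γ) := by
  intro c d h
  obtain ⟨ρ, rfl⟩ := Surface.exists_rep c
  obtain ⟨σ, rfl⟩ := Surface.exists_rep d
  rw [pullCls_cls, pullCls_cls, Surface.cls_eq_iff] at h
  obtain ⟨η, hη, e⟩ := h
  refine Surface.cls_eq (η ∘ f.symmMap) (fun j => ?_) ?_
  · obtain ⟨k, rfl⟩ := f.bdry.surjective j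
    exact (congrArg η (f.symm_apply_base k)).trans (hη k)
  · have := congrArg (GBundle.pull f.symmMap) e
    rwa [GBundle.pull_smul, pull_pull_symm, pull_pull_symm] at this

theorem pullCls_surjective : Function.Surjective (f.pullCls Γ) := by
  intro c
  obtain ⟨ρ, rfl⟩ := Surface.exists_rep c
  exact ⟨B'.cls Γ (ρ.pull f.symmMap), by rw [pullCls_cls, pull_symm_pull]⟩

theorem pullCls_bijective : Function.Bijective (f.pullCls Γ) :=
  ⟨f.pullCls_injective, f.pullCls_surjective⟩

theorem clsAut_pullCls (c : B'.Classes Γ) : B.clsAut Γ (f.pullCls Γ c) = B'.clsAut Γ c := by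
  obtain ⟨ρ, rfl⟩ := Surface.exists_rep c
  rw [pullCls_cls, Surface.clsAut_cls, Surface.clsAut_cls]
  refine Nat.card_congr
    { toFun := fun η => ⟨η.1 ∘ f.symmMap, fun j => ?_, ?_⟩
      invFun := fun η => ⟨η.1 ∘ f.toContinuousMap, fun j => ?_, ?_⟩
      left_inv := fun η => Subtype.ext (funext fun x => ?_)
      right_inv := fun η => Subtype.ext (funext fun x => ?_) }
  · obtain ⟨k, rfl⟩ := f.bdry.surjective j
    exact (congrArg η.1 (f.symm_apply_base k)).trans (η.2.1 k)
  · have := congrArg (GBundle.pull f.symmMap) η.2.2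
    rwa [GBundle.pull_smul, pull_pull_symm] at this
  · exact (congrArg η.1 (f.apply_base j)).trans (η.2.1 _)
  · rw [← GBundle.pull_smul, η.2.2]
  · exact congrArg η.1 (f.toDiffeo.symm_apply_apply x)
  · exact congrArg η.1 (f.toDiffeo.apply_symm_apply x)

end LDiffeo

/-! ### Bundles and classes on disjoint unions -/

namespace GBundle

theorem pull_pull {Γ X Y W : Type u} [Group Γ] [TopologicalSpace X] [TopologicalSpace Y]
    [TopologicalSpace W] (f : C(X, Y)) (g : C(Y, W)) (ρ : GBundle Γ W) :
    (ρ.pull g).pull f = ρ.pull (g.comp f) :=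
  ext_hol fun _ _ p => hol_congr_apply ρ (Path.map (Path.map p f.continuous) g.continuous)
    (Path.map p (g.comp f).continuous) fun _ => rfl

section Sum

variable {Γ X Y : Type u} [Group Γ] [TopologicalSpace X] [TopologicalSpace Y]

theorem isLeft_path {u v : X ⊕ Y} (p : Path u v) (t : unitInterval) :
    (p t).isLeft = u.isLeft := by
  have hc : Continuous (Sum.isLeft : X ⊕ Y → Bool) :=
    continuous_sum_dom.2 ⟨continuous_const (y := true), continuous_const (y := false)⟩
  have := PreconnectedSpace.constant inferInstance (hc.comp p.continuous) (x := t) (y := 0)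
  simpa using this

/-- The retraction of `X ⊕ Y` onto `X` which sends `Y` to the point `x`. -/
def retractLeft (x : X) : C(X ⊕ Y, X) :=
  ⟨Sum.elim id fun _ => x, continuous_id.sumElim continuous_const⟩

/-- The retraction of `X ⊕ Y` onto `Y` which sends `X` to the point `y`. -/
def retractRight (y : Y) : C(X ⊕ Y, Y) :=
  ⟨Sum.elim (fun _ => y) id, continuous_const.sumElim continuous_id⟩

/-- The auxiliary point is the image of the other summand, which a path starting on the left never
enters. -/
theorem hol_retractLeft (ρ : GBundle Γ X) (x x' : X) {u v : X ⊕ Y} (p : Path u v)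
    (hu : u.isLeft) : (ρ.pull (retractLeft x)).hol p = (ρ.pull (retractLeft x')).hol p := by
  refine hol_congr_apply ρ _ _ fun t => ?_
  have ht := (isLeft_path p t).trans hu
  change retractLeft x (p t) = retractLeft x' (p t)
  rcases h : p t with w | w
  · rfl
  · simp [h] at ht

theorem hol_retractRight (ρ : GBundle Γ Y) (y y' : Y) {u v : X ⊕ Y} (p : Path u v)
    (hu : u.isLeft = false) :
    (ρ.pull (retractRight y)).hol p = (ρ.pull (retractRight y')).hol p := by
  refine hol_congr_apply ρ _ _ fun t => ?_
  have ht := (isLeft_path p t).trans hu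
  change retractRight y (p t) = retractRight y' (p t)
  rcases h : p t with w | w
  · simp [h] at ht
  · rfl

/-- The bundle on a disjoint union with given restrictions. -/
def sum (ρ : GBundle Γ X) (σ : GBundle Γ Y) : GBundle Γ (X ⊕ Y) :=
  -- The starting point selects the summand and also serves as the auxiliary point of the
  -- retraction, so neither summand has to be nonempty.
  ofHol (fun {u _} p => match u with
      | Sum.inl x => (ρ.pull (retractLeft x)).hol p
      | Sum.inr y => (σ.pull (retractRight y)).hol p)
    (fun {u _ _ _} h => match u with
      | Sum.inl _ => hol_congr _ h
      | Sum.inr _ => hol_congr _ h)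
    (fun u => match u with
      | Sum.inl _ => hol_refl _ _
      | Sum.inr _ => hol_refl _ _)
    (fun {u v _} p q => by
      have h := isLeft_path p 1
      rw [p.target] at h
      match u, v, h with
      | Sum.inl x, Sum.inl y, _ =>
        exact (hol_trans _ p q).trans (congrArg (· * _) (hol_retractLeft ρ x y q rfl))
      | Sum.inr x, Sum.inr y, _ =>
        exact (hol_trans _ p q).trans (congrArg (· * _) (hol_retractRight σ x y q rfl)))

theorem pull_inl_sum (ρ : GBundle Γ X) (σ : GBundle Γ Y) :
    (sum ρ σ).pull ⟨Sum.inl, continuous_inl⟩ = ρ :=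
  ext_hol fun _ _ p => hol_congr_apply ρ _ p fun _ => rfl

theorem pull_inr_sum (ρ : GBundle Γ X) (σ : GBundle Γ Y) :
    (sum ρ σ).pull ⟨Sum.inr, continuous_inr⟩ = σ :=
  ext_hol fun _ _ p => hol_congr_apply σ _ p fun _ => rfl

/-- A path is recovered from its retraction to the summand in which it starts. -/
theorem sum_ext {τ τ' : GBundle Γ (X ⊕ Y)}
    (hl : τ.pull ⟨Sum.inl, continuous_inl⟩ = τ'.pull ⟨Sum.inl, continuous_inl⟩)
    (hr : τ.pull ⟨Sum.inr, continuous_inr⟩ = τ'.pull ⟨Sum.inr, continuous_inr⟩) : τ = τ' := by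
  refine ext_hol fun u v p => ?_
  rcases u with x | y
  · have key : ∀ σ : GBundle Γ (X ⊕ Y), σ.hol p = (σ.pull ⟨Sum.inl, continuous_inl⟩).hol
        (p.map (retractLeft x).continuous) := fun σ => hol_congr_apply σ _ _ fun t => by
      have ht := isLeft_path p t
      change p t = Sum.inl (retractLeft x (p t))
      rcases h : p t with w | w
      · rfl
      · simp [h] at ht
    rw [key, key, hl]
  · have key : ∀ σ : GBundle Γ (X ⊕ Y), σ.hol p = (σ.pull ⟨Sum.inr, continuous_inr⟩).hol
        (p.map (retractRight y).continuous) := fun σ => hol_congr_apply σ _ _ fun t => by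
      have ht := isLeft_path p t
      change p t = Sum.inr (retractRight y (p t))
      rcases h : p t with w | w
      · simp [h] at ht
      · rfl
    rw [key, key, hr]

end Sum

end GBundle

/-- A decomposition of the surface `M` as a disjoint union of `B` and `B'`. -/
structure SumDecomp {I O I₁ O₁ I₂ O₂ : Type} (M : Surface.{u} I O) (B : Surface.{u} I₁ O₁)
    (B' : Surface.{u} I₂ O₂) where
  homeo : B.carrier ⊕ B'.carrier ≃ₜ M.carrier
  idx : (I₁ ⊕ O₁) ⊕ (I₂ ⊕ O₂) ≃ I ⊕ O
  label_inl : ∀ j z, M.label (idx (Sum.inl j)) z = homeo (Sum.inl (B.label j z))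
  label_inr : ∀ j z, M.label (idx (Sum.inr j)) z = homeo (Sum.inr (B'.label j z))
  isLeft_inl : ∀ j, (idx (Sum.inl j)).isLeft = j.isLeft
  isLeft_inr : ∀ j, (idx (Sum.inr j)).isLeft = j.isLeft

namespace SumDecomp

variable {I O I₁ O₁ I₂ O₂ : Type} {M : Surface.{u} I O}
  {B : Surface.{u} I₁ O₁} {B' : Surface.{u} I₂ O₂} (D : SumDecomp M B B')

/-- The inclusion of the first part. -/
def left : C(B.carrier, M.carrier) := ⟨D.homeo ∘ Sum.inl, D.homeo.continuous.comp continuous_inl⟩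

/-- The inclusion of the second part. -/
def right : C(B'.carrier, M.carrier) := ⟨D.homeo ∘ Sum.inr, D.homeo.continuous.comp continuous_inr⟩

theorem exists_comp_eq {α : Type*} (η : B.carrier → α) (ζ : B'.carrier → α) :
    ∃ θ : M.carrier → α, θ ∘ D.left = η ∧ θ ∘ D.right = ζ := by
  refine ⟨Sum.elim η ζ ∘ D.homeo.symm, funext fun x => ?_, funext fun x => ?_⟩
  · simp [left]
  · simp [right]

theorem comp_ext {α : Type*} {θ θ' : M.carrier → α} (hl : θ ∘ D.left = θ' ∘ D.left)
    (hr : θ ∘ D.right = θ' ∘ D.right) : θ = θ' := by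
  funext x
  obtain ⟨x | x, rfl⟩ := D.homeo.surjective x
  · exact congrFun hl x
  · exact congrFun hr x

variable {Γ : Type u} [Group Γ]

theorem exists_pull_eq (ρ : GBundle Γ B.carrier) (σ : GBundle Γ B'.carrier) :
    ∃ τ : GBundle Γ M.carrier, τ.pull D.left = ρ ∧ τ.pull D.right = σ := by
  refine ⟨(GBundle.sum ρ σ).pull ⟨D.homeo.symm, D.homeo.symm.continuous⟩, ?_, ?_⟩
  · refine Eq.trans (GBundle.ext_hol fun x y p => ?_) (GBundle.pull_inl_sum ρ σ)
    exact GBundle.hol_congr_apply (GBundle.sum ρ σ) (Path.map (Path.map p D.left.continuous)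
      D.homeo.symm.continuous) (Path.map p continuous_inl) fun t => D.homeo.symm_apply_apply _
  · refine Eq.trans (GBundle.ext_hol fun x y p => ?_) (GBundle.pull_inr_sum ρ σ)
    exact GBundle.hol_congr_apply (GBundle.sum ρ σ) (Path.map (Path.map p D.right.continuous)
      D.homeo.symm.continuous) (Path.map p continuous_inr) fun t => D.homeo.symm_apply_apply _

theorem pull_ext {τ τ' : GBundle Γ M.carrier} (hl : τ.pull D.left = τ'.pull D.left)
    (hr : τ.pull D.right = τ'.pull D.right) : τ = τ' := by
  have h : τ.pull ⟨D.homeo, D.homeo.continuous⟩ = τ'.pull ⟨D.homeo, D.homeo.continuous⟩ :=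
    GBundle.sum_ext (by rw [GBundle.pull_pull, GBundle.pull_pull]; exact hl)
      (by rw [GBundle.pull_pull, GBundle.pull_pull]; exact hr)
  have key : ∀ σ : GBundle Γ M.carrier, (σ.pull ⟨D.homeo, D.homeo.continuous⟩).pull
      ⟨D.homeo.symm, D.homeo.symm.continuous⟩ = σ := fun σ => GBundle.ext_hol fun _ _ p =>
    GBundle.hol_congr_apply σ _ p fun _ => D.homeo.apply_symm_apply _
  rw [← key τ, h, key]

theorem left_base (j : I₁ ⊕ O₁) : D.left (B.base j) = M.base (D.idx (Sum.inl j)) :=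
  (D.label_inl j 1).symm

theorem right_base (j : I₂ ⊕ O₂) : D.right (B'.base j) = M.base (D.idx (Sum.inr j)) :=
  (D.label_inr j 1).symm

/-- A gauge map on the union is an arbitrary pair of gauge maps on the parts, and the base points
are distributed over the parts, so the conditions separate. -/
theorem smul_cls_eq_iff {g : I ⊕ O → Γ} {ρ σ : GBundle Γ M.carrier} :
    g • M.cls Γ ρ = M.cls Γ σ ↔
      (g ∘ D.idx ∘ Sum.inl) • B.cls Γ (ρ.pull D.left) = B.cls Γ (σ.pull D.left) ∧
      (g ∘ D.idx ∘ Sum.inr) • B'.cls Γ (ρ.pull D.right) = B'.cls Γ (σ.pull D.right) := by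
  simp only [Surface.smul_cls_eq_iff]
  constructor
  · rintro ⟨θ, hθ, rfl⟩
    exact ⟨⟨θ ∘ D.left, fun j => (congrArg θ (D.left_base j)).trans (hθ _), rfl⟩,
      ⟨θ ∘ D.right, fun j => (congrArg θ (D.right_base j)).trans (hθ _), rfl⟩⟩
  · rintro ⟨⟨η, hη, e⟩, ⟨ζ, hζ, e'⟩⟩
    obtain ⟨θ, rfl, rfl⟩ := D.exists_comp_eq η ζ
    refine ⟨θ, fun j => ?_, D.pull_ext e e'⟩
    obtain ⟨j | j, rfl⟩ := D.idx.surjective j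
    · exact (congrArg θ (D.left_base j)).symm.trans (hη j)
    · exact (congrArg θ (D.right_base j)).symm.trans (hζ j)

theorem cls_eq_iff {ρ σ : GBundle Γ M.carrier} :
    M.cls Γ ρ = M.cls Γ σ ↔ B.cls Γ (ρ.pull D.left) = B.cls Γ (σ.pull D.left) ∧
      B'.cls Γ (ρ.pull D.right) = B'.cls Γ (σ.pull D.right) := by
  have := D.smul_cls_eq_iff (g := 1) (ρ := ρ) (σ := σ)
  have h1 : (1 : I ⊕ O → Γ) ∘ D.idx ∘ Sum.inl = 1 := rfl
  have h2 : (1 : I ⊕ O → Γ) ∘ D.idx ∘ Sum.inr = 1 := rfl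
  rwa [h1, h2, one_smul, one_smul, one_smul] at this

variable (Γ) in
/-- The classes on a disjoint union are the pairs of classes on the parts. -/
def clsEquiv : M.Classes Γ ≃ B.Classes Γ × B'.Classes Γ :=
  Equiv.ofBijective (fun c => (Quotient.lift (fun ρ => B.cls Γ (ρ.pull D.left))
      (fun _ _ h => (D.cls_eq_iff.1 (Quotient.sound h : M.cls Γ _ = M.cls Γ _)).1) c,
    Quotient.lift (fun ρ => B'.cls Γ (ρ.pull D.right))
      (fun _ _ h => (D.cls_eq_iff.1 (Quotient.sound h : M.cls Γ _ = M.cls Γ _)).2) c)) (by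
    constructor
    · intro c d h
      obtain ⟨ρ, rfl⟩ := Surface.exists_rep c
      obtain ⟨σ, rfl⟩ := Surface.exists_rep d
      exact D.cls_eq_iff.2 ⟨(Prod.ext_iff.1 h).1, (Prod.ext_iff.1 h).2⟩
    · rintro ⟨c, d⟩
      obtain ⟨ρ, rfl⟩ := Surface.exists_rep c
      obtain ⟨σ, rfl⟩ := Surface.exists_rep d
      obtain ⟨τ, rfl, rfl⟩ := D.exists_pull_eq ρ σ
      exact ⟨M.cls Γ τ, rfl⟩)

theorem clsEquiv_cls (ρ : GBundle Γ M.carrier) : D.clsEquiv Γ (M.cls Γ ρ) =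
    (B.cls Γ (ρ.pull D.left), B'.cls Γ (ρ.pull D.right)) := rfl

theorem clsEquiv_smul (g : I ⊕ O → Γ) (c : M.Classes Γ) : D.clsEquiv Γ (g • c) =
    ((g ∘ D.idx ∘ Sum.inl) • (D.clsEquiv Γ c).1, (g ∘ D.idx ∘ Sum.inr) • (D.clsEquiv Γ c).2) := by
  obtain ⟨ρ, rfl⟩ := Surface.exists_rep c
  obtain ⟨σ, hσ⟩ := Surface.exists_rep (g • M.cls Γ ρ)
  rw [← hσ, clsEquiv_cls, clsEquiv_cls]
  exact Prod.ext (D.smul_cls_eq_iff.1 hσ.symm).1.symm (D.smul_cls_eq_iff.1 hσ.symm).2.symm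

theorem clsHol_inl (c : M.Classes Γ) (j : I₁ ⊕ O₁) :
    B.clsHol Γ (D.clsEquiv Γ c).1 j = M.clsHol Γ c (D.idx (Sum.inl j)) := by
  obtain ⟨ρ, rfl⟩ := Surface.exists_rep c
  have h : (ρ.pull D.left).hol (B.loop j) = ρ.hol (M.loop (D.idx (Sum.inl j))) :=
    GBundle.hol_congr_apply ρ _ _ fun t => (D.label_inl j _).symm
  change B.bdryHol Γ (ρ.pull D.left) j = M.bdryHol Γ ρ _
  rw [Surface.bdryHol_eq, Surface.bdryHol_eq, D.isLeft_inl, h]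

theorem clsHol_inr (c : M.Classes Γ) (j : I₂ ⊕ O₂) :
    B'.clsHol Γ (D.clsEquiv Γ c).2 j = M.clsHol Γ c (D.idx (Sum.inr j)) := by
  obtain ⟨ρ, rfl⟩ := Surface.exists_rep c
  have h : (ρ.pull D.right).hol (B'.loop j) = ρ.hol (M.loop (D.idx (Sum.inr j))) :=
    GBundle.hol_congr_apply ρ _ _ fun t => (D.label_inr j _).symm
  change B'.bdryHol Γ (ρ.pull D.right) j = M.bdryHol Γ ρ _
  rw [Surface.bdryHol_eq, Surface.bdryHol_eq, D.isLeft_inr, h]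

/-- Restriction to the parts identifies the automorphism group with a product; this multiplicativity
is what makes the tensor map isometric. -/
theorem clsAut_eq (c : M.Classes Γ) :
    M.clsAut Γ c = B.clsAut Γ (D.clsEquiv Γ c).1 * B'.clsAut Γ (D.clsEquiv Γ c).2 := by
  obtain ⟨ρ, rfl⟩ := Surface.exists_rep c
  rw [clsEquiv_cls, Surface.clsAut_cls, Surface.clsAut_cls, Surface.clsAut_cls, ← Nat.card_prod]
  refine Nat.card_congr (Equiv.ofBijective (fun θ =>
    (⟨θ.1 ∘ D.left, fun j => (congrArg θ.1 (D.left_base j)).trans (θ.2.1 _), by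
      rw [← GBundle.pull_smul, θ.2.2]⟩,
    ⟨θ.1 ∘ D.right, fun j => (congrArg θ.1 (D.right_base j)).trans (θ.2.1 _), by
      rw [← GBundle.pull_smul, θ.2.2]⟩)) ⟨?_, ?_⟩)
  · intro θ θ' h
    obtain ⟨h1, h2⟩ := Prod.ext_iff.1 h
    exact Subtype.ext (D.comp_ext (congrArg Subtype.val h1) (congrArg Subtype.val h2))
  · rintro ⟨⟨η, hη, e⟩, ⟨ζ, hζ, e'⟩⟩
    obtain ⟨θ, rfl, rfl⟩ := D.exists_comp_eq η ζ
    refine ⟨⟨θ, fun j => ?_, D.pull_ext e e'⟩, rfl⟩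
    obtain ⟨j | j, rfl⟩ := D.idx.surjective j
    · exact (congrArg θ (D.left_base j)).symm.trans (hη j)
    · exact (congrArg θ (D.right_base j)).symm.trans (hζ j)

end SumDecomp

/-! ### Classes on a surface and on the surface cut along curves -/

/-- The element of `Γ^{π₀(∂M)}` given by `g` on the boundary of `B` and by `h` on both copies of
the cutting curves. -/
def glGauge {Γ : Type u} {I O K : Type} (g : I ⊕ O → Γ) (h : K → Γ) :
    (I ⊕ K) ⊕ (O ⊕ K) → Γ :=
  Sum.elim g (Sum.elim h h) ∘ Equiv.sumSumSumComm I K O K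

theorem glGauge_one {Γ : Type u} [Group Γ] {I O K : Type} :
    glGauge (1 : I ⊕ O → Γ) (1 : K → Γ) = 1 := by
  funext j; rcases j with (j | j) | (j | j) <;> rfl

theorem glGauge_mul {Γ : Type u} [Group Γ] {I O K : Type} (g g' : I ⊕ O → Γ) (h h' : K → Γ) :
    glGauge (g * g') (h * h') = glGauge g h * glGauge g' h' := by
  funext j; rcases j with (j | j) | (j | j) <;> rfl

theorem glGauge_inv {Γ : Type u} [Group Γ] {I O K : Type} (g : I ⊕ O → Γ) (h : K → Γ) :
    (glGauge g h)⁻¹ = glGauge g⁻¹ h⁻¹ := by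
  rw [inv_eq_iff_mul_eq_one, ← glGauge_mul, mul_inv_cancel, mul_inv_cancel, glGauge_one]

/-- The boundary holonomies along the two copies of each cutting curve agree. -/
def Surface.Matched {Γ : Type u} [Group Γ] {I O K : Type} {M : Surface.{u} (I ⊕ K) (O ⊕ K)}
    (c : M.Classes Γ) : Prop :=
  ∀ k, M.clsHol Γ c (Sum.inl (Sum.inr k)) = (M.clsHol Γ c (Sum.inr (Sum.inr k)))⁻¹

namespace Cut

variable {Γ : Type u} [Group Γ] {I O K : Type} {B : Surface.{u} I O} {A : CurveSystem B K}
  {M : Surface.{u} (I ⊕ K) (O ⊕ K)} (q : Cut B A M)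

open GBundle

theorem isCurveGluing (q : Cut B A M) : IsCurveGluing q.toContinuousMap
    (fun k z => M.label (Sum.inl (Sum.inr k)) z) (fun k z => M.label (Sum.inr (Sum.inr k)) z) where
  surj := q.map_surjective
  cont_left k := (M.label_smooth _).continuous
  cont_right k := (M.label_smooth _).continuous
  inj := by
    rintro ⟨k | k, z⟩ ⟨l | l, w⟩ e <;> simp_all [Surface.label_eq_iff]
  map_left k z := (q.map_curve_in k z).trans (q.map_curve_out k z).symm
  map_eq := q.map_eq

theorem pull_injective (q : Cut B A M) : Function.Injective (pull (Γ := Γ) q.toContinuousMap) :=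
  q.isCurveGluing.pull_injective exists_contractible_nhds exists_contractible_nhds

theorem map_base_inl (q : Cut B A M) (i : I) :
    q.toContinuousMap (M.base (Sum.inl (Sum.inl i))) = B.base (Sum.inl i) := q.map_in i 1

theorem map_base_inr (q : Cut B A M) (o : O) :
    q.toContinuousMap (M.base (Sum.inr (Sum.inl o))) = B.base (Sum.inr o) := q.map_out o 1

theorem hol_loop (ρ : GBundle Γ M.carrier) (j : (I ⊕ K) ⊕ (O ⊕ K)) :
    ρ.hol (M.loop j) = ρ.hol (arc (M.label_smooth j).continuous 0 (2 * Real.pi)) :=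
  hol_congr_apply ρ _ _ fun t => by
    simp only [arc, Path.map_coe, Function.comp, Path.segment_apply, AffineMap.lineMap_apply]
    refine congrArg (fun s => M.label j (Circle.exp s)) ?_
    simp only [vsub_eq_sub, smul_eq_mul, vadd_eq_add]
    ring

/-- The boundary orientation reverses the label on the incoming copy, so matching means equal
holonomies in the common direction of the labels. -/
theorem matched_cls_iff {ρ : GBundle Γ M.carrier} : Surface.Matched (M.cls Γ ρ) ↔
    ∀ k, ρ.hol (arc (M.label_smooth (Sum.inl (Sum.inr k))).continuous 0 (2 * Real.pi)) =
      ρ.hol (arc (M.label_smooth (Sum.inr (Sum.inr k))).continuous 0 (2 * Real.pi)) := by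
  refine forall_congr' fun k => ?_
  rw [← hol_loop, ← hol_loop]
  exact inv_inj

theorem matched_pull (q : Cut B A M) (τ : GBundle Γ B.carrier) :
    Surface.Matched (M.cls Γ (τ.pull q.toContinuousMap)) :=
  matched_cls_iff.2 fun k => q.isCurveGluing.hol_left_pull τ k 0 (2 * Real.pi)

/-- Matching controls only full turns, whereas descent requires equal holonomies along all arcs. A
gauge map supported on the outgoing copies of the curves repairs the arcs, and being trivial at the
base points it does not change the class. -/
theorem exists_cls_pull_eq [Finite K] (q : Cut B A M) {c : M.Classes Γ} (hc : Surface.Matched c) :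
    ∃ τ : GBundle Γ B.carrier, M.cls Γ (τ.pull q.toContinuousMap) = c := by
  classical
  obtain ⟨ρ, rfl⟩ := Surface.exists_rep c
  choose d hd1 hd using fun k => exists_arc_gauge ρ _ _ (matched_cls_iff.1 hc k)
  -- On the outgoing copy of curve `k` the value is the correction `d k` from `exists_arc_gauge`;
  -- everywhere else it is 1.
  let η : M.carrier → Γ := fun x => if h : ∃ (k : K) (z : Circle), M.label (Sum.inr (Sum.inr k)) z = x
    then d h.choose h.choose_spec.choose else 1
  have hη : ∀ k z, η (M.label (Sum.inr (Sum.inr k)) z) = d k z := by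
    intro k z
    have h : ∃ (l : K) (w : Circle), M.label (Sum.inr (Sum.inr l)) w =
      M.label (Sum.inr (Sum.inr k)) z := ⟨k, z, rfl⟩
    have h2 := (M.label_eq_iff).1 h.choose_spec.choose_spec
    have e1 : h.choose = k := by simpa using h2.1
    refine (dif_pos h).trans ?_
    exact congr (congrArg d e1) h2.2
  have hη' : ∀ j z, (∀ k, j ≠ Sum.inr (Sum.inr k)) → η (M.label j z) = 1 := by
    intro j z hj
    refine dif_neg ?_
    rintro ⟨l, w, e⟩
    exact hj l (M.label_eq_iff.1 e).1.symm
  obtain ⟨τ, hτ⟩ := q.isCurveGluing.exists_pull_eq exists_contractible_nhds (η • ρ) (by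
    intro k s t
    rw [hol_smul, hol_smul, hη, hη, hη' _ _ (by simp), hη' _ _ (by simp), one_mul, inv_one,
      mul_one]
    exact hd k s t)
  refine ⟨τ, ?_⟩
  rw [hτ]
  refine (Surface.cls_eq η (fun j => ?_) rfl).symm
  by_cases hj : ∃ k, j = Sum.inr (Sum.inr k)
  · obtain ⟨k, rfl⟩ := hj
    exact (hη k 1).trans (hd1 k)
  · push Not at hj
    exact hη' j 1 hj

/-- A gauge transformation between pull-backs which agrees on the two copies of the base points of
the curves descends. -/
theorem exists_gauge_eq (q : Cut B A M) {τ σ : GBundle Γ B.carrier} {ζ : M.carrier → Γ}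
    (hζ : ∀ k, ζ (M.base (Sum.inl (Sum.inr k))) = ζ (M.base (Sum.inr (Sum.inr k))))
    (e : ζ • τ.pull q.toContinuousMap = σ.pull q.toContinuousMap) :
    ∃ η : B.carrier → Γ, η ∘ q.toContinuousMap = ζ ∧ η • τ = σ := by
  have h := q.isCurveGluing
  -- Both bundles have the same transport from the base point to `z` on the two copies, and `ζ`
  -- intertwines them; agreement at the base point therefore propagates along the whole curve.
  have key : ∀ k z, ζ (M.label (Sum.inl (Sum.inr k)) z) = ζ (M.label (Sum.inr (Sum.inr k)) z) := by
    intro k z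
    obtain ⟨t, rfl⟩ := Circle.exp_surjective z
    have h1 := h.hol_left_pull τ k 0 t
    have h2 := h.hol_left_pull σ k 0 t
    rw [← e, hol_smul, hol_smul, h1] at h2
    have h0 := hζ k
    simp only [Surface.base, ← Circle.exp_zero] at h0
    rw [h0] at h2
    exact mul_right_cancel (mul_right_cancel h2)
  let η : B.carrier → Γ := ζ ∘ Function.surjInv h.surj
  have hη : η ∘ q.toContinuousMap = ζ := by
    funext x
    rcases h.map_eq _ x (Function.surjInv_eq h.surj (q.toContinuousMap x)) with
      h | ⟨k, z, ⟨h, rfl⟩ | ⟨rfl, h⟩⟩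
    · exact congrArg ζ h
    · exact (congrArg ζ h).trans (key k z)
    · exact (congrArg ζ h).trans (key k z).symm
  -- The relation between `τ` and `σ` is known after pull-back, and pull-back along `q` is injective
  -- on bundles.
  refine ⟨η, hη, q.pull_injective ?_⟩
  rw [pull_smul, hη, e]

/-- On `B` a gauge map is unconstrained at the base points of the curves, while on `M` these are
base points of the boundary. The free parameter `h` records the values there, equal on the two
copies because the map comes from `B`. -/
theorem smul_cls_eq_iff (q : Cut B A M) {g : I ⊕ O → Γ} {τ σ : GBundle Γ B.carrier} :
    g • B.cls Γ τ = B.cls Γ σ ↔ ∃ h : K → Γ, glGauge g h • M.cls Γ (τ.pull q.toContinuousMap) =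
      M.cls Γ (σ.pull q.toContinuousMap) := by
  simp only [Surface.smul_cls_eq_iff]
  constructor
  · rintro ⟨η, hη, rfl⟩
    refine ⟨fun k => η (A.curve k 1), η ∘ q.toContinuousMap, ?_, rfl⟩
    rintro ((i | k) | (o | k))
    · exact (congrArg η (q.map_base_inl i)).trans (hη _)
    · exact congrArg η (q.map_curve_in k 1)
    · exact (congrArg η (q.map_base_inr o)).trans (hη _)
    · exact congrArg η (q.map_curve_out k 1)
  · rintro ⟨h, ζ, hζ, e⟩
    obtain ⟨η, rfl, hη⟩ := q.exists_gauge_eq (fun k => (hζ (Sum.inl (Sum.inr k))).trans (hζ (Sum.inr (Sum.inr k))).symm) e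
    refine ⟨η, ?_, hη⟩
    rintro (i | o)
    · exact (congrArg η (q.map_base_inl i)).symm.trans (hζ _)
    · exact (congrArg η (q.map_base_inr o)).symm.trans (hζ _)

/-- The class `c` is that of the pull-back of a bundle of class `b`. -/
def Rel (q : Cut B A M) (c : M.Classes Γ) (b : B.Classes Γ) : Prop :=
  ∃ τ : GBundle Γ B.carrier, M.cls Γ (τ.pull q.toContinuousMap) = c ∧ B.cls Γ τ = b

theorem rel_cls (q : Cut B A M) (τ : GBundle Γ B.carrier) :
    q.Rel (M.cls Γ (τ.pull q.toContinuousMap)) (B.cls Γ τ) := ⟨τ, rfl, rfl⟩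

variable {q}

/-- Conjugating both copies of a curve by the same element preserves matching, so the translated
class is again a pull-back; the class below it is determined by `smul_cls_eq_iff`. -/
theorem Rel.smul {c : M.Classes Γ} {b : B.Classes Γ} (h : q.Rel c b) (g : I ⊕ O → Γ) (k : K → Γ)
    [Finite K] : q.Rel (glGauge g k • c) (g • b) := by
  obtain ⟨τ, rfl, rfl⟩ := h
  obtain ⟨σ, hσ⟩ := q.exists_cls_pull_eq (c := glGauge g k • M.cls Γ (τ.pull q.toContinuousMap))
    (fun l => by
      have := q.matched_pull τ l
      simp only [Surface.clsHol_smul, Pi.mul_apply, Pi.inv_apply, this]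
      simp [glGauge, mul_assoc])
  exact ⟨σ, hσ, (q.smul_cls_eq_iff.2 ⟨k, hσ.symm⟩).symm⟩

theorem Rel.exists_smul {c c' : M.Classes Γ} {b : B.Classes Γ} {g : I ⊕ O → Γ} (h : q.Rel c b)
    (h' : q.Rel c' (g • b)) : ∃ k : K → Γ, glGauge g k • c = c' := by
  obtain ⟨τ, rfl, rfl⟩ := h
  obtain ⟨σ, rfl, hσ⟩ := h'
  exact q.smul_cls_eq_iff.1 hσ.symm

theorem Rel.eq_smul {c c' : M.Classes Γ} {b b' : B.Classes Γ} {g : I ⊕ O → Γ} {k : K → Γ}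
    (h : q.Rel c b) (h' : q.Rel c' b') (e : glGauge g k • c = c') : g • b = b' := by
  obtain ⟨τ, rfl, rfl⟩ := h
  obtain ⟨σ, rfl, rfl⟩ := h'
  exact q.smul_cls_eq_iff.2 ⟨k, e⟩

theorem Rel.unique {c : M.Classes Γ} {b b' : B.Classes Γ} (h : q.Rel c b) (h' : q.Rel c b') :
    b = b' := by
  have := h.eq_smul (g := 1) (k := 1) h' (by rw [glGauge_one, one_smul])
  rwa [one_smul] at this

theorem Rel.matched {c : M.Classes Γ} {b : B.Classes Γ} (h : q.Rel c b) : Surface.Matched c := by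
  obtain ⟨τ, rfl, rfl⟩ := h
  exact q.matched_pull τ

theorem exists_rel_of_matched [Finite K] (q : Cut B A M) {c : M.Classes Γ}
    (h : Surface.Matched c) : ∃ b : B.Classes Γ, q.Rel c b := by
  obtain ⟨τ, hτ⟩ := q.exists_cls_pull_eq h
  exact ⟨_, τ, hτ, rfl⟩

theorem exists_rel (q : Cut B A M) (b : B.Classes Γ) : ∃ c : M.Classes Γ, q.Rel c b := by
  obtain ⟨τ, rfl⟩ := Surface.exists_rep b
  exact ⟨_, τ, rfl, rfl⟩

theorem Rel.clsHol_inl {c : M.Classes Γ} {b : B.Classes Γ} (h : q.Rel c b) (i : I) :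
    M.clsHol Γ c (Sum.inl (Sum.inl i)) = B.clsHol Γ b (Sum.inl i) := by
  obtain ⟨τ, rfl, rfl⟩ := h
  exact congrArg (·⁻¹) (hol_congr_apply τ ((M.loop _).map q.toContinuousMap.continuous) _
    fun t => q.map_in i _)

theorem Rel.clsHol_inr {c : M.Classes Γ} {b : B.Classes Γ} (h : q.Rel c b) (o : O) :
    M.clsHol Γ c (Sum.inr (Sum.inl o)) = B.clsHol Γ b (Sum.inr o) := by
  obtain ⟨τ, rfl, rfl⟩ := h
  exact hol_congr_apply τ ((M.loop _).map q.toContinuousMap.continuous) _ fun t => q.map_out o _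

theorem Rel.clsHol_eq {c : M.Classes Γ} {b : B.Classes Γ} (h : q.Rel c b) :
    M.clsHol Γ c ∘ (Equiv.sumSumSumComm I K O K).symm ∘ Sum.inl = B.clsHol Γ b := by
  funext j
  rcases j with i | o
  · exact h.clsHol_inl i
  · exact h.clsHol_inr o

/-- Evaluate automorphisms of `τ` at the base points of the curves. Those with value 1 there are the
based automorphisms of the pull-back, and the values that occur are exactly the elements of Γ^K
fixing its class. Lagrange's theorem then gives the count. -/
theorem card_stabilizer_mul (q : Cut B A M) (τ : GBundle Γ B.carrier) :
    Nat.card {h : K → Γ // glGauge (1 : I ⊕ O → Γ) h • M.cls Γ (τ.pull q.toContinuousMap) =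
        M.cls Γ (τ.pull q.toContinuousMap)} * M.clsAut Γ (M.cls Γ (τ.pull q.toContinuousMap)) =
      B.clsAut Γ (B.cls Γ τ) := by
  let φ : MulAction.stabilizer (basedGauge Γ B.base) τ →* (K → Γ) :=
    { toFun := fun η k => η.1.1 (A.curve k 1)
      map_one' := rfl
      map_mul' := fun _ _ => rfl }
  have h1 : Nat.card φ.range * Nat.card φ.ker = B.clsAut Γ (B.cls Γ τ) := by
    rw [← Nat.card_congr (QuotientGroup.quotientKerEquivRange φ).toEquiv]
    exact (Subgroup.card_eq_card_quotient_mul_card_subgroup _).symm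
  rw [← h1, Surface.clsAut_cls]
  congr 1
  · refine Nat.card_congr (Equiv.subtypeEquivRight fun h => ?_)
    rw [Surface.smul_cls_eq_iff]
    constructor
    · rintro ⟨ζ, hζ, e⟩
      obtain ⟨η, rfl, hη⟩ := q.exists_gauge_eq (fun k => (hζ (Sum.inl (Sum.inr k))).trans (hζ (Sum.inr (Sum.inr k))).symm) e
      refine ⟨⟨⟨η, ?_⟩, hη⟩, funext fun k => ?_⟩
      · rintro (i | o)
        · exact (congrArg η (q.map_base_inl i)).symm.trans (hζ _)
        · exact (congrArg η (q.map_base_inr o)).symm.trans (hζ _)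
      · exact (congrArg η (q.map_curve_in k 1)).symm.trans (hζ _)
    · rintro ⟨η, rfl⟩
      refine ⟨η.1.1 ∘ q.toContinuousMap, ?_, congrArg (pull q.toContinuousMap) η.2⟩
      rintro ((i | k) | (o | k))
      · exact (congrArg η.1.1 (q.map_base_inl i)).trans (η.1.2 _)
      · exact congrArg η.1.1 (q.map_curve_in k 1)
      · exact (congrArg η.1.1 (q.map_base_inr o)).trans (η.1.2 _)
      · exact congrArg η.1.1 (q.map_curve_out k 1)
  · symm
    refine Nat.card_congr (Equiv.ofBijective (fun η => ⟨η.1.1.1 ∘ q.toContinuousMap, ?_,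
      congrArg (pull q.toContinuousMap) η.1.2⟩) ⟨?_, ?_⟩)
    · have hk : ∀ k, η.1.1.1 (A.curve k 1) = 1 := fun k => congrFun η.2 k
      rintro ((i | k) | (o | k))
      · exact (congrArg η.1.1.1 (q.map_base_inl i)).trans (η.1.1.2 _)
      · exact (congrArg η.1.1.1 (q.map_curve_in k 1)).trans (hk k)
      · exact (congrArg η.1.1.1 (q.map_base_inr o)).trans (η.1.1.2 _)
      · exact (congrArg η.1.1.1 (q.map_curve_out k 1)).trans (hk k)
    · intro η ζ e
      refine Subtype.ext (Subtype.ext (Subtype.ext (funext fun x => ?_)))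
      obtain ⟨y, rfl⟩ := q.map_surjective x
      exact congrFun (congrArg Subtype.val e) y
    · rintro ⟨ζ, hζ, e⟩
      obtain ⟨η, rfl, hη⟩ := q.exists_gauge_eq (fun k => (hζ (Sum.inl (Sum.inr k))).trans (hζ (Sum.inr (Sum.inr k))).symm) e
      refine ⟨⟨⟨⟨η, ?_⟩, hη⟩, funext fun k => ?_⟩, rfl⟩
      · rintro (i | o)
        · exact (congrArg η (q.map_base_inl i)).symm.trans (hζ _)
        · exact (congrArg η (q.map_base_inr o)).symm.trans (hζ _)
      · exact (congrArg η (q.map_curve_in k 1)).symm.trans (hζ _)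

/-- The classes over `b` are one orbit of Γ^K. The orbit-stabilizer formula combined with
`card_stabilizer_mul` yields the identity that accounts for the factor in the gluing functor. -/
theorem Rel.card_mul [Finite K] {c : M.Classes Γ} {b : B.Classes Γ} (h : q.Rel c b) :
    Nat.card {c' : M.Classes Γ // q.Rel c' b} * B.clsAut Γ b =
      Nat.card (K → Γ) * M.clsAut Γ c := by
  let φ : (K → Γ) →* ((I ⊕ K) ⊕ (O ⊕ K) → Γ) :=
    { toFun := fun h => glGauge 1 h
      map_one' := glGauge_one
      map_mul' := fun h h' => by rw [← glGauge_mul, one_mul] }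
  let _ : MulAction (K → Γ) (M.Classes Γ) := MulAction.compHom _ φ
  have horb : Nat.card {c' : M.Classes Γ // q.Rel c' b} = Nat.card (MulAction.orbit (K → Γ) c) := by
    refine Nat.card_congr (Equiv.subtypeEquivRight fun c' => ?_)
    constructor
    · intro h'
      exact h.exists_smul (g := 1) (by rwa [one_smul])
    · rintro ⟨k, rfl⟩
      have := h.smul 1 k
      rwa [one_smul] at this
  have h2 : Nat.card (K → Γ) = Nat.card (MulAction.orbit (K → Γ) c) *
      Nat.card (MulAction.stabilizer (K → Γ) c) := by
    rw [← Nat.card_prod]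
    exact Nat.card_congr (MulAction.orbitProdStabilizerEquivGroup (K → Γ) c).symm
  rw [horb, h2, mul_assoc]
  congr 1
  obtain ⟨τ, rfl, rfl⟩ := h
  exact (q.card_stabilizer_mul τ).symm

theorem Rel.clsAut_eq {c c' : M.Classes Γ} {b : B.Classes Γ} (h : q.Rel c b) (h' : q.Rel c' b) :
    M.clsAut Γ c' = M.clsAut Γ c := by
  obtain ⟨k, rfl⟩ := h.exists_smul (g := 1) (by rwa [one_smul])
  exact M.clsAut_smul Γ _ _

end Cut

/-! ### Isomorphisms and isometries of graded spaces -/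

namespace EObj

variable {Γ : Type u} [Group Γ] {J : Type}

/-- A bijective morphism is an isomorphism. -/
def isoOfBijective {U W : EObj Γ J} (f : U ⟶ W) (hf : Function.Bijective (lin f)) : U ≅ W where
  hom := f
  inv := EHom.mk (U := W) (W := U) (LinearEquiv.ofBijective (lin f) hf).symm.toLinearMap
    (fun x w hw => by
      set u := (LinearEquiv.ofBijective (lin f) hf).symm w
      have hu : lin f u = w := (LinearEquiv.ofBijective (lin f) hf).apply_symm_apply w
      change u ∈ U.grade x
      -- Split `u` into its part of degree `x` and a rest `b`. The image of `b` lies both in degree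
      -- `x` and in the orthogonal sum of the other degrees, so it vanishes, and `b` vanishes by
      -- injectivity.
      have hmem : u ∈ U.grade x ⊔ ⨆ (y) (_ : y ≠ x), U.grade y := by
        rw [← iSup_split_single, U.span]
        trivial
      obtain ⟨a, ha, b, hb, hab⟩ := Submodule.mem_sup.1 hmem
      have hfb : lin f b ∈ ⨆ (y) (_ : y ≠ x), W.grade y := by
        have key : (⨆ (y) (_ : y ≠ x), U.grade y) ≤
            (⨆ (y) (_ : y ≠ x), W.grade y).comap (lin f) :=
          iSup₂_le fun y hy v hv => Submodule.mem_iSup_of_mem y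
            (Submodule.mem_iSup_of_mem hy (EHom.map_grade f y v hv))
        exact key hb
      have hfb' : lin f b ∈ W.grade x := by
        have : lin f b = w - lin f a := by rw [← hu, ← hab, map_add, add_sub_cancel_left]
        rw [this]
        exact Submodule.sub_mem _ hw (EHom.map_grade f x a ha)
      have horth : W.grade x ⟂ ⨆ (y) (_ : y ≠ x), W.grade y := by
        simp only [Submodule.isOrtho_iSup_right]
        exact fun y hy => W.ortho x y hy.symm
      have h0 : lin f b = 0 := inner_self_eq_zero.1 (horth.inner_eq hfb' hfb)
      have hb0 : b = 0 := hf.1 (h0.trans (map_zero _).symm)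
      rwa [← hab, hb0, add_zero])
    (fun g w => by
      refine hf.1 ?_
      have h1 := fun w => (LinearEquiv.ofBijective (lin f) hf).apply_symm_apply w
      exact (h1 _).trans (((EHom.map_act f g _).trans (congrArg (W.act g) (h1 w))).symm))
  hom_inv_id := hom_ext (LinearMap.ext fun v =>
    (LinearEquiv.ofBijective (lin f) hf).symm_apply_apply v)
  inv_hom_id := hom_ext (LinearMap.ext fun v =>
    (LinearEquiv.ofBijective (lin f) hf).apply_symm_apply v)

theorem lin_hom_lin_inv {U W : EObj Γ J} (φ : U ≅ W) (v : W.V) :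
    lin φ.hom (lin φ.inv v) = v :=
  congrArg (fun h => lin h v) φ.inv_hom_id

theorem lin_comp {U V W : EObj Γ J} (f : U ⟶ V) (g : V ⟶ W) (v : U.V) :
    lin (f ≫ g) v = lin g (lin f v) := rfl

theorem _root_.IsIsometric.injective {U W : EObj Γ J} {f : U ⟶ W} (h : IsIsometric f) :
    Function.Injective (lin f) := by
  refine (injective_iff_map_eq_zero _).2 fun v hv => ?_
  rw [← inner_self_eq_zero (𝕜 := ℂ), ← h, hv, inner_zero_left]

theorem _root_.IsIsometric.inv {U W : EObj Γ J} {φ : U ≅ W} (h : IsIsometric φ.hom) :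
    IsIsometric φ.inv := fun v w => by
  rw [← h, lin_hom_lin_inv, lin_hom_lin_inv]

theorem _root_.IsIsometric.comp {U V W : EObj Γ J} {f : U ⟶ V} {g : V ⟶ W} (hf : IsIsometric f)
    (hg : IsIsometric g) : IsIsometric (f ≫ g) := fun v w => by
  rw [lin_comp, lin_comp, hg, hf]

theorem isIsometric_contractFunctor_map [Finite Γ] {K : Type} [Finite K]
    {U W : EObj Γ (J ⊕ (K ⊕ K))} {f : U ⟶ W} (hf : IsIsometric f) :
    IsIsometric ((contractFunctor Γ J K).map f) := fun v w =>
  congrArg ((contractFactor Γ K : ℂ) * ·) (hf v.1 w.1)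

theorem isIsometric_reindexFunctor_map {J' : Type} (e : J ≃ J') {U W : EObj Γ J} {f : U ⟶ W}
    (hf : IsIsometric f) : IsIsometric ((reindexFunctor Γ e).map f) := hf

end EObj

theorem TensorProduct.inner_map_eq {V W X : Type*} [NormedAddCommGroup V] [InnerProductSpace ℂ V]
    [NormedAddCommGroup W] [InnerProductSpace ℂ W] [NormedAddCommGroup X] [InnerProductSpace ℂ X]
    (f : V ⊗[ℂ] W →ₗ[ℂ] X) (hf : ∀ v w v' w', inner ℂ (f (v ⊗ₜ w)) (f (v' ⊗ₜ w')) =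
      inner ℂ v v' * inner ℂ w w') (s t : V ⊗[ℂ] W) : inner ℂ (f s) (f t) = inner ℂ s t := by
  induction s using TensorProduct.induction_on with
  | zero => simp
  | add s s' hs hs' => rw [map_add, inner_add_left, inner_add_left, hs, hs']
  | tmul v w =>
    induction t using TensorProduct.induction_on with
    | zero => simp
    | add t t' ht ht' => rw [map_add, inner_add_right, inner_add_right, ht, ht']
    | tmul v' w' => rw [hf, TensorProduct.inner_tmul]

/-! ### Coordinates on Z(B); the isometries for diffeomorphisms and disjoint unions -/

namespace ZSpace

variable {Γ : Type u} [Group Γ] {I O : Type} {B : Surface.{u} I O}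

theorem add_apply (v w : ZSpace Γ B) (c : B.Classes Γ) : (v + w) c = v c + w c := rfl

/-- The element with given coefficients. -/
def ofFun (f : B.Classes Γ → ℂ) : ZSpace Γ B := f

theorem ofFun_apply (f : B.Classes Γ → ℂ) (c : B.Classes Γ) : ofFun f c = f c := rfl

theorem smul_apply (a : ℂ) (v : ZSpace Γ B) (c : B.Classes Γ) : (a • v) c = a * v c := rfl

theorem push_apply {I' O' : Type} {B' : Surface.{u} I' O'} (f : LDiffeo B B') (v : ZSpace Γ B)
    (c : B'.Classes Γ) : push Γ f v c = v (f.pullCls Γ c) := rfl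

theorem act_apply [Finite Γ] [Finite I] [Finite O] (g : I ⊕ O → Γ) (v : ZSpace Γ B)
    (c : B.Classes Γ) : ((Z Γ B).act g v : ZSpace Γ B) c = v (g⁻¹ • c) := rfl

open Classical in
/-- The basis element given by a class. -/
def single (c : B.Classes Γ) : ZSpace Γ B := (Pi.single c 1 : B.Classes Γ → ℂ)

open Classical in
theorem single_self (c : B.Classes Γ) : single c c = 1 := Pi.single_eq_same _ _

open Classical in
theorem single_of_ne {c d : B.Classes Γ} (h : d ≠ c) : single c d = 0 := Pi.single_eq_of_ne h _

theorem eq_sum_single [Finite Γ] [Finite I] [Finite O] (v : ZSpace Γ B) :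
    v = ∑ c : B.Classes Γ, v c • single c := by
  classical
  have h := (Finset.univ_sum_single (v : B.Classes Γ → ℂ)).symm
  refine h.trans (Finset.sum_congr rfl fun c _ => ?_)
  funext d
  change (Pi.single c (v c) : B.Classes Γ → ℂ) d = v c * (Pi.single c 1 : B.Classes Γ → ℂ) d
  by_cases hd : d = c
  · subst hd; simp
  · simp [hd]

variable (Γ B) in
/-- The functions supported on a set of classes. -/
def supp (S : Set (B.Classes Γ)) : Submodule ℂ (ZSpace Γ B) where
  carrier := {v | ∀ c, c ∉ S → v c = 0}
  add_mem' hv hw c hc := by rw [add_apply, hv c hc, hw c hc, add_zero]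
  zero_mem' _ _ := rfl
  smul_mem' a v hv c hc := by rw [smul_apply, hv c hc, mul_zero]

theorem single_mem_supp {S : Set (B.Classes Γ)} {c : B.Classes Γ} (hc : c ∈ S) :
    single c ∈ supp Γ B S := fun _ hd => single_of_ne fun h => hd (h ▸ hc)

variable [Finite Γ] [Finite I] [Finite O]

/-- The classes form a finite basis, so joins of coordinate subspaces correspond to unions of index
sets. This identifies the matched part of `Z` with the functions supported on matched classes. -/
theorem iSup_supp {ι : Sort*} (S : ι → Set (B.Classes Γ)) :
    ⨆ i, supp Γ B (S i) = supp Γ B (⋃ i, S i) := by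
  apply le_antisymm
  · exact iSup_le fun i v hv c hc => hv c fun h => hc (Set.mem_iUnion.2 ⟨i, h⟩)
  · intro v hv
    rw [eq_sum_single v]
    refine Submodule.sum_mem _ fun c _ => ?_
    by_cases hc : c ∈ ⋃ i, S i
    · obtain ⟨i, hi⟩ := Set.mem_iUnion.1 hc
      exact Submodule.smul_mem _ _ (Submodule.mem_iSup_of_mem i (single_mem_supp hi))
    · rw [hv c hc, zero_smul]
      exact Submodule.zero_mem _

end ZSpace

namespace LDiffeo

variable {Γ : Type u} [Group Γ] [Finite Γ] {I O I' O' : Type} [Finite I] [Finite O] [Finite I']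
  [Finite O'] {B : Surface.{u} I O} {B' : Surface.{u} I' O'} (f : LDiffeo B B')

variable (Γ) in
/-- The map `f_*` as a morphism. -/
def pushHom : (reindexFunctor Γ f.bdry).obj (Z Γ B) ⟶ Z Γ B' :=
  EHom.mk (U := (reindexFunctor Γ f.bdry).obj (Z Γ B)) (W := Z Γ B') (ZSpace.push Γ f)
    (fun _ _ hv c hc => hv _ fun h => hc (f.bdry.surjective.injective_comp_right
      ((f.clsHol_pullCls c).symm.trans h)))
    (fun g v => funext fun c => congrArg v (f.pullCls_smul g⁻¹ c).symm)

theorem pushHom_bijective : Function.Bijective (EObj.lin (f.pushHom Γ)) :=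
  ((Equiv.ofBijective _ (f.pullCls_bijective (Γ := Γ))).arrowCongr (Equiv.refl ℂ)).symm.bijective

theorem isIsometric_pushHom : IsIsometric (f.pushHom Γ) := fun v w => by
  refine Fintype.sum_equiv (Equiv.ofBijective _ (f.pullCls_bijective (Γ := Γ))) _ _ fun c => ?_
  rw [Equiv.ofBijective_apply, f.clsAut_pullCls]
  rfl

end LDiffeo

namespace SumDecomp

variable {Γ : Type u} [Group Γ] {I O I₁ O₁ I₂ O₂ : Type} {M : Surface.{u} I O}
  {B : Surface.{u} I₁ O₁} {B' : Surface.{u} I₂ O₂} (D : SumDecomp M B B')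

variable (Γ) in
/-- The map `Z(B) ⊗ Z(B') → Z(M)`. -/
def tensorMap : ZSpace Γ B ⊗[ℂ] ZSpace Γ B' →ₗ[ℂ] ZSpace Γ M :=
  TensorProduct.lift (LinearMap.mk₂ ℂ
    (fun v w => (fun c => v (D.clsEquiv Γ c).1 * w (D.clsEquiv Γ c).2 : ZSpace Γ M))
    (fun _ _ _ => funext fun _ => add_mul _ _ _)
    (fun _ _ _ => funext fun _ => mul_assoc _ _ _)
    (fun _ _ _ => funext fun _ => mul_add _ _ _)
    (fun _ _ _ => funext fun _ => mul_left_comm _ _ _))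

theorem tensorMap_tmul (v : ZSpace Γ B) (w : ZSpace Γ B') (c : M.Classes Γ) :
    D.tensorMap Γ (v ⊗ₜ w) c = v (D.clsEquiv Γ c).1 * w (D.clsEquiv Γ c).2 := rfl

theorem coeff_tensorMap (ρ : GBundle Γ M.carrier) (t : ZSpace Γ B ⊗[ℂ] ZSpace Γ B') :
    D.tensorMap Γ t (M.cls Γ ρ) = coeff₂ (ρ.pull D.left) (ρ.pull D.right) t := by
  have : (ZSpace.coeff Γ M ρ) ∘ₗ D.tensorMap Γ = coeff₂ (ρ.pull D.left) (ρ.pull D.right) :=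
    TensorProduct.ext' fun v w => rfl
  exact LinearMap.congr_fun this t

variable [Finite Γ] [Finite I] [Finite O] [Finite I₁] [Finite O₁] [Finite I₂] [Finite O₂]

variable (Γ) in
/-- The map `Z(B) ⊠ Z(B') → Z(M)` as a morphism. -/
def tensorHom : EObj.reindex D.idx ((Z Γ B).ext (Z Γ B')) ⟶ Z Γ M :=
  EHom.mk (U := EObj.reindex D.idx ((Z Γ B).ext (Z Γ B'))) (W := Z Γ M) (D.tensorMap Γ)
    (fun x t ht => by
      have key : Submodule.map₂ (TensorProduct.mk ℂ (ZSpace Γ B) (ZSpace Γ B'))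
          ((Z Γ B).grade ((x ∘ D.idx) ∘ Sum.inl)) ((Z Γ B').grade ((x ∘ D.idx) ∘ Sum.inr)) ≤
          ((Z Γ M).grade x).comap (D.tensorMap Γ) := by
        refine Submodule.map₂_le.2 fun v hv w hw c hc => ?_
        refine (D.tensorMap_tmul v w c).trans ?_
        by_contra h
        obtain ⟨h1, h2⟩ := mul_ne_zero_iff.1 h
        refine hc (funext fun j => ?_)
        obtain ⟨j | j, rfl⟩ := D.idx.surjective j
        · rw [← D.clsHol_inl]
          exact congrFun (not_imp_comm.1 (hv _) h1) j
        · rw [← D.clsHol_inr]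
          exact congrFun (not_imp_comm.1 (hw _) h2) j
      exact key ht)
    (fun g t => by
      have key : D.tensorMap Γ ∘ₗ TensorProduct.map ((Z Γ B).act ((g ∘ D.idx) ∘ Sum.inl))
          ((Z Γ B').act ((g ∘ D.idx) ∘ Sum.inr)) = (Z Γ M).act g ∘ₗ D.tensorMap Γ := by
        refine TensorProduct.ext' fun v w => funext fun c => ?_
        have h := D.clsEquiv_smul g⁻¹ c
        exact (congr (congrArg HMul.hMul (congrArg v (Prod.ext_iff.1 h).1))
          (congrArg w (Prod.ext_iff.1 h).2)).symm
      exact LinearMap.congr_fun key t)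

/-- Classes on the union are pairs and the weights 1/#Aut multiply, so the sum defining the inner
product of two products factors. -/
theorem isIsometric_tensorHom : IsIsometric (D.tensorHom Γ) := by
  refine TensorProduct.inner_map_eq (D.tensorMap Γ) fun v w v' w' => ?_
  rw [ZSpace.inner_def, ZSpace.inner_def, ZSpace.inner_def, Finset.sum_mul_sum,
    ← Fintype.sum_prod_type']
  refine Fintype.sum_equiv (D.clsEquiv Γ) _ _ fun c => ?_
  rw [D.clsAut_eq, tensorMap_tmul, tensorMap_tmul]
  simp only [RCLike.inner_apply, map_mul, Nat.cast_mul]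
  rw [one_div, mul_inv]
  ring

/-- An isometric map is injective, and each basis vector is the image of the tensor product of two
basis vectors. -/
theorem tensorHom_bijective : Function.Bijective (EObj.lin (D.tensorHom Γ)) := by
  refine ⟨D.isIsometric_tensorHom.injective, ?_⟩
  intro v
  change v ∈ LinearMap.range (D.tensorMap Γ)
  rw [ZSpace.eq_sum_single v]
  refine Submodule.sum_mem _ fun c _ => Submodule.smul_mem _ _ ?_
  refine ⟨ZSpace.single (D.clsEquiv Γ c).1 ⊗ₜ ZSpace.single (D.clsEquiv Γ c).2, funext fun d => ?_⟩
  rw [tensorMap_tmul]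
  by_cases h : d = c
  · subst h
    rw [ZSpace.single_self, ZSpace.single_self, ZSpace.single_self, mul_one]
  · rw [ZSpace.single_of_ne h]
    by_contra h'
    obtain ⟨h1, h2⟩ := mul_ne_zero_iff.1 h'
    exact h ((D.clsEquiv Γ).injective (Prod.ext
      (not_imp_comm.1 ZSpace.single_of_ne h1) (not_imp_comm.1 ZSpace.single_of_ne h2)))

variable (Γ) in
/-- The isometry `Z(M) ≅ Z(B) ⊠ Z(B')`. -/
def iso : Z Γ M ≅ EObj.reindex D.idx ((Z Γ B).ext (Z Γ B')) :=
  (EObj.isoOfBijective _ (D.tensorHom_bijective (Γ := Γ))).symm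

theorem isIsometric_iso : IsIsometric (D.iso Γ).hom :=
  IsIsometric.inv (φ := EObj.isoOfBijective _ (D.tensorHom_bijective (Γ := Γ)))
    D.isIsometric_tensorHom

theorem tensorMap_iso (v : ZSpace Γ M) : D.tensorMap Γ (EObj.lin (D.iso Γ).hom v) = v :=
  EObj.lin_hom_lin_inv (EObj.isoOfBijective _ (D.tensorHom_bijective (Γ := Γ))) v

theorem coeff₂_iso (v : ZSpace Γ M) (ρ : GBundle Γ M.carrier) :
    coeff₂ (ρ.pull D.left) (ρ.pull D.right) (EObj.lin (D.iso Γ).hom v) = v (M.cls Γ ρ) := by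
  exact (D.coeff_tensorMap ρ _).symm.trans (congrFun (D.tensorMap_iso v) _)

theorem tensorMap_injective : Function.Injective (D.tensorMap Γ) :=
  D.tensorHom_bijective.1

end SumDecomp

/-! ### The gluing isometry for a cut surface -/

theorem Surface.clsHol_eq_iff {Γ : Type u} [Group Γ] {I O K : Type}
    {M : Surface.{u} (I ⊕ K) (O ⊕ K)} {c : M.Classes Γ} {y : I ⊕ O → Γ} :
    (Surface.Matched c ∧ M.clsHol Γ c ∘ (Equiv.sumSumSumComm I K O K).symm ∘ Sum.inl = y) ↔
      ∃ x : K → Γ, M.clsHol Γ c =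
        Sum.elim y (Sum.elim x⁻¹ x) ∘ Equiv.sumSumSumComm I K O K := by
  constructor
  · rintro ⟨hm, rfl⟩
    refine ⟨fun k => M.clsHol Γ c (Sum.inr (Sum.inr k)), funext fun j => ?_⟩
    rcases j with (i | k) | (o | k)
    · rfl
    · exact hm k
    · rfl
    · rfl
  · rintro ⟨x, hx⟩
    refine ⟨fun k => ?_, ?_⟩
    · rw [hx]; rfl
    · rw [hx]; funext j; rcases j with j | j <;> rfl

section Matched

variable {Γ : Type u} [Group Γ] [Finite Γ] {I O K : Type} [Finite I] [Finite O] [Finite K]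
  {M : Surface.{u} (I ⊕ K) (O ⊕ K)}

theorem matched_Z_eq (y : I ⊕ O → Γ) :
    (EObj.reindex (Equiv.sumSumSumComm I K O K) (Z Γ M)).matched y =
      ZSpace.supp Γ M {c | Surface.Matched c ∧
        M.clsHol Γ c ∘ (Equiv.sumSumSumComm I K O K).symm ∘ Sum.inl = y} := by
  refine (ZSpace.iSup_supp fun x : K → Γ => {c | M.clsHol Γ c =
    Sum.elim y (Sum.elim x⁻¹ x) ∘ Equiv.sumSumSumComm I K O K}).trans (congrArg _ ?_)
  ext c
  rw [Set.mem_iUnion, Set.mem_ofPred_eq, Surface.clsHol_eq_iff]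
  rfl

theorem iSup_matched_Z_eq :
    ⨆ y, (EObj.reindex (Equiv.sumSumSumComm I K O K) (Z Γ M)).matched y =
      ZSpace.supp Γ M {c | Surface.Matched c} := by
  simp only [matched_Z_eq]
  refine (ZSpace.iSup_supp _).trans (congrArg _ ?_)
  ext c
  simp

end Matched

namespace Cut

variable {Γ : Type u} [Group Γ] {I O K : Type} {B : Surface.{u} I O} {A : CurveSystem B K}
  {M : Surface.{u} (I ⊕ K) (O ⊕ K)} (q : Cut B A M)

open Classical in
variable (Γ) in
/-- The map `Z(B) → Z(M)` such that the coefficient of `q^* τ` in the image of `v` is that of `τ`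
in `v`. -/
def transfer : ZSpace Γ B →ₗ[ℂ] ZSpace Γ M where
  -- The class chosen below `c` is unique by `Rel.unique`. Classes over which there is none receive
  -- 0, as they must in order to lie in the contraction.
  toFun v := ZSpace.ofFun fun c => if h : ∃ b, q.Rel c b then v h.choose else 0
  map_add' v w := funext fun c => by
    refine Eq.trans ?_ (ZSpace.add_apply _ _ c).symm
    simp only [ZSpace.ofFun_apply]
    split_ifs with h
    · rfl
    · exact (add_zero 0).symm
  map_smul' a v := funext fun c => by
    refine Eq.trans ?_ (ZSpace.smul_apply _ _ c).symm
    simp only [ZSpace.ofFun_apply]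
    split_ifs with h
    · rfl
    · exact (mul_zero _).symm

variable {q}

open Classical in
theorem Rel.transfer_apply {c : M.Classes Γ} {b : B.Classes Γ} (h : q.Rel c b) (v : ZSpace Γ B) :
    q.transfer Γ v c = v b := by
  have h' : ∃ b, q.Rel c b := ⟨b, h⟩
  exact (dif_pos h').trans (congrArg v (h'.choose_spec.unique h))

open Classical in
theorem transfer_apply_of_not {c : M.Classes Γ} (h : ¬ ∃ b, q.Rel c b) (v : ZSpace Γ B) :
    q.transfer Γ v c = 0 := dif_neg h

theorem exists_rel_of_ne_zero {c : M.Classes Γ} {v : ZSpace Γ B} (h : q.transfer Γ v c ≠ 0) :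
    ∃ b, q.Rel c b ∧ v b ≠ 0 := by
  by_cases h' : ∃ b, q.Rel c b
  · obtain ⟨b, hb⟩ := h'
    exact ⟨b, hb, by rwa [hb.transfer_apply] at h⟩
  · exact absurd (transfer_apply_of_not h' v) h

theorem transfer_injective : Function.Injective (q.transfer Γ) := fun v w h => by
  funext b
  obtain ⟨c, hc⟩ := q.exists_rel b
  rw [← hc.transfer_apply v, h, hc.transfer_apply]

/-- The element `k` does not appear on the left: the formula contains both equivariance for the
boundary of `B` and invariance under the diagonal Γ^K. -/
theorem transfer_smul [Finite K] (g : I ⊕ O → Γ) (k : K → Γ) (v : ZSpace Γ B)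
    (c : M.Classes Γ) : q.transfer Γ (ZSpace.ofFun fun b => v (g • b)) c =
      q.transfer Γ v (glGauge g k • c) := by
  by_cases h : ∃ b, q.Rel c b
  · obtain ⟨b, hb⟩ := h
    rw [hb.transfer_apply, (hb.smul g k).transfer_apply, ZSpace.ofFun_apply]
  · rw [transfer_apply_of_not h, transfer_apply_of_not]
    rintro ⟨b, hb⟩
    refine h ⟨g⁻¹ • b, ?_⟩
    have := hb.smul g⁻¹ k⁻¹
    rwa [← mul_smul, ← glGauge_mul, inv_mul_cancel, inv_mul_cancel, glGauge_one, one_smul] at this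

variable [Finite Γ] [Finite I] [Finite O] [Finite K]

theorem act_glGauge (g : I ⊕ O → Γ) (h : K → Γ) (v : ZSpace Γ M) :
    (EObj.reindex (Equiv.sumSumSumComm I K O K) (Z Γ M)).act (Sum.elim g (Sum.elim h h)) v =
      (Z Γ M).act (glGauge g h) v := rfl

theorem transfer_mem (v : ZSpace Γ B) : q.transfer Γ v ∈
    (EObj.reindex (Equiv.sumSumSumComm I K O K) (Z Γ M)).contractSpace := by
  refine ⟨?_, fun h => ?_⟩
  · rw [iSup_matched_Z_eq]
    intro c hc
    by_contra h
    obtain ⟨b, hb, -⟩ := exists_rel_of_ne_zero h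
    exact hc hb.matched
  · refine (act_glGauge 1 h _).trans (funext fun c => ?_)
    refine (ZSpace.act_apply _ _ c).trans ?_
    rw [glGauge_inv, inv_one, ← transfer_smul]
    refine congrArg (fun u => q.transfer Γ u c) (funext fun b => ?_)
    rw [ZSpace.ofFun_apply, one_smul]

/-- An element of the contraction vanishes off the matched classes and is constant on Γ^K-orbits,
which are the sets of classes over a fixed class of `B`. Reading it off at an arbitrary lift `r b`
hence gives a preimage. -/
theorem exists_transfer_eq {w : ZSpace Γ M}
    (hw : w ∈ (EObj.reindex (Equiv.sumSumSumComm I K O K) (Z Γ M)).contractSpace) :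
    ∃ v : ZSpace Γ B, q.transfer Γ v = w := by
  choose r hr using q.exists_rel (Γ := Γ)
  refine ⟨ZSpace.ofFun fun b => w (r b), funext fun c => ?_⟩
  by_cases h : ∃ b, q.Rel c b
  · obtain ⟨b, hb⟩ := h
    rw [hb.transfer_apply, ZSpace.ofFun_apply]
    obtain ⟨k, hk⟩ := hb.exists_smul (g := 1) (c' := r b) (by rw [one_smul]; exact hr b)
    have h1 := congrFun ((act_glGauge (M := M) 1 k⁻¹ w).symm.trans (hw.2 k⁻¹)) c
    have h2 := (ZSpace.act_apply (glGauge 1 k⁻¹) w c).symm.trans h1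
    rw [glGauge_inv, inv_one, inv_inv, hk] at h2
    exact h2
  · rw [transfer_apply_of_not h]
    have h1 := hw.1
    rw [iSup_matched_Z_eq] at h1
    exact (h1 c fun hc => h (q.exists_rel_of_matched hc)).symm

variable (q)

variable (Γ) in
/-- The gluing isometry as a morphism. -/
def glHom : Z Γ B ⟶ (glFunctor Γ I O K).obj (Z Γ M) :=
  EHom.mk (U := Z Γ B) (W := (glFunctor Γ I O K).obj (Z Γ M))
    ((Scaled.equiv (contractFactor Γ K) _).toLinearMap ∘ₗ
      (q.transfer Γ).codRestrict
        (EObj.reindex (Equiv.sumSumSumComm I K O K) (Z Γ M)).contractSpace transfer_mem)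
    (fun y v hv => by
      change q.transfer Γ v ∈ (EObj.reindex (Equiv.sumSumSumComm I K O K) (Z Γ M)).matched y
      rw [matched_Z_eq]
      intro c hc
      by_contra h
      obtain ⟨b, hb, hvb⟩ := exists_rel_of_ne_zero h
      exact hc ⟨hb.matched, hb.clsHol_eq.trans (not_imp_comm.1 (hv b) hvb)⟩)
    (fun g v => by
      refine Subtype.ext ?_
      have e : (Sum.elim g 1 : (I ⊕ O) ⊕ (K ⊕ K) → Γ) = Sum.elim g (Sum.elim 1 1) := by
        funext j; rcases j with j | j | j <;> rfl
      change q.transfer Γ ((Z Γ B).act g v) =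
        (EObj.reindex (Equiv.sumSumSumComm I K O K) (Z Γ M)).act (Sum.elim g 1) (q.transfer Γ v)
      rw [e]
      refine Eq.trans (funext fun c => ?_) (act_glGauge g 1 _).symm
      refine (transfer_smul g⁻¹ 1 v c).trans ?_
      refine Eq.trans ?_ (ZSpace.act_apply (glGauge g 1) _ c).symm
      rw [glGauge_inv, inv_one])

theorem glHom_bijective : Function.Bijective (EObj.lin (q.glHom Γ)) := by
  refine ⟨fun v w h => transfer_injective (q := q) (congrArg Subtype.val h), fun w => ?_⟩
  obtain ⟨v, hv⟩ := exists_transfer_eq (q := q) w.2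
  exact ⟨v, Subtype.ext hv⟩

/-- Summing over the classes of `M` fibre by fibre over those of `B`, the summand is constant on
each fibre, since #Aut is. `Rel.card_mul` gives the size of the fibre, and `contractFactor` cancels
#Γ^K. -/
theorem sum_eq_of_rel (F : M.Classes Γ → ℂ) (hF : ∀ c, (¬ ∃ b, q.Rel c b) → F c = 0)
    (G : B.Classes Γ → ℂ) (hFG : ∀ c b, q.Rel c b → F c = 1 / (M.clsAut Γ c : ℂ) * G b) :
    ((contractFactor Γ K : ℝ) : ℂ) * ∑ c, F c = ∑ b, 1 / (B.clsAut Γ b : ℂ) * G b := by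
  classical
  have h1 : ∀ c, F c = ∑ b, if q.Rel c b then F c else 0 := by
    intro c
    by_cases h : ∃ b, q.Rel c b
    · obtain ⟨b, hb⟩ := h
      rw [Finset.sum_eq_single b, if_pos hb]
      · exact fun d _ hd => if_neg fun hd' => hd (hd'.unique hb)
      · simp
    · rw [hF c h]
      simp
  rw [Finset.sum_congr rfl fun c _ => h1 c, Finset.sum_comm, Finset.mul_sum]
  refine Finset.sum_congr rfl fun b _ => ?_
  obtain ⟨c, hc⟩ := q.exists_rel b
  have h2 : ∀ c', (if q.Rel c' b then F c' else 0) =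
      if q.Rel c' b then 1 / (M.clsAut Γ c : ℂ) * G b else 0 := by
    intro c'
    split_ifs with h
    · rw [hFG c' b h, hc.clsAut_eq h]
    · rfl
  rw [Finset.sum_congr rfl fun c' _ => h2 c', ← Finset.sum_filter, Finset.sum_const, nsmul_eq_mul]
  have h3 := hc.card_mul
  rw [Nat.card_eq_fintype_card, Fintype.card_subtype, Nat.card_fun] at h3
  have h4 : ((Finset.univ.filter fun c' => q.Rel c' b).card : ℂ) * (B.clsAut Γ b : ℂ) =
      (Nat.card Γ : ℂ) ^ Nat.card K * (M.clsAut Γ c : ℂ) := by exact_mod_cast h3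
  have hb : (B.clsAut Γ b : ℂ) ≠ 0 := by exact_mod_cast (B.clsAut_pos Γ b).ne'
  have hcc : (M.clsAut Γ c : ℂ) ≠ 0 := by exact_mod_cast (M.clsAut_pos Γ c).ne'
  have hΓ : (Nat.card Γ : ℂ) ≠ 0 := by exact_mod_cast Nat.card_pos.ne'
  have h5 : ((Finset.univ.filter fun c' => q.Rel c' b).card : ℂ) =
      (Nat.card Γ : ℂ) ^ Nat.card K * (M.clsAut Γ c : ℂ) / (B.clsAut Γ b : ℂ) := by
    rw [eq_div_iff hb, h4]
  rw [h5]
  simp only [contractFactor]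
  push_cast
  field_simp

theorem isIsometric_glHom : IsIsometric (q.glHom Γ) := fun (v w : ZSpace Γ B) => by
  refine q.sum_eq_of_rel (fun c => 1 / (M.clsAut Γ c : ℂ) *
    inner ℂ (q.transfer Γ v c) (q.transfer Γ w c)) (fun c hc => ?_)
    (fun b => inner ℂ (v b) (w b)) (fun c b h => ?_)
  · rw [transfer_apply_of_not hc, inner_zero_left, mul_zero]
  · rw [h.transfer_apply, h.transfer_apply]

variable (Γ) in
/-- The gluing isometry. -/
def glIso : Z Γ B ≅ (glFunctor Γ I O K).obj (Z Γ M) :=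
  EObj.isoOfBijective _ (q.glHom_bijective (Γ := Γ))

end Cut

/-! ### Gluing two surfaces: the isometry with the tensor product -/

namespace Gluing

variable {Γ : Type u} [Group Γ] {I J L : Type} {B₁ : Surface.{u} I J} {B₂ : Surface.{u} J L}
  {B : Surface.{u} I L} {A : CurveSystem B J} (q : Gluing B₁ B₂ B A)

/-- The index bijection for the decomposition of a cut surface into its parts. -/
def idx (I J L : Type) : (J ⊕ L) ⊕ (I ⊕ J) ≃ (I ⊕ J) ⊕ (L ⊕ J) :=
  (Equiv.sumSumSumComm J L I J).trans
    (Equiv.sumCongr (Equiv.sumComm J I) (Equiv.refl (L ⊕ J)))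

/-- The cut surface decomposed into its parts. -/
def decomp (B₁ : Surface.{u} I J) (B₂ : Surface.{u} J L) :
    SumDecomp ((B₁.disjUnion B₂).relabel (Equiv.refl (I ⊕ J)) (Equiv.sumComm L J)) B₂ B₁ where
  homeo := Homeomorph.sumComm B₂.carrier B₁.carrier
  idx := idx I J L
  label_inl := by rintro (j | l) z <;> rfl
  label_inr := by rintro (i | j) z <;> rfl
  isLeft_inl := by rintro (j | l) <;> rfl
  isLeft_inr := by rintro (i | j) <;> rfl

/-- The class `b` is that of a bundle with restrictions of the classes `c.2` and `c.1`. -/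
def Rel (c : B₂.Classes Γ × B₁.Classes Γ) (b : B.Classes Γ) : Prop :=
  Cut.Rel q (((decomp B₁ B₂).clsEquiv Γ).symm c) b

theorem rel_iff {c : B₂.Classes Γ × B₁.Classes Γ} {b : B.Classes Γ} :
    q.Rel c b ↔ ∃ τ : GBundle Γ B.carrier, (B₂.cls Γ (τ.pull q.right), B₁.cls Γ (τ.pull q.left)) = c
      ∧ B.cls Γ τ = b := by
  refine exists_congr fun τ => and_congr_left fun _ => ?_
  rw [Equiv.eq_symm_apply, SumDecomp.clsEquiv_cls, GBundle.pull_pull, GBundle.pull_pull]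
  rfl

variable [Finite Γ] [Finite I] [Finite J] [Finite L]

variable (Γ) in
/-- The isometry `Z(B) ≅ gl(Z(B₂) ⊠ Z(B₁))`. -/
def glIso₂ : Z Γ B ≅ (glFunctor Γ I L J).obj (Z₂ Γ B₁ B₂) :=
  Cut.glIso Γ q ≪≫ (glFunctor Γ I L J).mapIso ((decomp B₁ B₂).iso Γ)

theorem isIsometric_glIso₂ : IsIsometric (q.glIso₂ Γ).hom :=
  (Cut.isIsometric_glHom q).comp (EObj.isIsometric_contractFunctor_map
    (EObj.isIsometric_reindexFunctor_map _ (decomp B₁ B₂).isIsometric_iso))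

variable (Γ) in
/-- The map `Z(B) → Z(B₂) ⊗ Z(B₁)` underlying the gluing isometry. -/
def transfer₂ : ZSpace Γ B →ₗ[ℂ] ZSpace Γ B₂ ⊗[ℂ] ZSpace Γ B₁ :=
  EObj.lin ((decomp B₁ B₂).iso Γ).hom ∘ₗ Cut.transfer Γ q

theorem tensorMap_transfer₂ (v : ZSpace Γ B) :
    (decomp B₁ B₂).tensorMap Γ (q.transfer₂ Γ v) = Cut.transfer Γ q v :=
  (decomp B₁ B₂).tensorMap_iso _

end Gluing

/-! ### Elements of the DW functor as equivariant functions on classes -/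

namespace ZSpace

variable {Γ : Type u} [Group Γ] {I O : Type} {B : Surface.{u} I O}

/-- The coefficient at the class `c`, on `V ⊗ Z(B)`. -/
def ev (V : Type u) [AddCommGroup V] [Module ℂ V] (c : B.Classes Γ) :
    V ⊗[ℂ] ZSpace Γ B →ₗ[ℂ] V :=
  (TensorProduct.rid ℂ V).toLinearMap ∘ₗ
    TensorProduct.map LinearMap.id (LinearMap.proj c : (B.Classes Γ → ℂ) →ₗ[ℂ] ℂ)

variable {V : Type u} [AddCommGroup V] [Module ℂ V]

theorem ev_tmul (c : B.Classes Γ) (u : V) (v : ZSpace Γ B) : ev V c (u ⊗ₜ v) = v c • u := rfl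

variable [Finite Γ] [Finite I] [Finite O]

theorem sum_ev_tmul_single (t : V ⊗[ℂ] ZSpace Γ B) : ∑ c, ev V c t ⊗ₜ single c = t := by
  induction t using TensorProduct.induction_on with
  | zero => simp
  | add s t hs ht =>
    simp only [map_add, TensorProduct.add_tmul, Finset.sum_add_distrib, hs, ht]
  | tmul u v =>
    conv_rhs => rw [eq_sum_single v]
    rw [TensorProduct.tmul_sum]
    refine Finset.sum_congr rfl fun c _ => ?_
    rw [ev_tmul, TensorProduct.smul_tmul]

/-- Stated for a predicate, so that it also applies to subspaces of objects whose underlying space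
is this tensor product only by definition. -/
theorem of_ev {t : V ⊗[ℂ] ZSpace Γ B} (P : V ⊗[ℂ] ZSpace Γ B → Prop) (h0 : P 0)
    (hadd : ∀ a b, P a → P b → P (a + b)) (h : ∀ c, P (ev V c t ⊗ₜ single c)) : P t := by
  rw [← sum_ev_tmul_single t]
  exact Finset.sum_induction _ P hadd h0 fun c _ => h c

theorem ev_ext {s t : V ⊗[ℂ] ZSpace Γ B} (h : ∀ c, ev V c s = ev V c t) : s = t := by
  rw [← sum_ev_tmul_single s, ← sum_ev_tmul_single t]
  simp only [h]

theorem exists_ev_eq (F : B.Classes Γ → V) : ∃ t : V ⊗[ℂ] ZSpace Γ B, ∀ c, ev V c t = F c := by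
  refine ⟨∑ c, F c ⊗ₜ single c, fun d => ?_⟩
  rw [map_sum, Finset.sum_eq_single d]
  · rw [ev_tmul, single_self, one_smul]
  · intro c _ hc
    rw [ev_tmul, single_of_ne hc.symm, zero_smul]
  · simp

end ZSpace

namespace Surface

variable {Γ : Type u} [Group Γ] {I O : Type} {B : Surface.{u} I O}

/-- The holonomies along the incoming components, in the direction of their labels. -/
def inHol (c : B.Classes Γ) : I → Γ := fun i => (B.clsHol Γ c (Sum.inl i))⁻¹

/-- The holonomies along the outgoing components. -/
def outHol (c : B.Classes Γ) : O → Γ := fun o => B.clsHol Γ c (Sum.inr o)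

theorem clsHol_eq_elim_iff {c : B.Classes Γ} {x : I → Γ} {y : O → Γ} :
    B.clsHol Γ c = Sum.elim x⁻¹ y ↔ inHol c = x ∧ outHol c = y := by
  constructor
  · intro h
    refine ⟨funext fun i => ?_, funext fun o => ?_⟩
    · simp [inHol, h]
    · simp [outHol, h]
  · rintro ⟨rfl, rfl⟩
    funext j
    rcases j with i | o
    · simp [inHol]
    · rfl

theorem inHol_smul (g : I → Γ) (h : O → Γ) (c : B.Classes Γ) :
    inHol (Sum.elim g h • c) = g * inHol c * g⁻¹ := by
  funext i
  simp [inHol, clsHol_smul, mul_assoc]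

theorem elim_smul_elim_smul (g g' : I → Γ) (h h' : O → Γ) (c : B.Classes Γ) :
    (Sum.elim g h : I ⊕ O → Γ) • (Sum.elim g' h' : I ⊕ O → Γ) • c =
      (Sum.elim (g * g') (h * h') : I ⊕ O → Γ) • c := by
  rw [smul_smul]
  congr 1
  funext j
  rcases j with j | j <;> rfl

theorem elim_inv (g : I → Γ) (h : O → Γ) : (Sum.elim g h : I ⊕ O → Γ)⁻¹ = Sum.elim g⁻¹ h⁻¹ := by
  funext j
  rcases j with j | j <;> rfl

theorem elim_one_smul (c : B.Classes Γ) : (Sum.elim 1 1 : I ⊕ O → Γ) • c = c := by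
  have : (Sum.elim 1 1 : I ⊕ O → Γ) = 1 := by funext j; rcases j with j | j <;> rfl
  rw [this, one_smul]

end Surface

namespace ZHat

open Surface ZSpace

variable {Γ : Type u} [Group Γ] [Finite Γ] {I O : Type} [Finite I] [Finite O]
  {B : Surface.{u} I O} {U : EObj Γ I}

theorem grade_eq (x : I → Γ) (y : O → Γ) :
    (EObj.reindex (pairing I O) (U.ext (Z Γ B))).grade (Sum.elim y (Sum.elim x⁻¹ x)) =
      Submodule.map₂ (TensorProduct.mk ℂ U.V (ZSpace Γ B)) (U.grade x)
        (supp Γ B {c | inHol c = x ∧ outHol c = y}) := by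
  have h : {c : B.Classes Γ | inHol c = x ∧ outHol c = y} =
      {c | B.clsHol Γ c = ((Sum.elim y (Sum.elim x⁻¹ x)) ∘ pairing I O) ∘ Sum.inr} := by
    ext c
    refine clsHol_eq_elim_iff.symm.trans ?_
    have e : ((Sum.elim y (Sum.elim x⁻¹ x)) ∘ pairing I O) ∘ Sum.inr = Sum.elim x⁻¹ y := by
      funext j
      rcases j with j | j <;> rfl
    rw [← e]
    rfl
  rw [h]
  rfl

theorem mem_of_ev {t : U.V ⊗[ℂ] ZSpace Γ B}
    (S : Submodule ℂ (EObj.reindex (pairing I O) (U.ext (Z Γ B))).V)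
    (h : ∀ c, ev U.V c t ⊗ₜ[ℂ] (single c : ZSpace Γ B) ∈ S) : t ∈ S := by
  have h0 := S.zero_mem
  have h1 := fun a b => S.add_mem (x := a) (y := b)
  exact of_ev (fun t => t ∈ S) h0 h1 h

/-- The coefficient at `c` must have the degree that pairs with the incoming holonomy of `c`, and
only classes with outgoing holonomy `y` may contribute. Conversely `t` is the sum of its
coefficients tensored with basis vectors, each of which then lies in the matched part. -/
theorem mem_matched_iff {t : U.V ⊗[ℂ] ZSpace Γ B} {y : O → Γ} :
    t ∈ (EObj.reindex (pairing I O) (U.ext (Z Γ B))).matched y ↔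
      ∀ c, ev U.V c t ∈ U.grade (inHol c) ∧ (outHol c ≠ y → ev U.V c t = 0) := by
  constructor
  · intro ht c
    have key : ∀ S : Submodule ℂ U.V, (∀ x, ∀ a ∈ U.grade x,
        ∀ b ∈ supp Γ B {c | inHol c = x ∧ outHol c = y}, b c • a ∈ S) → ev U.V c t ∈ S := by
      intro S hS
      have h1 : (EObj.reindex (pairing I O) (U.ext (Z Γ B))).matched y ≤
          S.comap (ev U.V c) := by
        refine iSup_le fun x => ?_
        rw [grade_eq]
        exact Submodule.map₂_le.2 fun a ha b hb => hS x a ha b hb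
      exact h1 ht
    refine ⟨key _ fun x a ha b hb => ?_, fun hc => ?_⟩
    · by_cases h : b c = 0
      · rw [h, zero_smul]
        exact Submodule.zero_mem _
      · rw [(not_imp_comm.1 (hb c) h).1]
        exact Submodule.smul_mem _ _ ha
    · refine (Submodule.mem_bot ℂ).1 (key ⊥ fun x a _ b hb => ?_)
      rw [hb c fun h => hc h.2, zero_smul]
      exact Submodule.zero_mem _
  · intro h
    refine mem_of_ev ((EObj.reindex (pairing I O) (U.ext (Z Γ B))).matched y) fun c => ?_
    by_cases hc : outHol c = y
    · have hle := le_iSup (fun x => (EObj.reindex (pairing I O) (U.ext (Z Γ B))).grade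
        (Sum.elim y (Sum.elim x⁻¹ x))) (inHol c)
      have m : TensorProduct.mk ℂ U.V (ZSpace Γ B) (ev U.V c t) (single c) ∈
          Submodule.map₂ (TensorProduct.mk ℂ U.V (ZSpace Γ B)) (U.grade (inHol c))
            (supp Γ B {d | inHol d = inHol c ∧ outHol d = y}) :=
        Submodule.apply_mem_map₂ _ (h c).1 (single_mem_supp ⟨rfl, hc⟩)
      rw [← grade_eq] at m
      exact hle m
    · rw [(h c).2 hc, TensorProduct.zero_tmul]
      exact ((EObj.reindex (pairing I O) (U.ext (Z Γ B))).matched y).zero_mem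

theorem mem_iSup_matched_iff {t : U.V ⊗[ℂ] ZSpace Γ B} :
    t ∈ ⨆ y, (EObj.reindex (pairing I O) (U.ext (Z Γ B))).matched y ↔
      ∀ c, ev U.V c t ∈ U.grade (inHol c) := by
  constructor
  · intro ht c
    have h1 : ⨆ y, (EObj.reindex (pairing I O) (U.ext (Z Γ B))).matched y ≤
        (U.grade (inHol c)).comap (ev U.V c) :=
      iSup_le fun y t ht => ((mem_matched_iff.1 ht) c).1
    exact h1 ht
  · intro h
    refine mem_of_ev (⨆ y, (EObj.reindex (pairing I O) (U.ext (Z Γ B))).matched y) fun c => ?_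
    have hle := le_iSup (EObj.reindex (pairing I O) (U.ext (Z Γ B))).matched (outHol c)
    refine hle (mem_matched_iff.2 fun d => ?_)
    by_cases hd : d = c
    · subst hd
      rw [ev_tmul, single_self, one_smul]
      exact ⟨h d, fun hd => absurd rfl hd⟩
    · rw [ev_tmul, single_of_ne hd, zero_smul]
      exact ⟨Submodule.zero_mem _, fun _ => rfl⟩

theorem ev_act (g : O → Γ) (h : I → Γ) (t : U.V ⊗[ℂ] ZSpace Γ B) (c : B.Classes Γ) :
    ev U.V c ((EObj.reindex (pairing I O) (U.ext (Z Γ B))).act (Sum.elim g (Sum.elim h h)) t) =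
      U.act h (ev U.V ((Sum.elim h⁻¹ g⁻¹ : I ⊕ O → Γ) • c) t) := by
  have key : ev U.V c ∘ₗ TensorProduct.map (U.act h) ((Z Γ B).act (Sum.elim h g)) =
      U.act h ∘ₗ ev U.V ((Sum.elim h⁻¹ g⁻¹ : I ⊕ O → Γ) • c) := by
    refine TensorProduct.ext' fun u v => ?_
    refine Eq.trans ?_ (map_smul (U.act h) _ _).symm
    rw [← elim_inv]
    rfl
  have e : ((Sum.elim g (Sum.elim h h)) ∘ pairing I O) ∘ Sum.inr = Sum.elim h g := by
    funext j
    rcases j with j | j <;> rfl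
  rw [← e] at key
  exact LinearMap.congr_fun key t

/-- Membership in the matched part becomes the degree condition and diagonal invariance becomes
equivariance under Γ^I. All later arguments about `ZHat` work with this description. -/
theorem mem_contractSpace_iff {t : U.V ⊗[ℂ] ZSpace Γ B} :
    t ∈ (EObj.reindex (pairing I O) (U.ext (Z Γ B))).contractSpace ↔
      (∀ c, ev U.V c t ∈ U.grade (inHol c)) ∧
      ∀ (h : I → Γ) (c : B.Classes Γ),
        ev U.V ((Sum.elim h 1 : I ⊕ O → Γ) • c) t = U.act h (ev U.V c t) := by
  refine and_congr mem_iSup_matched_iff (forall_congr' fun h => ?_)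
  constructor
  · intro ht c
    rw [← ht]
    refine (ev_act 1 h t _).trans ?_
    rw [elim_smul_elim_smul, inv_mul_cancel, inv_one, one_mul, elim_one_smul, ht]
  · intro ht
    refine ev_ext fun c => (ev_act 1 h t c).trans ?_
    rw [← ht, elim_smul_elim_smul, mul_inv_cancel, inv_one, one_mul, elim_one_smul]

/-- The value at the class `c` of an element of `Ẑ(B)(U)`, regarded as a function on classes. -/
def eval (c : B.Classes Γ) : ((ZHat Γ B).obj U).V →ₗ[ℂ] U.V := ev U.V c ∘ₗ val Γ B U

theorem eval_apply (c : B.Classes Γ) (v : ((ZHat Γ B).obj U).V) :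
    eval c v = ev U.V c (val Γ B U v) := rfl

theorem val_injective : Function.Injective (val Γ B U) := fun _ _ h => Subtype.ext h

theorem eval_ext {v w : ((ZHat Γ B).obj U).V} (h : ∀ c, eval c v = eval c w) : v = w :=
  val_injective (ev_ext h)

theorem eval_mem (v : ((ZHat Γ B).obj U).V) (c : B.Classes Γ) : eval c v ∈ U.grade (inHol c) :=
  (mem_contractSpace_iff.1 v.2).1 c

theorem eval_smul (v : ((ZHat Γ B).obj U).V) (h : I → Γ) (c : B.Classes Γ) :
    eval ((Sum.elim h 1 : I ⊕ O → Γ) • c) v = U.act h (eval c v) :=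
  (mem_contractSpace_iff.1 v.2).2 h c

theorem exists_eval_eq (F : B.Classes Γ → U.V) (h1 : ∀ c, F c ∈ U.grade (inHol c))
    (h2 : ∀ (h : I → Γ) (c : B.Classes Γ),
      F ((Sum.elim h 1 : I ⊕ O → Γ) • c) = U.act h (F c)) :
    ∃ v : ((ZHat Γ B).obj U).V, ∀ c, eval c v = F c := by
  obtain ⟨t, ht⟩ := exists_ev_eq F
  refine ⟨(⟨t, mem_contractSpace_iff.2 ⟨fun c => ?_, fun h c => ?_⟩⟩ :
    (EObj.reindex (pairing I O) (U.ext (Z Γ B))).contractSpace), ht⟩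
  · rw [ht]
    exact h1 c
  · rw [ht, ht]
    exact h2 h c

/-- The degree condition on the incoming side holds for every element of the contraction, so only
the outgoing holonomies are tested. -/
theorem mem_grade_iff {v : ((ZHat Γ B).obj U).V} {y : O → Γ} :
    v ∈ ((ZHat Γ B).obj U).grade y ↔ ∀ c, outHol c ≠ y → eval c v = 0 :=
  (mem_matched_iff (t := val Γ B U v)).trans
    ⟨fun h c => (h c).2, fun h c => ⟨eval_mem v c, h c⟩⟩

theorem eval_act (v : ((ZHat Γ B).obj U).V) (g : O → Γ) (c : B.Classes Γ) :
    eval c (((ZHat Γ B).obj U).act g v) = eval ((Sum.elim 1 g⁻¹ : I ⊕ O → Γ) • c) v := by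
  have e : (Sum.elim g 1 : O ⊕ (I ⊕ I) → Γ) = Sum.elim g (Sum.elim 1 1) := by
    funext j; rcases j with j | j | j <;> rfl
  have h : val Γ B U (((ZHat Γ B).obj U).act g v) =
      (EObj.reindex (pairing I O) (U.ext (Z Γ B))).act (Sum.elim g (Sum.elim 1 1))
        (val Γ B U v) := by
    rw [← e]
    rfl
  rw [eval_apply, h]
  refine (ev_act g 1 _ c).trans ?_
  rw [inv_one, map_one]
  rfl

theorem eval_map {W : EObj Γ I} (f : U ⟶ W) (v : ((ZHat Γ B).obj U).V) (c : B.Classes Γ) :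
    eval c (EObj.lin ((ZHat Γ B).map f) v) = EObj.lin f (eval c v) := by
  have key : ev W.V c ∘ₗ TensorProduct.map (EObj.lin f) LinearMap.id =
      EObj.lin f ∘ₗ ev U.V (B := B) c :=
    TensorProduct.ext' fun u v => (map_smul (EObj.lin f) _ _).symm
  exact LinearMap.congr_fun key (val Γ B U v)

theorem isLinearFunctor : IsLinearFunctor (ZHat Γ B) := by
  intro U W f g h a e
  refine LinearMap.ext fun v => eval_ext fun c => ?_
  rw [LinearMap.add_apply, LinearMap.smul_apply, map_add, map_smul, eval_map, eval_map, eval_map, e]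
  rfl

/-- A linear map into `Ẑ(B)(U)` with given values. -/
theorem exists_linearMap {V : Type*} [AddCommGroup V] [Module ℂ V]
    (F : B.Classes Γ → V →ₗ[ℂ] U.V) (h1 : ∀ c v, F c v ∈ U.grade (inHol c))
    (h2 : ∀ (h : I → Γ) (c : B.Classes Γ) v,
      F ((Sum.elim h 1 : I ⊕ O → Γ) • c) v = U.act h (F c v)) :
    ∃ L : V →ₗ[ℂ] ((ZHat Γ B).obj U).V, ∀ c v, eval c (L v) = F c v := by
  choose L hL using fun v => exists_eval_eq (U := U) (fun c => F c v) (fun c => h1 c v)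
    (fun h c => h2 h c v)
  refine ⟨{ toFun := L, map_add' := fun v w => ?_, map_smul' := fun a v => ?_ }, fun c v => hL v c⟩
  · refine eval_ext fun c => ?_
    rw [map_add, hL, hL, hL, map_add]
  · refine eval_ext fun c => ?_
    rw [map_smul, hL, hL, map_smul]
    rfl

end ZHat

/-! ### Functoriality of Z and of the DW functor under diffeomorphisms -/

namespace LDiffeo

variable {Γ : Type u} [Group Γ] {I O I' O' : Type} {B : Surface.{u} I O} {B' : Surface.{u} I' O'}

theorem inHol_pullCls (f : LDiffeo B B') (c : B'.Classes Γ) :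
    Surface.inHol (f.pullCls Γ c) = Surface.inHol c ∘ f.inEquiv :=
  funext fun i => congrArg (·⁻¹) (congrFun (f.clsHol_pullCls c) (Sum.inl i))

theorem outHol_pullCls (f : LDiffeo B B') (c : B'.Classes Γ) :
    Surface.outHol (f.pullCls Γ c) = Surface.outHol c ∘ f.outEquiv :=
  funext fun o => congrFun (f.clsHol_pullCls c) (Sum.inr o)

theorem pullCls_elim_smul (f : LDiffeo B B') (g : I' → Γ) (h : O' → Γ) (c : B'.Classes Γ) :
    f.pullCls Γ ((Sum.elim g h : I' ⊕ O' → Γ) • c) =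
      (Sum.elim (g ∘ f.inEquiv) (h ∘ f.outEquiv) : I ⊕ O → Γ) • f.pullCls Γ c := by
  have e : Sum.elim g h ∘ f.bdry = Sum.elim (g ∘ f.inEquiv) (h ∘ f.outEquiv) := by
    funext j
    rcases j with j | j <;> rfl
  rw [f.pullCls_smul, e]

theorem pullCls_eq_self {f : LDiffeo B B} (hf : ∀ x, f.toDiffeo x = x) (c : B.Classes Γ) :
    f.pullCls Γ c = c := by
  obtain ⟨ρ, rfl⟩ := Surface.exists_rep c
  rw [pullCls_cls]
  exact congrArg _ (GBundle.ext_hol fun _ _ p => GBundle.hol_congr_apply ρ _ p fun _ => hf _)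

theorem pullCls_comp {I'' O'' : Type} {B'' : Surface.{u} I'' O''} {f : LDiffeo B B'}
    {g : LDiffeo B' B''} {h : LDiffeo B B''}
    (e : ∀ x, h.toDiffeo x = g.toDiffeo (f.toDiffeo x)) (c : B''.Classes Γ) :
    h.pullCls Γ c = f.pullCls Γ (g.pullCls Γ c) := by
  obtain ⟨ρ, rfl⟩ := Surface.exists_rep c
  rw [pullCls_cls, pullCls_cls, pullCls_cls]
  exact congrArg _ (GBundle.ext_hol fun _ _ p => GBundle.hol_congr_apply ρ _ _ fun _ => e _)

end LDiffeo

theorem ZSpace.push_eq_id {Γ : Type u} [Group Γ] {I O : Type} {B : Surface.{u} I O}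
    {f : LDiffeo B B} (hf : ∀ x, f.toDiffeo x = x) : ZSpace.push Γ f = LinearMap.id :=
  LinearMap.ext fun v => funext fun c => congrArg v (LDiffeo.pullCls_eq_self hf c)

theorem ZSpace.push_comp {Γ : Type u} [Group Γ] {I O I' O' I'' O'' : Type}
    {B : Surface.{u} I O} {B' : Surface.{u} I' O'} {B'' : Surface.{u} I'' O''}
    {f : LDiffeo B B'} {g : LDiffeo B' B''} {h : LDiffeo B B''}
    (e : ∀ x, h.toDiffeo x = g.toDiffeo (f.toDiffeo x)) :
    ZSpace.push Γ h = ZSpace.push Γ g ∘ₗ ZSpace.push Γ f :=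
  LinearMap.ext fun v => funext fun c => congrArg v (LDiffeo.pullCls_comp e c)

theorem ZSpace.ev_map_push {Γ : Type u} [Group Γ] {I O I' O' : Type}
    {B : Surface.{u} I O} {B' : Surface.{u} I' O'} (f : LDiffeo B B') {V : Type u}
    [AddCommGroup V] [Module ℂ V] (t : V ⊗[ℂ] ZSpace Γ B) (c : B'.Classes Γ) :
    ZSpace.ev V c (TensorProduct.map LinearMap.id (ZSpace.push Γ f) t) =
      ZSpace.ev V (f.pullCls Γ c) t := by
  have key : ZSpace.ev V c ∘ₗ TensorProduct.map LinearMap.id (ZSpace.push Γ f) =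
      ZSpace.ev V (f.pullCls Γ c) := TensorProduct.ext' fun _ _ => rfl
  exact LinearMap.congr_fun key t

namespace LDiffeo

variable {Γ : Type u} [Group Γ] [Finite Γ] {I O I' O' : Type} [Finite I] [Finite O] [Finite I']
  [Finite O'] {B : Surface.{u} I O} {B' : Surface.{u} I' O'} (f : LDiffeo B B')

/-- Precomposition with `pullCls` preserves the degree and equivariance conditions because `pullCls`
respects holonomies and boundary actions, up to the relabelling of components. -/
theorem exists_zHatHom (U : EObj Γ I) :
    ∃ φ : (ZHat Γ B).obj U ⟶
        (reindexFunctor Γ f.inEquiv ⋙ ZHat Γ B' ⋙ reindexFunctor Γ f.outEquiv.symm).obj U,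
      ∀ v c, ZHat.eval (U := U.reindex f.inEquiv) c (EObj.lin φ v) =
        ZHat.eval (f.pullCls Γ c) v := by
  obtain ⟨L, hL⟩ := ZHat.exists_linearMap (B := B') (U := U.reindex f.inEquiv)
    (V := ((ZHat Γ B).obj U).V) (fun c => ZHat.eval (f.pullCls Γ c))
    (fun c v => by
      have h := ZHat.eval_mem v (f.pullCls Γ c)
      rw [f.inHol_pullCls] at h
      exact h)
    (fun h c v => by
      rw [f.pullCls_elim_smul]
      exact ZHat.eval_smul v (h ∘ f.inEquiv) _)
  refine ⟨EHom.mk (U := (ZHat Γ B).obj U)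
    (W := EObj.reindex f.outEquiv.symm ((ZHat Γ B').obj (U.reindex f.inEquiv))) L
    (fun y v hv => ?_) (fun g v => ?_), fun v c => hL c v⟩
  · refine ZHat.mem_grade_iff.2 fun c hc => (hL c v).trans (ZHat.mem_grade_iff.1 hv _ fun h => ?_)
    rw [f.outHol_pullCls] at h
    refine hc ?_
    rw [← h]
    funext o
    exact congrArg (Surface.outHol c) (f.outEquiv.apply_symm_apply o).symm
  · refine ZHat.eval_ext fun c => (hL c _).trans ?_
    refine Eq.trans ?_ (ZHat.eval_act (L v) (g ∘ f.outEquiv.symm) c).symm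
    refine (ZHat.eval_act v g _).trans (Eq.trans ?_ (hL _ v).symm)
    refine congrArg (fun d => ZHat.eval d v) (Eq.trans ?_ (f.pullCls_elim_smul _ _ c).symm)
    refine congrArg (fun k : O → Γ => (Sum.elim 1 k : I ⊕ O → Γ) • f.pullCls Γ c) (funext fun o => ?_)
    exact congrArg (fun x => (g x)⁻¹) (f.outEquiv.symm_apply_apply o).symm

/-- As `pullCls` is a bijection, precomposition with its inverse supplies preimages. -/
theorem exists_zHatIso (U : EObj Γ I) :
    ∃ φ : (ZHat Γ B).obj U ≅
        (reindexFunctor Γ f.inEquiv ⋙ ZHat Γ B' ⋙ reindexFunctor Γ f.outEquiv.symm).obj U,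
      ∀ v c, ZHat.eval (U := U.reindex f.inEquiv) c (EObj.lin φ.hom v) =
        ZHat.eval (f.pullCls Γ c) v := by
  obtain ⟨φ, hφ⟩ := f.exists_zHatHom U
  refine ⟨EObj.isoOfBijective φ ⟨fun v w h => ?_, fun w => ?_⟩, hφ⟩
  · refine ZHat.eval_ext fun c => ?_
    obtain ⟨d, rfl⟩ := f.pullCls_surjective c
    rw [← hφ, h, hφ]
  · let e := Equiv.ofBijective _ (f.pullCls_bijective (Γ := Γ))
    have he : ∀ c, e.symm (f.pullCls Γ c) = c := fun c => e.symm_apply_apply c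
    obtain ⟨v, hv⟩ := ZHat.exists_eval_eq (B := B) (U := U)
      (fun c => ZHat.eval (U := U.reindex f.inEquiv) (e.symm c) w)
      (fun c => by
        obtain ⟨d, rfl⟩ := f.pullCls_surjective c
        rw [he, f.inHol_pullCls]
        exact ZHat.eval_mem (U := U.reindex f.inEquiv) w d)
      (fun h c => by
        obtain ⟨d, rfl⟩ := f.pullCls_surjective c
        have h1 := f.pullCls_elim_smul (h ∘ f.inEquiv.symm) 1 d
        have h2 : (h ∘ f.inEquiv.symm) ∘ f.inEquiv = h :=
          funext fun i => congrArg h (f.inEquiv.symm_apply_apply i)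
        rw [h2] at h1
        have h3 := ZHat.eval_smul (U := U.reindex f.inEquiv) w (h ∘ f.inEquiv.symm) d
        refine (congrArg (fun c => ZHat.eval (U := U.reindex f.inEquiv) c w)
          ((congrArg e.symm h1.symm).trans (he _))).trans (h3.trans ?_)
        rw [he]
        exact congrArg (fun k => U.act k _) h2)
    refine ⟨v, ZHat.eval_ext (U := U.reindex f.inEquiv) fun c => ?_⟩
    rw [hφ, hv, he]

theorem exists_zHat_iso : ∃ α : ZHat Γ B ≅ reindexFunctor Γ f.inEquiv ⋙ ZHat Γ B' ⋙
      reindexFunctor Γ f.outEquiv.symm,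
    ∀ (U : EObj Γ I) (v : ((ZHat Γ B).obj U).V),
      ZHat.val Γ B' (U.reindex f.inEquiv) (EObj.lin (α.hom.app U) v) =
        TensorProduct.map (LinearMap.id : U.V →ₗ[ℂ] U.V) (ZSpace.push Γ f)
          (ZHat.val Γ B U v) := by
  choose φ hφ using f.exists_zHatIso (Γ := Γ)
  refine ⟨NatIso.ofComponents φ fun {U W} g => ?_, fun U v => ?_⟩
  · refine EObj.hom_ext (LinearMap.ext fun v => ?_)
    refine ZHat.eval_ext (U := W.reindex f.inEquiv) fun c => ?_
    refine (hφ W _ c).trans ((ZHat.eval_map g v _).trans ?_)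
    rw [← hφ U]
    exact (ZHat.eval_map ((reindexFunctor Γ f.inEquiv).map g) _ c).symm
  · exact ZSpace.ev_ext fun c => (hφ U v c).trans (ZSpace.ev_map_push f _ c).symm

end LDiffeo

/-! ### Naturality of the disjoint union isometry -/

namespace SumDecomp

variable {Γ : Type u} [Group Γ] {I O I₁ O₁ I₂ O₂ : Type} {M : Surface.{u} I O}
  {B : Surface.{u} I₁ O₁} {B' : Surface.{u} I₂ O₂} (D : SumDecomp M B B')
  {J P J₁ P₁ J₂ P₂ : Type} {N : Surface.{u} J P}
  {C : Surface.{u} J₁ P₁} {C' : Surface.{u} J₂ P₂} (E : SumDecomp N C C')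

theorem clsEquiv_pullCls {h : LDiffeo M N} {f : LDiffeo B C} {f' : LDiffeo B' C'}
    (hf : ∀ x, h.toDiffeo (D.left x) = E.left (f.toDiffeo x))
    (hf' : ∀ x, h.toDiffeo (D.right x) = E.right (f'.toDiffeo x)) (c : N.Classes Γ) :
    D.clsEquiv Γ (h.pullCls Γ c) =
      (f.pullCls Γ (E.clsEquiv Γ c).1, f'.pullCls Γ (E.clsEquiv Γ c).2) := by
  obtain ⟨ρ, rfl⟩ := Surface.exists_rep c
  rw [LDiffeo.pullCls_cls, clsEquiv_cls, clsEquiv_cls, LDiffeo.pullCls_cls, LDiffeo.pullCls_cls]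
  simp only [GBundle.pull_pull]
  exact Prod.ext (congrArg (fun g => B.cls Γ (ρ.pull g)) (ContinuousMap.ext hf))
    (congrArg (fun g => B'.cls Γ (ρ.pull g)) (ContinuousMap.ext hf'))

/-- Only diffeomorphisms of the parts enter, not one of the unions, so the formula also serves for
gluings, where none is given on the cut surface. -/
theorem tensorMap_map_push (f : LDiffeo B C) (f' : LDiffeo B' C')
    (t : ZSpace Γ B ⊗[ℂ] ZSpace Γ B') (c : N.Classes Γ) :
    E.tensorMap Γ (TensorProduct.map (ZSpace.push Γ f) (ZSpace.push Γ f') t) c =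
      D.tensorMap Γ t ((D.clsEquiv Γ).symm
        (f.pullCls Γ (E.clsEquiv Γ c).1, f'.pullCls Γ (E.clsEquiv Γ c).2)) := by
  have key : (LinearMap.proj c : (N.Classes Γ → ℂ) →ₗ[ℂ] ℂ) ∘ₗ E.tensorMap Γ ∘ₗ
      TensorProduct.map (ZSpace.push Γ f) (ZSpace.push Γ f') =
      (LinearMap.proj ((D.clsEquiv Γ).symm (f.pullCls Γ (E.clsEquiv Γ c).1,
        f'.pullCls Γ (E.clsEquiv Γ c).2)) : (M.Classes Γ → ℂ) →ₗ[ℂ] ℂ) ∘ₗ D.tensorMap Γ := by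
    refine TensorProduct.ext' fun v w => ?_
    refine Eq.trans ?_ (D.tensorMap_tmul v w _).symm
    rw [Equiv.apply_symm_apply]
    rfl
  exact LinearMap.congr_fun key t

theorem iso_push [Finite Γ] [Finite I] [Finite O] [Finite I₁] [Finite O₁] [Finite I₂] [Finite O₂]
    [Finite J] [Finite P] [Finite J₁] [Finite P₁] [Finite J₂] [Finite P₂]
    {h : LDiffeo M N} {f : LDiffeo B C} {f' : LDiffeo B' C'}
    (hf : ∀ x, h.toDiffeo (D.left x) = E.left (f.toDiffeo x))
    (hf' : ∀ x, h.toDiffeo (D.right x) = E.right (f'.toDiffeo x)) (v : ZSpace Γ M) :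
    (EObj.lin (E.iso Γ).hom (ZSpace.push Γ h v) : ZSpace Γ C ⊗[ℂ] ZSpace Γ C') =
      TensorProduct.map (ZSpace.push Γ f) (ZSpace.push Γ f') (EObj.lin (D.iso Γ).hom v) := by
  refine E.tensorMap_injective ((E.tensorMap_iso _).trans (funext fun c => ?_))
  refine Eq.trans ?_ (tensorMap_map_push D E f f' _ c).symm
  rw [D.tensorMap_iso, ← D.clsEquiv_pullCls E hf hf', Equiv.symm_apply_apply, ZSpace.push_apply]

end SumDecomp

/-! ### Multiplicativity of the DW functor -/

/-- The decomposition of a disjoint union. -/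
def Surface.sumDecomp {I O I' O' : Type} (B : Surface.{u} I O) (B' : Surface.{u} I' O') :
    SumDecomp (B.disjUnion B') B B' where
  homeo := Homeomorph.refl _
  idx := Equiv.sumSumSumComm I O I' O'
  label_inl := by rintro (i | o) z <;> rfl
  label_inr := by rintro (i | o) z <;> rfl
  isLeft_inl := by rintro (i | o) <;> rfl
  isLeft_inr := by rintro (i | o) <;> rfl

namespace Surface

variable {Γ : Type u} [Group Γ] {I O I' O' : Type} {B : Surface.{u} I O} {B' : Surface.{u} I' O'}

variable (Γ B B') in
/-- Classes on a disjoint union are pairs of classes. -/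
def sumCls : (B.disjUnion B').Classes Γ ≃ B.Classes Γ × B'.Classes Γ :=
  (B.sumDecomp B').clsEquiv Γ

theorem inHol_sumCls (c : (B.disjUnion B').Classes Γ) :
    inHol (sumCls Γ B B' c).1 = inHol c ∘ Sum.inl ∧
      inHol (sumCls Γ B B' c).2 = inHol c ∘ Sum.inr :=
  ⟨funext fun i => congrArg (·⁻¹) ((B.sumDecomp B').clsHol_inl c (Sum.inl i)),
    funext fun i => congrArg (·⁻¹) ((B.sumDecomp B').clsHol_inr c (Sum.inl i))⟩

theorem outHol_sumCls (c : (B.disjUnion B').Classes Γ) :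
    outHol (sumCls Γ B B' c).1 = outHol c ∘ Sum.inl ∧
      outHol (sumCls Γ B B' c).2 = outHol c ∘ Sum.inr :=
  ⟨funext fun o => (B.sumDecomp B').clsHol_inl c (Sum.inr o),
    funext fun o => (B.sumDecomp B').clsHol_inr c (Sum.inr o)⟩

theorem sumCls_elim_smul (g : I ⊕ I' → Γ) (h : O ⊕ O' → Γ) (c : (B.disjUnion B').Classes Γ) :
    sumCls Γ B B' ((Sum.elim g h : (I ⊕ I') ⊕ (O ⊕ O') → Γ) • c) =
      ((Sum.elim (g ∘ Sum.inl) (h ∘ Sum.inl) : I ⊕ O → Γ) • (sumCls Γ B B' c).1,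
        (Sum.elim (g ∘ Sum.inr) (h ∘ Sum.inr) : I' ⊕ O' → Γ) • (sumCls Γ B B' c).2) := by
  have e1 : Sum.elim g h ∘ Equiv.sumSumSumComm I O I' O' ∘ Sum.inl =
      Sum.elim (g ∘ Sum.inl) (h ∘ Sum.inl) := by
    funext j; rcases j with j | j <;> rfl
  have e2 : Sum.elim g h ∘ Equiv.sumSumSumComm I O I' O' ∘ Sum.inr =
      Sum.elim (g ∘ Sum.inr) (h ∘ Sum.inr) := by
    funext j; rcases j with j | j <;> rfl
  rw [← e1, ← e2]
  exact (B.sumDecomp B').clsEquiv_smul _ c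

end Surface

/-- A finite jointly injective family of linear maps over a field has a left inverse. -/
theorem LinearMap.exists_sum_comp_eq_id {k T W κ : Type*} [Field k] [AddCommGroup T] [Module k T]
    [AddCommGroup W] [Module k W] [Fintype κ] (f : κ → T →ₗ[k] W)
    (hf : ∀ s, (∀ i, f i s = 0) → s = 0) :
    ∃ p : κ → W →ₗ[k] T, ∑ i, p i ∘ₗ f i = LinearMap.id := by
  classical
  -- Joint injectivity is injectivity of the map into the finite product; the components of a left
  -- inverse of that map are the required `p i`.
  obtain ⟨q, hq⟩ := LinearMap.exists_leftInverse_of_injective (LinearMap.pi f)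
    (LinearMap.ker_eq_bot'.2 fun s hs => hf s fun i => congrFun hs i)
  refine ⟨fun i => q ∘ₗ LinearMap.single k (fun _ => W) i, LinearMap.ext fun s => ?_⟩
  rw [← hq, LinearMap.sum_apply, LinearMap.comp_apply]
  conv_rhs => rw [← Finset.univ_sum_single (LinearMap.pi f s)]
  rw [map_sum]
  rfl

/-- A tensor vanishes if it is killed by all tensor products of maps from two jointly injective
families. -/
theorem TensorProduct.eq_zero_of_map_eq_zero {k S S' V V' ι ι' : Type*} [Field k]
    [AddCommGroup S] [Module k S] [AddCommGroup S'] [Module k S'] [AddCommGroup V] [Module k V]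
    [AddCommGroup V'] [Module k V'] [Finite ι] [Finite ι'] (e : ι → S →ₗ[k] V)
    (e' : ι' → S' →ₗ[k] V') (he : ∀ s, (∀ i, e i s = 0) → s = 0)
    (he' : ∀ s, (∀ i, e' i s = 0) → s = 0) (t : S ⊗[k] S')
    (ht : ∀ i j, TensorProduct.map (e i) (e' j) t = 0) : t = 0 := by
  have := Fintype.ofFinite ι
  have := Fintype.ofFinite ι'
  obtain ⟨p, hp⟩ := LinearMap.exists_sum_comp_eq_id e he
  obtain ⟨p', hp'⟩ := LinearMap.exists_sum_comp_eq_id e' he'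
  -- The identity of the tensor product is written as a double sum whose terms each factor through
  -- some `e i ⊗ e' j`.
  have h : TensorProduct.map (∑ i, p i ∘ₗ e i) (∑ j, p' j ∘ₗ e' j) t = t := by
    rw [hp, hp', TensorProduct.map_id, LinearMap.id_apply]
  have hl : ∀ (F : S →ₗ[k] S) , TensorProduct.map F (∑ j, p' j ∘ₗ e' j) t =
      ∑ j, TensorProduct.map F (p' j ∘ₗ e' j) t := fun F => by
    rw [← LinearMap.sum_apply]
    exact LinearMap.congr_fun
      (map_sum (TensorProduct.mapBilinear (RingHom.id k) S S' S S' F) _ _) t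
  rw [← h, hl]
  refine Finset.sum_eq_zero fun j _ => ?_
  have hr : TensorProduct.map (∑ i, p i ∘ₗ e i) (p' j ∘ₗ e' j) t =
      ∑ i, TensorProduct.map (p i ∘ₗ e i) (p' j ∘ₗ e' j) t := by
    rw [← LinearMap.sum_apply]
    exact LinearMap.congr_fun (map_sum ((TensorProduct.mapBilinear (RingHom.id k) S S' S S').flip
      (p' j ∘ₗ e' j)) _ _) t
  rw [hr]
  refine Finset.sum_eq_zero fun i _ => ?_
  rw [TensorProduct.map_comp, LinearMap.comp_apply, ht, map_zero]

theorem TensorProduct.sum_tmul_sum_equiv {R M N α β γ : Type*} [CommSemiring R] [AddCommMonoid M]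
    [AddCommMonoid N] [Module R M] [Module R N] [Fintype α] [Fintype β] [Fintype γ]
    (e : γ ≃ α × β) (f : α → M) (g : β → N) :
    (∑ a, f a) ⊗ₜ[R] (∑ b, g b) = ∑ c, f (e c).1 ⊗ₜ[R] g (e c).2 := by
  rw [TensorProduct.sum_tmul]
  simp only [TensorProduct.tmul_sum]
  rw [← Fintype.sum_prod_type']
  exact (Fintype.sum_equiv e _ _ fun _ => rfl).symm

namespace ZHat

variable {Γ : Type u} [Group Γ] [Finite Γ] {I O : Type} [Finite I]
  {B : Surface.{u} I O} (U : EObj Γ I)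

open Classical in
/-- The value at the class `d` of the average over `Γ^I` of the function that maps the class `c` to
a given vector and vanishes elsewhere. -/
def avg (c d : B.Classes Γ) : U.V →ₗ[ℂ] U.V :=
  letI := Fintype.ofFinite (I → Γ)
  ∑ h : I → Γ, if (Sum.elim h 1 : I ⊕ O → Γ) • c = d then U.act h else 0

variable {U}

open Classical in
theorem avg_apply [inst : Fintype (I → Γ)] (c d : B.Classes Γ) (a : U.V) :
    avg U c d a = ∑ h : I → Γ, if (Sum.elim h 1 : I ⊕ O → Γ) • c = d then U.act h a else 0 := by
  rw [Subsingleton.elim inst (Fintype.ofFinite _)]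
  refine (LinearMap.sum_apply _ _ _).trans (Finset.sum_congr rfl fun h _ => ?_)
  split_ifs <;> rfl

variable [Finite O]

variable (B U) in
/-- The function on classes given by an element of `Ẑ(B)(U)`. -/
def evals : ((ZHat Γ B).obj U).V →ₗ[ℂ] B.Classes Γ → U.V := LinearMap.pi eval

/-- Summing over all of Γ^I makes the function equivariant, by translating the summation index, and
conjugation of degrees by the action preserves the degree condition. -/
theorem avg_mem_range {c : B.Classes Γ} {a : U.V} (ha : a ∈ U.grade (Surface.inHol c)) :
    LinearMap.pi (avg U c) a ∈ LinearMap.range (evals B U) := by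
  classical
  have := Fintype.ofFinite (I → Γ)
  obtain ⟨v, hv⟩ := exists_eval_eq (B := B) (U := U) (fun d => avg U c d a)
    (fun d => by
      rw [avg_apply]
      refine Submodule.sum_mem _ fun h _ => ?_
      split_ifs with hd
      · rw [← hd, Surface.inHol_smul]
        exact U.act_grade h _ a ha
      · exact Submodule.zero_mem _)
    (fun k d => by
      rw [avg_apply, avg_apply, map_sum]
      refine (Fintype.sum_equiv (Equiv.mulLeft k) _ _ fun h => ?_).symm
      have e : (Sum.elim (k * h) 1 : I ⊕ O → Γ) • c =
          (Sum.elim k 1 : I ⊕ O → Γ) • (Sum.elim h 1 : I ⊕ O → Γ) • c := by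
        rw [Surface.elim_smul_elim_smul, one_mul]
      have e' := smul_left_cancel_iff (Sum.elim k 1 : I ⊕ O → Γ)
        (x := (Sum.elim h 1 : I ⊕ O → Γ) • c) (y := d)
      rw [← e] at e'
      rw [Equiv.coe_mulLeft]
      by_cases hd : (Sum.elim h 1 : I ⊕ O → Γ) • c = d
      · rw [if_pos hd, if_pos (e'.2 hd), map_mul]
        rfl
      · rw [if_neg hd, if_neg (hd ∘ e'.1), map_zero])
  exact ⟨v, funext hv⟩

/-- A subspace of `Ẑ(B)(U)` that contains all averages is the whole space. -/
theorem eq_top_of_avg {S : Submodule ℂ ((ZHat Γ B).obj U).V}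
    (hS : ∀ c, U.grade (Surface.inHol c) ≤ (S.map (evals B U)).comap (LinearMap.pi (avg U c))) :
    S = ⊤ := by
  classical
  have := Fintype.ofFinite (I → Γ)
  refine eq_top_iff.2 fun w _ => ?_
  choose s hs he using fun c => hS c (eval_mem w c)
  -- Averaging the values of `w` class by class and adding up reproduces `w`, multiplied by the
  -- order of Γ^I since `avg` is not normalized.
  have h : ∑ c, s c = (Fintype.card (I → Γ) : ℂ) • w := by
    refine eval_ext fun d => ?_
    rw [map_sum, map_smul]
    have h1 : ∀ c, eval d (s c) =
        ∑ h : I → Γ, if (Sum.elim h 1 : I ⊕ O → Γ) • c = d then eval d w else 0 := fun c => by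
      refine (congrFun (he c) d).trans ((avg_apply c d _).trans (Finset.sum_congr rfl fun h _ => ?_))
      split_ifs with hd
      · rw [← hd, eval_smul]
      · rfl
    rw [Finset.sum_congr rfl fun c _ => h1 c, Finset.sum_comm, Nat.cast_smul_eq_nsmul ℂ,
      ← Finset.card_univ, ← Finset.sum_const]
    refine Finset.sum_congr rfl fun h _ => ?_
    -- For each `h` exactly one class is carried to `d`.
    rw [Finset.sum_eq_single ((Sum.elim h 1 : I ⊕ O → Γ)⁻¹ • d)]
    · rw [smul_inv_smul, if_pos rfl]
    · intro c _ hc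
      exact if_neg fun hc' => hc (by rw [← hc', inv_smul_smul])
    · simp
  have hc : (Fintype.card (I → Γ) : ℂ) ≠ 0 := Nat.cast_ne_zero.2 Fintype.card_ne_zero
  have h2 : w = (Fintype.card (I → Γ) : ℂ)⁻¹ • ∑ c, s c := by
    rw [h, smul_smul, inv_mul_cancel₀ hc, one_smul]
  rw [h2]
  exact Submodule.smul_mem _ _ (Submodule.sum_mem _ fun c _ => hs c)

end ZHat

namespace ZHat

variable {Γ : Type u} [Group Γ] [Finite Γ] {I O I' O' : Type} [Finite I] [Finite I']
  {B : Surface.{u} I O} {B' : Surface.{u} I' O'} {U : EObj Γ I} {W : EObj Γ I'}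

/-- The group of the union is a product, and the condition of carrying `c` to `d` is the conjunction
of the conditions on the parts, so the sum factors. -/
theorem avg_tmul (c d : (B.disjUnion B').Classes Γ) (a : U.V) (b : W.V) :
    avg (U.ext W) c d (a ⊗ₜ[ℂ] b) =
      avg U (Surface.sumCls Γ B B' c).1 (Surface.sumCls Γ B B' d).1 a ⊗ₜ[ℂ]
        avg W (Surface.sumCls Γ B B' c).2 (Surface.sumCls Γ B B' d).2 b := by
  classical
  have := Fintype.ofFinite (I → Γ)
  have := Fintype.ofFinite (I' → Γ)
  have := Fintype.ofFinite (I ⊕ I' → Γ)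
  refine (avg_apply c d (U := U.ext W) (a ⊗ₜ b)).trans ?_
  rw [avg_apply, avg_apply,
    TensorProduct.sum_tmul_sum_equiv (Equiv.sumArrowEquivProdArrow I I' Γ)]
  refine Finset.sum_congr rfl fun h _ => ?_
  have e : (Sum.elim h 1 : (I ⊕ I') ⊕ (O ⊕ O') → Γ) • c = d ↔
      (Sum.elim (h ∘ Sum.inl) 1 : I ⊕ O → Γ) • (Surface.sumCls Γ B B' c).1 =
          (Surface.sumCls Γ B B' d).1 ∧
        (Sum.elim (h ∘ Sum.inr) 1 : I' ⊕ O' → Γ) • (Surface.sumCls Γ B B' c).2 =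
          (Surface.sumCls Γ B B' d).2 := by
    rw [← (Surface.sumCls Γ B B').apply_eq_iff_eq, Surface.sumCls_elim_smul, Prod.ext_iff]
    rfl
  change _ = (if (Sum.elim (h ∘ Sum.inl) 1 : I ⊕ O → Γ) • (Surface.sumCls Γ B B' c).1 =
    (Surface.sumCls Γ B B' d).1 then U.act (h ∘ Sum.inl) a else 0) ⊗ₜ
      (if (Sum.elim (h ∘ Sum.inr) 1 : I' ⊕ O' → Γ) • (Surface.sumCls Γ B B' c).2 =
          (Surface.sumCls Γ B B' d).2 then W.act (h ∘ Sum.inr) b else 0)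
  by_cases h1 : (Sum.elim (h ∘ Sum.inl) 1 : I ⊕ O → Γ) • (Surface.sumCls Γ B B' c).1 =
    (Surface.sumCls Γ B B' d).1
  · by_cases h2 : (Sum.elim (h ∘ Sum.inr) 1 : I' ⊕ O' → Γ) • (Surface.sumCls Γ B B' c).2 =
          (Surface.sumCls Γ B B' d).2
    · rw [if_pos h1, if_pos h2, if_pos (e.2 ⟨h1, h2⟩)]
      rfl
    · rw [if_neg h2, if_neg fun h => h2 (e.1 h).2, TensorProduct.tmul_zero]
      rfl
  · rw [if_neg h1, if_neg fun h => h1 (e.1 h).1, TensorProduct.zero_tmul]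
    rfl

variable [Finite O] [Finite O']

/-- The tensor `s ⊗ t` goes to the function whose value at a pair of classes is the tensor product
of the values of `s` and `t`. -/
theorem exists_tensorHom (U : EObj Γ I) (W : EObj Γ I') :
    ∃ φ : ((ZHat Γ B).obj U).ext ((ZHat Γ B').obj W) ⟶ (ZHat Γ (B.disjUnion B')).obj (U.ext W),
      ∀ (t : ((ZHat Γ B).obj U).V ⊗[ℂ] ((ZHat Γ B').obj W).V) (c : (B.disjUnion B').Classes Γ),
        (eval (U := U.ext W) c (EObj.lin φ t) : U.V ⊗[ℂ] W.V) =
        TensorProduct.map (eval (Surface.sumCls Γ B B' c).1) (eval (Surface.sumCls Γ B B' c).2)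
          t := by
  have h1 : ∀ c (t : ((ZHat Γ B).obj U).V ⊗[ℂ] ((ZHat Γ B').obj W).V),
      TensorProduct.map (eval (Surface.sumCls Γ B B' c).1) (eval (Surface.sumCls Γ B B' c).2) t ∈
        Submodule.map₂ (TensorProduct.mk ℂ U.V W.V) (U.grade (Surface.inHol c ∘ Sum.inl))
          (W.grade (Surface.inHol c ∘ Sum.inr)) := fun c t => by
    induction t using TensorProduct.induction_on with
    | zero => rw [map_zero]; exact Submodule.zero_mem _
    | add s t hs ht => rw [map_add]; exact Submodule.add_mem _ hs ht
    | tmul s t =>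
      rw [← (Surface.inHol_sumCls c).1, ← (Surface.inHol_sumCls c).2]
      exact Submodule.apply_mem_map₂ (TensorProduct.mk ℂ U.V W.V) (eval_mem s _) (eval_mem t _)
  have h2 : ∀ (h : I ⊕ I' → Γ) (c : (B.disjUnion B').Classes Γ),
      TensorProduct.map
        (eval (B := B) (U := U) (Surface.sumCls Γ B B' ((Sum.elim h 1 : _ → Γ) • c)).1)
        (eval (B := B') (U := W) (Surface.sumCls Γ B B' ((Sum.elim h 1 : _ → Γ) • c)).2) =
      TensorProduct.map (U.act (h ∘ Sum.inl)) (W.act (h ∘ Sum.inr)) ∘ₗ TensorProduct.map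
        (eval (Surface.sumCls Γ B B' c).1) (eval (Surface.sumCls Γ B B' c).2) := fun h c => by
    refine TensorProduct.ext' fun s t => ?_
    rw [Surface.sumCls_elim_smul]
    exact congrArg₂ (fun a b => TensorProduct.mk ℂ U.V W.V a b) (eval_smul s _ _) (eval_smul t _ _)
  obtain ⟨L, hL⟩ := exists_linearMap (B := B.disjUnion B') (U := U.ext W)
    (V := ((ZHat Γ B).obj U).V ⊗[ℂ] ((ZHat Γ B').obj W).V)
    (fun c => TensorProduct.map (eval (Surface.sumCls Γ B B' c).1)
      (eval (Surface.sumCls Γ B B' c).2)) h1 (fun h c t => LinearMap.congr_fun (h2 h c) t)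
  have hL' : ∀ s t c, eval (U := U.ext W) c (L (s ⊗ₜ t)) =
      TensorProduct.mk ℂ U.V W.V (eval (Surface.sumCls Γ B B' c).1 s)
        (eval (Surface.sumCls Γ B B' c).2 t) := fun s t c => hL c _
  refine ⟨EHom.mk (U := ((ZHat Γ B).obj U).ext ((ZHat Γ B').obj W))
    (W := (ZHat Γ (B.disjUnion B')).obj (U.ext W)) L (fun y t ht => ?_) (fun g t => ?_),
    fun t c => hL c t⟩
  · have key : Submodule.map₂ (TensorProduct.mk ℂ _ _)
        (((ZHat Γ B).obj U).grade (y ∘ Sum.inl)) (((ZHat Γ B').obj W).grade (y ∘ Sum.inr)) ≤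
        (((ZHat Γ (B.disjUnion B')).obj (U.ext W)).grade y).comap L := by
      refine Submodule.map₂_le.2 fun s hs t ht => mem_grade_iff.2 fun c hc => (hL' s t c).trans ?_
      by_cases h1 : Surface.outHol (Surface.sumCls Γ B B' c).1 = y ∘ Sum.inl
      · have h2 : Surface.outHol (Surface.sumCls Γ B B' c).2 ≠ y ∘ Sum.inr := fun h2 => hc (by
          rw [(Surface.outHol_sumCls c).1] at h1
          rw [(Surface.outHol_sumCls c).2] at h2
          rw [← Sum.elim_comp_inl_inr (Surface.outHol c), h1, h2, Sum.elim_comp_inl_inr])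
        rw [mem_grade_iff.1 ht _ h2, map_zero]
        rfl
      · rw [mem_grade_iff.1 hs _ h1, map_zero]
        rfl
    exact key ht
  · have key : L ∘ₗ TensorProduct.map (((ZHat Γ B).obj U).act (g ∘ Sum.inl))
        (((ZHat Γ B').obj W).act (g ∘ Sum.inr)) =
        ((ZHat Γ (B.disjUnion B')).obj (U.ext W)).act g ∘ₗ L := by
      refine TensorProduct.ext' fun s t => eval_ext fun c => (hL' _ _ c).trans ?_
      refine Eq.trans ?_ (eval_act (L (s ⊗ₜ t)) g c).symm
      rw [hL', Surface.sumCls_elim_smul, eval_act, eval_act]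
      rfl
    exact LinearMap.congr_fun key t

/-- Injectivity follows because evaluations at classes are jointly injective on each factor. For
surjectivity it suffices to reach averages of pure tensors, which are tensor products of averages.
-/
theorem exists_tensorIso (U : EObj Γ I) (W : EObj Γ I') :
    ∃ φ : ((ZHat Γ B).obj U).ext ((ZHat Γ B').obj W) ≅ (ZHat Γ (B.disjUnion B')).obj (U.ext W),
      ∀ (t : ((ZHat Γ B).obj U).V ⊗[ℂ] ((ZHat Γ B').obj W).V) (c : (B.disjUnion B').Classes Γ),
        (eval (U := U.ext W) c (EObj.lin φ.hom t) : U.V ⊗[ℂ] W.V) =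
        TensorProduct.map (eval (Surface.sumCls Γ B B' c).1) (eval (Surface.sumCls Γ B B' c).2)
          t := by
  obtain ⟨φ, hφ⟩ := exists_tensorHom (B := B) (B' := B') U W
  refine ⟨EObj.isoOfBijective φ ⟨?_, ?_⟩, hφ⟩
  · refine (injective_iff_map_eq_zero (EObj.lin φ)).2 fun t ht => ?_
    refine TensorProduct.eq_zero_of_map_eq_zero (fun c : B.Classes Γ => eval (U := U) c)
      (fun c : B'.Classes Γ => eval (U := W) c)
      (fun s hs => eval_ext fun c => (hs c).trans (map_zero _).symm)
      (fun s hs => eval_ext fun c => (hs c).trans (map_zero _).symm) t fun c c' => ?_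
    have h := hφ t ((Surface.sumCls Γ B B').symm (c, c'))
    rw [Equiv.apply_symm_apply, ht] at h
    exact h.symm.trans (map_zero _)
  -- The criterion is an inclusion of submodules, so it can be checked on the pure tensors spanning
  -- a graded piece of `U.ext W`.
  · refine LinearMap.range_eq_top.1 (eq_top_of_avg fun c => ?_)
    refine Submodule.map₂_le.2 fun a ha b hb => ?_
    rw [← (Surface.inHol_sumCls c).1] at ha
    rw [← (Surface.inHol_sumCls c).2] at hb
    obtain ⟨s, hs⟩ := avg_mem_range ha
    obtain ⟨t, ht⟩ := avg_mem_range hb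
    refine ⟨EObj.lin φ (s ⊗ₜ t : ((ZHat Γ B).obj U).V ⊗[ℂ] ((ZHat Γ B').obj W).V), ⟨_, rfl⟩,
      funext fun d => ?_⟩
    refine (hφ _ d).trans (Eq.trans ?_ (avg_tmul c d a b).symm)
    exact congrArg₂ (fun a b => TensorProduct.mk ℂ U.V W.V a b) (congrFun hs _) (congrFun ht _)

theorem isExtProduct : IsExtProduct (ZHat Γ B) (ZHat Γ B') (ZHat Γ (B.disjUnion B')) := by
  refine ⟨isLinearFunctor, ?_⟩
  choose φ hφ using fun (U : EObj Γ I) (W : EObj Γ I') =>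
    exists_tensorIso (B := B) (B' := B') U W
  refine ⟨Iso.symm (NatIso.ofComponents (fun P => φ P.1 P.2) fun {P Q} f => ?_)⟩
  refine EObj.hom_ext (TensorProduct.ext' fun s t => ?_)
  refine eval_ext (U := Q.1.ext Q.2) fun c => ?_
  refine (hφ Q.1 Q.2 _ c).trans (Eq.trans ?_ (eval_map (EObj.extMap f.1 f.2) _ c).symm)
  refine Eq.trans ?_ (congrArg (TensorProduct.map (EObj.lin f.1) (EObj.lin f.2))
    (hφ P.1 P.2 (s ⊗ₜ t) c)).symm
  exact congrArg₂ (fun a b => TensorProduct.mk ℂ Q.1.V Q.2.V a b) (eval_map f.1 s _) (eval_map f.2 t _)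

end ZHat

/-! ### Naturality of the gluing isometries -/

namespace Cut

variable {Γ : Type u} [Group Γ] {I O K I' O' K' : Type} {B : Surface.{u} I O}
  {A : CurveSystem B K} {M : Surface.{u} (I ⊕ K) (O ⊕ K)} {q : Cut B A M}
  {B' : Surface.{u} I' O'} {A' : CurveSystem B' K'} {M' : Surface.{u} (I' ⊕ K') (O' ⊕ K')}
  {q' : Cut B' A' M'} {f : LDiffeo B B'} {h : LDiffeo M M'}

/-- Compatibility with the cutting maps makes the two pull-backs from `B'` to `M` equal; the
converse uses that every bundle on `B` is pulled back from `B'` and that pull-back is injective on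
classes. -/
theorem rel_pullCls_iff (e : ∀ x, q'.map (h.toDiffeo x) = f.toDiffeo (q.map x))
    {c : M'.Classes Γ} {b : B'.Classes Γ} :
    q.Rel (h.pullCls Γ c) (f.pullCls Γ b) ↔ q'.Rel c b := by
  have key : ∀ σ : GBundle Γ B'.carrier,
      (σ.pull f.toContinuousMap).pull q.toContinuousMap =
        (σ.pull q'.toContinuousMap).pull h.toContinuousMap := fun σ => by
    rw [GBundle.pull_pull, GBundle.pull_pull]
    exact congrArg σ.pull (ContinuousMap.ext fun x => (e x).symm)
  constructor
  · rintro ⟨τ, h1, h2⟩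
    obtain ⟨σ, rfl⟩ : ∃ σ : GBundle Γ B'.carrier, σ.pull f.toContinuousMap = τ :=
      ⟨_, f.pull_symm_pull τ⟩
    rw [key] at h1
    exact ⟨σ, h.pullCls_injective h1, f.pullCls_injective h2⟩
  · rintro ⟨σ, rfl, rfl⟩
    exact ⟨σ.pull f.toContinuousMap, by rw [key]; rfl, rfl⟩

/-- Stated for one pair of classes, so that it covers both a diffeomorphism of the cut surfaces and
separate diffeomorphisms of the two parts. -/
theorem transfer_push_apply {c : M.Classes Γ} {c' : M'.Classes Γ}
    (e : ∀ b, q.Rel c (f.pullCls Γ b) ↔ q'.Rel c' b) (v : ZSpace Γ B) :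
    q'.transfer Γ (ZSpace.push Γ f v) c' = q.transfer Γ v c := by
  by_cases hc : ∃ b, q'.Rel c' b
  · obtain ⟨b, hb⟩ := hc
    rw [hb.transfer_apply, ((e b).2 hb).transfer_apply, ZSpace.push_apply]
  · rw [transfer_apply_of_not hc, transfer_apply_of_not]
    rintro ⟨b, hb⟩
    obtain ⟨b, rfl⟩ := f.pullCls_surjective b
    exact hc ⟨b, (e b).1 hb⟩

theorem transfer_push (e : ∀ x, q'.map (h.toDiffeo x) = f.toDiffeo (q.map x)) (v : ZSpace Γ B) :
    q'.transfer Γ (ZSpace.push Γ f v) = ZSpace.push Γ h (q.transfer Γ v) :=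
  funext fun _ => transfer_push_apply (fun _ => rel_pullCls_iff e) v

end Cut

namespace Gluing

variable {Γ : Type u} [Group Γ] {I J L : Type} {B₁ : Surface.{u} I J} {B₂ : Surface.{u} J L}
  {B : Surface.{u} I L} {A : CurveSystem B J}

section Naturality

variable {I' J' L' : Type} {q : Gluing B₁ B₂ B A} {B₁' : Surface.{u} I' J'}
  {B₂' : Surface.{u} J' L'} {B' : Surface.{u} I' L'} {A' : CurveSystem B' J'}
  {q' : Gluing B₁' B₂' B' A'} {f₁ : LDiffeo B₁ B₁'} {f₂ : LDiffeo B₂ B₂'} {f : LDiffeo B B'}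

theorem rel_pullCls_iff (h₁ : ∀ x, q'.left (f₁.toDiffeo x) = f.toDiffeo (q.left x))
    (h₂ : ∀ x, q'.right (f₂.toDiffeo x) = f.toDiffeo (q.right x))
    {c : B₂'.Classes Γ × B₁'.Classes Γ} {b : B'.Classes Γ} :
    q.Rel (f₂.pullCls Γ c.1, f₁.pullCls Γ c.2) (f.pullCls Γ b) ↔ q'.Rel c b := by
  have key₁ : ∀ σ : GBundle Γ B'.carrier, (σ.pull f.toContinuousMap).pull q.left =
      (σ.pull q'.left).pull f₁.toContinuousMap := fun σ => by
    rw [GBundle.pull_pull, GBundle.pull_pull]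
    exact congrArg σ.pull (ContinuousMap.ext fun x => (h₁ x).symm)
  have key₂ : ∀ σ : GBundle Γ B'.carrier, (σ.pull f.toContinuousMap).pull q.right =
      (σ.pull q'.right).pull f₂.toContinuousMap := fun σ => by
    rw [GBundle.pull_pull, GBundle.pull_pull]
    exact congrArg σ.pull (ContinuousMap.ext fun x => (h₂ x).symm)
  rw [rel_iff, rel_iff]
  constructor
  · rintro ⟨τ, h1, h2⟩
    obtain ⟨σ, rfl⟩ : ∃ σ : GBundle Γ B'.carrier, σ.pull f.toContinuousMap = τ :=
      ⟨_, f.pull_symm_pull τ⟩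
    rw [key₁, key₂] at h1
    exact ⟨σ, Prod.ext (f₂.pullCls_injective (congrArg Prod.fst h1))
      (f₁.pullCls_injective (congrArg Prod.snd h1)), f.pullCls_injective h2⟩
  · rintro ⟨σ, rfl, rfl⟩
    exact ⟨σ.pull f.toContinuousMap, by rw [key₁, key₂]; rfl, rfl⟩

theorem transfer₂_push [Finite Γ] [Finite I] [Finite J] [Finite L] [Finite I'] [Finite J']
    [Finite L'] (h₁ : ∀ x, q'.left (f₁.toDiffeo x) = f.toDiffeo (q.left x))
    (h₂ : ∀ x, q'.right (f₂.toDiffeo x) = f.toDiffeo (q.right x)) (v : ZSpace Γ B) :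
    q'.transfer₂ Γ (ZSpace.push Γ f v) =
      TensorProduct.map (ZSpace.push Γ f₂) (ZSpace.push Γ f₁) (q.transfer₂ Γ v) := by
  refine (decomp B₁' B₂').tensorMap_injective (funext fun c => ?_)
  rw [SumDecomp.tensorMap_map_push (decomp B₁ B₂), tensorMap_transfer₂, tensorMap_transfer₂]
  refine Cut.transfer_push_apply (fun b => (rel_pullCls_iff h₁ h₂).trans ?_) v
  rw [Rel, Equiv.symm_apply_apply]

end Naturality

variable (q : Gluing B₁ B₂ B A)

theorem coeff₂_transfer₂ [Finite Γ] [Finite I] [Finite J] [Finite L] (v : ZSpace Γ B)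
    (τ : GBundle Γ B.carrier) :
    coeff₂ (τ.pull q.right) (τ.pull q.left) (q.transfer₂ Γ v) = ZSpace.coeff Γ B τ v := by
  have h := (decomp B₁ B₂).coeff_tensorMap (τ.pull (Cut.toContinuousMap q)) (q.transfer₂ Γ v)
  rw [tensorMap_transfer₂, (Cut.rel_cls q τ).transfer_apply, GBundle.pull_pull,
    GBundle.pull_pull] at h
  exact h.symm

/-! ### Gluing as composition of DW functors -/

variable {q} {c c' : B₂.Classes Γ × B₁.Classes Γ} {b : B.Classes Γ}

/-- The element `h` acts simultaneously on the incoming boundary of `B₂` and the outgoing boundary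
of `B₁`, the two copies of the cutting curves. -/
theorem clsEquiv_symm_smul (g : I → Γ) (h : J → Γ) (k : L → Γ)
    (c : B₂.Classes Γ × B₁.Classes Γ) :
    ((decomp B₁ B₂).clsEquiv Γ).symm ((Sum.elim h k : J ⊕ L → Γ) • c.1,
      (Sum.elim g h : I ⊕ J → Γ) • c.2) =
      glGauge (Sum.elim g k) h • ((decomp B₁ B₂).clsEquiv Γ).symm c := by
  have e1 : glGauge (Sum.elim g k) h ∘ (decomp B₁ B₂).idx ∘ Sum.inl = Sum.elim h k := by
    funext j; rcases j with j | j <;> rfl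
  have e2 : glGauge (Sum.elim g k) h ∘ (decomp B₁ B₂).idx ∘ Sum.inr = Sum.elim g h := by
    funext j; rcases j with j | j <;> rfl
  rw [Equiv.symm_apply_eq, SumDecomp.clsEquiv_smul, Equiv.apply_symm_apply, e1, e2]

theorem Rel.smul [Finite J] (h : q.Rel c b) (g : I → Γ) (l : J → Γ) (k : L → Γ) :
    q.Rel ((Sum.elim l k : J ⊕ L → Γ) • c.1, (Sum.elim g l : I ⊕ J → Γ) • c.2)
      ((Sum.elim g k : I ⊕ L → Γ) • b) := by
  rw [Rel, clsEquiv_symm_smul]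
  exact Cut.Rel.smul h _ _

theorem exists_rel_smul_iff [Finite J] (g : I → Γ) (l : J → Γ) (k : L → Γ) :
    (∃ b, q.Rel ((Sum.elim l k : J ⊕ L → Γ) • c.1, (Sum.elim g l : I ⊕ J → Γ) • c.2) b) ↔
      ∃ b, q.Rel c b := by
  constructor
  · rintro ⟨b, h⟩
    have h' := h.smul g⁻¹ l⁻¹ k⁻¹
    simp only [← Surface.elim_inv, inv_smul_smul] at h'
    exact ⟨_, h'⟩
  · rintro ⟨b, h⟩
    exact ⟨_, h.smul g l k⟩

theorem Rel.exists_smul {g : I → Γ} {k : L → Γ} (h : q.Rel c b)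
    (h' : q.Rel c' ((Sum.elim g k : I ⊕ L → Γ) • b)) :
    ∃ l : J → Γ, c' = ((Sum.elim l k : J ⊕ L → Γ) • c.1, (Sum.elim g l : I ⊕ J → Γ) • c.2) := by
  obtain ⟨l, hl⟩ := Cut.Rel.exists_smul h h'
  refine ⟨l, ((decomp B₁ B₂).clsEquiv Γ).symm.injective ?_⟩
  rw [clsEquiv_symm_smul, hl]

theorem Rel.unique {b' : B.Classes Γ} (h : q.Rel c b) (h' : q.Rel c b') : b = b' :=
  Cut.Rel.unique h h'

theorem Rel.inHol_eq (h : q.Rel c b) : Surface.inHol c.2 = Surface.inHol b := funext fun i => by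
  have h1 := (decomp B₁ B₂).clsHol_inr (((decomp B₁ B₂).clsEquiv Γ).symm c) (Sum.inl i)
  rw [Equiv.apply_symm_apply] at h1
  exact congrArg (·⁻¹) (h1.trans (Cut.Rel.clsHol_inl h i))

theorem Rel.outHol_eq (h : q.Rel c b) : Surface.outHol c.1 = Surface.outHol b := funext fun l => by
  have h1 := (decomp B₁ B₂).clsHol_inl (((decomp B₁ B₂).clsEquiv Γ).symm c) (Sum.inr l)
  rw [Equiv.apply_symm_apply] at h1
  exact h1.trans (Cut.Rel.clsHol_inr h l)

theorem matched_iff : Surface.Matched (((decomp B₁ B₂).clsEquiv Γ).symm c) ↔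
    Surface.outHol c.2 = Surface.inHol c.1 := by
  refine (forall_congr' fun j => ?_).trans funext_iff.symm
  have h1 := (decomp B₁ B₂).clsHol_inl (((decomp B₁ B₂).clsEquiv Γ).symm c) (Sum.inl j)
  have h2 := (decomp B₁ B₂).clsHol_inr (((decomp B₁ B₂).clsEquiv Γ).symm c) (Sum.inr j)
  rw [Equiv.apply_symm_apply] at h1 h2
  rw [Surface.outHol, Surface.inHol, h1, h2, eq_inv_iff_mul_eq_one, eq_inv_iff_mul_eq_one]
  exact mul_eq_one_comm

theorem Rel.outHol_eq_inHol (h : q.Rel c b) : Surface.outHol c.2 = Surface.inHol c.1 :=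
  matched_iff.1 (Cut.Rel.matched h)

theorem exists_rel_of_outHol_eq [Finite J] (q : Gluing B₁ B₂ B A)
    (h : Surface.outHol c.2 = Surface.inHol c.1) : ∃ b, q.Rel c b :=
  Cut.exists_rel_of_matched q (matched_iff.2 h)

theorem exists_rel (q : Gluing B₁ B₂ B A) (b : B.Classes Γ) : ∃ c, q.Rel c b := by
  obtain ⟨m, hm⟩ := Cut.exists_rel q b
  refine ⟨(decomp B₁ B₂).clsEquiv Γ m, ?_⟩
  rw [Rel, Equiv.symm_apply_apply]
  exact hm

section Composition

variable [Finite Γ] [Finite I] [Finite L] {U : EObj Γ I}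

open Classical in
variable (q) in
/-- The value at the pair `c` of the restriction to the parts of an element of `Ẑ(B)(U)`. -/
def restr (c : B₂.Classes Γ × B₁.Classes Γ) : ((ZHat Γ B).obj U).V →ₗ[ℂ] U.V :=
  if h : ∃ b, q.Rel c b then ZHat.eval h.choose else 0

theorem Rel.restr_apply (h : q.Rel c b) (v : ((ZHat Γ B).obj U).V) :
    q.restr c v = ZHat.eval b v := by
  have h' : ∃ b, q.Rel c b := ⟨b, h⟩
  rw [restr, dif_pos h', h'.choose_spec.unique h]

theorem restr_of_not (h : ¬ ∃ b, q.Rel c b) (v : ((ZHat Γ B).obj U).V) : q.restr c v = 0 := by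
  rw [restr, dif_neg h, LinearMap.zero_apply]

theorem restr_mem (c : B₂.Classes Γ × B₁.Classes Γ) (v : ((ZHat Γ B).obj U).V) :
    q.restr c v ∈ U.grade (Surface.inHol c.2) := by
  by_cases h : ∃ b, q.Rel c b
  · obtain ⟨b, h⟩ := h
    rw [h.restr_apply, h.inHol_eq]
    exact ZHat.eval_mem v b
  · rw [restr_of_not h]
    exact Submodule.zero_mem _

theorem restr_map {W : EObj Γ I} (f : U ⟶ W) (c : B₂.Classes Γ × B₁.Classes Γ)
    (v : ((ZHat Γ B).obj U).V) :
    q.restr c (EObj.lin ((ZHat Γ B).map f) v) = EObj.lin f (q.restr c v) := by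
  by_cases h : ∃ b, q.Rel c b
  · obtain ⟨b, h⟩ := h
    rw [h.restr_apply, h.restr_apply, ZHat.eval_map]
  · rw [restr_of_not h, restr_of_not h, map_zero]

variable [Finite J]

/-- Acting by `l` on both copies of the curves leaves the class on `B` unchanged, so only `g` has an
effect. -/
theorem restr_smul (g : I → Γ) (l : J → Γ) (c : B₂.Classes Γ × B₁.Classes Γ)
    (v : ((ZHat Γ B).obj U).V) :
    q.restr ((Sum.elim l 1 : J ⊕ L → Γ) • c.1, (Sum.elim g l : I ⊕ J → Γ) • c.2) v =
      U.act g (q.restr c v) := by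
  by_cases h : ∃ b, q.Rel c b
  · obtain ⟨b, h⟩ := h
    rw [h.restr_apply, (h.smul g l 1).restr_apply, ZHat.eval_smul]
  · rw [restr_of_not h, restr_of_not (h ∘ (exists_rel_smul_iff g l 1).1), map_zero]

theorem restr_act (k : L → Γ) (c : B₂.Classes Γ × B₁.Classes Γ) (v : ((ZHat Γ B).obj U).V) :
    q.restr c (((ZHat Γ B).obj U).act k v) =
      q.restr ((Sum.elim 1 k⁻¹ : J ⊕ L → Γ) • c.1, (Sum.elim 1 1 : I ⊕ J → Γ) • c.2) v := by
  by_cases h : ∃ b, q.Rel c b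
  · obtain ⟨b, h⟩ := h
    rw [h.restr_apply, (h.smul 1 1 k⁻¹).restr_apply, ZHat.eval_act]
  · rw [restr_of_not h, restr_of_not (h ∘ (exists_rel_smul_iff 1 1 k⁻¹).1)]

variable (q) in
-- An element of the composite is a function of two classes that vanishes unless the holonomies
-- along the common boundary agree and is equivariant under Γ^J and Γ^I. The function `restr` has
-- these properties, and it is curried in two stages, `c₁` inside `c₂`.
theorem exists_restrHom (U : EObj Γ I) :
    ∃ φ : (ZHat Γ B).obj U ⟶ (ZHat Γ B₂).obj ((ZHat Γ B₁).obj U),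
      ∀ v c₂ c₁, ZHat.eval (U := U) c₁ (ZHat.eval (U := (ZHat Γ B₁).obj U) c₂ (EObj.lin φ v)) =
        q.restr (c₂, c₁) v := by
  choose N hN using fun c₂ => ZHat.exists_linearMap (B := B₁) (U := U)
    (V := ((ZHat Γ B).obj U).V) (fun c₁ => q.restr (c₂, c₁)) (fun c₁ v => restr_mem (c₂, c₁) v)
    (fun h c₁ v => by
      have := restr_smul (q := q) h 1 (c₂, c₁) v
      rwa [Surface.elim_one_smul] at this)
  obtain ⟨T, hT⟩ := ZHat.exists_linearMap (B := B₂) (U := (ZHat Γ B₁).obj U)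
    (V := ((ZHat Γ B).obj U).V) N
    -- The inner function has degree `inHol c₂`: if `outHol c₁` differs from it, no bundle on `B`
    -- restricts to the pair and the value is 0.
    (fun c₂ v => ZHat.mem_grade_iff.2 fun c₁ hc => by
      rw [hN, restr_of_not]
      rintro ⟨b, h⟩
      exact hc h.outHol_eq_inHol)
    (fun l c₂ v => ZHat.eval_ext fun c₁ => by
      -- The shift of `c₁` by `l⁻¹` is the one that `eval_act` produces from the action of `l` on
      -- the inner function.
      have h := restr_smul (q := q) 1 l (c₂, (Sum.elim 1 l⁻¹ : I ⊕ J → Γ) • c₁) v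
      rw [Surface.elim_smul_elim_smul, mul_inv_cancel, one_mul, Surface.elim_one_smul,
        map_one] at h
      rw [hN, ZHat.eval_act, hN, h]
      rfl)
  have hNT : ∀ v c₂ c₁, ZHat.eval (U := U) c₁ (ZHat.eval (U := (ZHat Γ B₁).obj U) c₂ (T v)) =
      q.restr (c₂, c₁) v := fun v c₂ c₁ => by rw [hT, hN]
  refine ⟨EHom.mk (U := (ZHat Γ B).obj U) (W := (ZHat Γ B₂).obj ((ZHat Γ B₁).obj U)) T
    (fun y v hv => ?_) (fun g v => ?_), hNT⟩
  · refine ZHat.mem_grade_iff.2 fun c₂ hc => ZHat.eval_ext fun c₁ => ?_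
    rw [hNT, map_zero]
    by_cases h : ∃ b, q.Rel (c₂, c₁) b
    · obtain ⟨b, h⟩ := h
      rw [h.restr_apply]
      exact ZHat.mem_grade_iff.1 hv b fun e => hc (h.outHol_eq.trans e)
    · exact restr_of_not h v
  · refine ZHat.eval_ext fun c₂ => ZHat.eval_ext fun c₁ => ?_
    rw [hNT, restr_act, ZHat.eval_act, hNT, Surface.elim_one_smul]

/-- The counterpart of `restr_smul` for arbitrary elements of the composite. It makes the preimage
constructed below independent of the chosen pairs. -/
theorem eval_eval_smul (w : ((ZHat Γ B₂).obj ((ZHat Γ B₁).obj U)).V) (g : I → Γ) (l : J → Γ)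
    (c : B₂.Classes Γ × B₁.Classes Γ) :
    ZHat.eval ((Sum.elim g l : I ⊕ J → Γ) • c.2) (ZHat.eval ((Sum.elim l 1 : J ⊕ L → Γ) • c.1) w) =
      U.act g (ZHat.eval c.2 (ZHat.eval c.1 w)) := by
  rw [ZHat.eval_smul, ZHat.eval_act, Surface.elim_smul_elim_smul, inv_mul_cancel, one_mul,
    ZHat.eval_smul]

variable (q) in
-- Every class on `B` lies under some pair, which gives injectivity. An element of the composite is
-- determined by one value over each class on `B`, since pairs over the same class differ by the
-- action of Γ^J and unmatched pairs have value 0.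
theorem exists_restrIso (U : EObj Γ I) :
    ∃ φ : (ZHat Γ B).obj U ≅ (ZHat Γ B₂).obj ((ZHat Γ B₁).obj U),
      ∀ v c₂ c₁, ZHat.eval (U := U) c₁
        (ZHat.eval (U := (ZHat Γ B₁).obj U) c₂ (EObj.lin φ.hom v)) = q.restr (c₂, c₁) v := by
  obtain ⟨φ, hφ⟩ := q.exists_restrHom U
  refine ⟨EObj.isoOfBijective φ ⟨fun v w h => ?_, fun w => ?_⟩, hφ⟩
  · refine ZHat.eval_ext fun b => ?_
    obtain ⟨c, hc⟩ := q.exists_rel b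
    rw [← hc.restr_apply, ← hc.restr_apply]
    exact (hφ v c.1 c.2).symm.trans ((congrArg (fun x => ZHat.eval c.2
      (ZHat.eval (U := (ZHat Γ B₁).obj U) c.1 x)) h).trans (hφ w c.1 c.2))
  -- The choice of a pair over each `b` is arbitrary; another choice changes it by an element of
  -- Γ^J, to which the double evaluation is insensitive.
  · choose r hr using q.exists_rel (Γ := Γ)
    obtain ⟨v, hv⟩ := ZHat.exists_eval_eq (B := B) (U := U)
      (fun b => ZHat.eval (r b).2 (ZHat.eval (r b).1 w))
      (fun b => by
        rw [← (hr b).inHol_eq]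
        exact ZHat.eval_mem _ _)
      (fun g b => by
        obtain ⟨l, hl⟩ := (hr b).exists_smul (hr ((Sum.elim g 1 : I ⊕ L → Γ) • b))
        rw [hl]
        exact eval_eval_smul w g l (r b))
    refine ⟨v, ZHat.eval_ext fun c₂ => ZHat.eval_ext fun c₁ => (hφ v c₂ c₁).trans ?_⟩
    by_cases h : ∃ b, q.Rel (c₂, c₁) b
    · obtain ⟨b, h⟩ := h
      have h' : q.Rel (r b) ((Sum.elim 1 1 : I ⊕ L → Γ) • b) := by
        rw [Surface.elim_one_smul]
        exact hr b
      obtain ⟨l, hl⟩ := h.exists_smul h'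
      rw [h.restr_apply, hv, hl]
      refine (eval_eval_smul w 1 l (c₂, c₁)).trans ?_
      rw [map_one]
      rfl
    -- A pair coming from no bundle on `B` has different holonomies along the common boundary, and
    -- there the inner function vanishes by its degree.
    · rw [restr_of_not h]
      refine (ZHat.mem_grade_iff.1 (ZHat.eval_mem w c₂) c₁ fun e => h ?_).symm
      exact q.exists_rel_of_outHol_eq e

theorem nonempty_zHat_iso_comp (q : Gluing B₁ B₂ B A) :
    Nonempty (ZHat Γ B ≅ ZHat Γ B₁ ⋙ ZHat Γ B₂) := by
  choose φ hφ using q.exists_restrIso (Γ := Γ)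
  refine ⟨NatIso.ofComponents φ fun {U W} f => ?_⟩
  refine EObj.hom_ext (LinearMap.ext fun v => ?_)
  refine ZHat.eval_ext (U := (ZHat Γ B₁).obj W) fun c₂ => ZHat.eval_ext (U := W) fun c₁ => ?_
  refine (hφ W _ c₂ c₁).trans ((restr_map f _ v).trans ?_)
  rw [← hφ U]
  refine Eq.trans ?_ (congrArg (ZHat.eval (U := W) c₁)
    (ZHat.eval_map ((ZHat Γ B₁).map f) (EObj.lin (φ U).hom v) c₂)).symm
  exact (ZHat.eval_map f _ c₁).symm

end Composition

end Gluing

end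

/-! ### Assembly of the theorem -/

theorem theorem3 (Γ : Type u) [Group Γ] [Finite Γ] :
    -- (a) functoriality
    (∀ (I O I' O' : Type) [Finite I] [Finite O] [Finite I'] [Finite O']
        (B : Surface.{u} I O) (B' : Surface.{u} I' O') (f : LDiffeo B B'),
      (∃ φ : (reindexFunctor Γ f.bdry).obj (Z Γ B) ≅ Z Γ B',
        IsIsometric φ.hom ∧ ∀ v : ZSpace Γ B, EObj.lin φ.hom v = ZSpace.push Γ f v) ∧
      (∃ α : ZHat Γ B ≅ reindexFunctor Γ f.inEquiv ⋙ ZHat Γ B' ⋙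
          reindexFunctor Γ f.outEquiv.symm,
        ∀ (U : EObj Γ I) (v : ((ZHat Γ B).obj U).V),
          ZHat.val Γ B' (U.reindex f.inEquiv) (EObj.lin (α.hom.app U) v) =
            TensorProduct.map (LinearMap.id : U.V →ₗ[ℂ] U.V) (ZSpace.push Γ f)
              (ZHat.val Γ B U v))) ∧
    (∀ (I O : Type) [Finite I] [Finite O] (B : Surface.{u} I O) (f : LDiffeo B B),
      (∀ x, f.toDiffeo x = x) → ZSpace.push Γ f = LinearMap.id) ∧
    (∀ (I O I' O' I'' O'' : Type) [Finite I] [Finite O] [Finite I'] [Finite O'] [Finite I'']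
        [Finite O''] (B : Surface.{u} I O) (B' : Surface.{u} I' O') (B'' : Surface.{u} I'' O'')
        (f : LDiffeo B B') (g : LDiffeo B' B'') (h : LDiffeo B B''),
      (∀ x, h.toDiffeo x = g.toDiffeo (f.toDiffeo x)) →
        ZSpace.push Γ h = ZSpace.push Γ g ∘ₗ ZSpace.push Γ f) ∧
    -- (b) multiplicativity
    (∃ ψ : ∀ (I O I' O' : Type) [Finite I] [Finite O] [Finite I'] [Finite O']
        (B : Surface.{u} I O) (B' : Surface.{u} I' O'),
        Z Γ (B.disjUnion B') ≅
          (reindexFunctor Γ (Equiv.sumSumSumComm I O I' O')).obj ((Z Γ B).ext (Z Γ B')),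
      (∀ (I O I' O' : Type) [Finite I] [Finite O] [Finite I'] [Finite O']
          (B : Surface.{u} I O) (B' : Surface.{u} I' O'),
        IsIsometric (ψ I O I' O' B B').hom ∧
        ∀ (v : ZSpace Γ (B.disjUnion B')) (ρ : GBundle Γ (B.disjUnion B').carrier),
          coeff₂ (ρ.pull (B.inlMap B')) (ρ.pull (B.inrMap B'))
            (EObj.lin (ψ I O I' O' B B').hom v) = ZSpace.coeff Γ (B.disjUnion B') ρ v) ∧
      (∀ (I O I' O' J P J' P' : Type) [Finite I] [Finite O] [Finite I'] [Finite O']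
          [Finite J] [Finite P] [Finite J'] [Finite P']
          (B : Surface.{u} I O) (B' : Surface.{u} I' O')
          (C : Surface.{u} J P) (C' : Surface.{u} J' P')
          (f : LDiffeo B C) (f' : LDiffeo B' C') (h : LDiffeo (B.disjUnion B') (C.disjUnion C')),
        (∀ x, h.toDiffeo (B.inlMap B' x) = C.inlMap C' (f.toDiffeo x)) →
        (∀ x, h.toDiffeo (B.inrMap B' x) = C.inrMap C' (f'.toDiffeo x)) →
        ∀ v : ZSpace Γ (B.disjUnion B'),
          (EObj.lin (ψ J P J' P' C C').hom (ZSpace.push Γ h v) :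
              ZSpace Γ C ⊗[ℂ] ZSpace Γ C') =
            TensorProduct.map (ZSpace.push Γ f) (ZSpace.push Γ f')
              (EObj.lin (ψ I O I' O' B B').hom v))) ∧
    (∀ (I O I' O' : Type) [Finite I] [Finite O] [Finite I'] [Finite O']
        (B : Surface.{u} I O) (B' : Surface.{u} I' O'),
      IsExtProduct (ZHat Γ B) (ZHat Γ B') (ZHat Γ (B.disjUnion B'))) ∧
    -- (c) gluing
    (∃ Φ : ∀ (I O K : Type) [Finite I] [Finite O] [Finite K] (B : Surface.{u} I O)
        (A : CurveSystem B K) (M : Surface.{u} (I ⊕ K) (O ⊕ K)) (_ : Cut B A M),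
        Z Γ B ≅ (glFunctor Γ I O K).obj (Z Γ M),
      (∀ (I O K : Type) [Finite I] [Finite O] [Finite K] (B : Surface.{u} I O)
          (A : CurveSystem B K) (M : Surface.{u} (I ⊕ K) (O ⊕ K)) (q : Cut B A M),
        IsIsometric (Φ I O K B A M q).hom ∧
        ∀ (v : ZSpace Γ B) (τ : GBundle Γ B.carrier),
          ZSpace.coeff Γ M (τ.pull q.toContinuousMap)
            (glVal (Z Γ M) (EObj.lin (Φ I O K B A M q).hom v)) = ZSpace.coeff Γ B τ v) ∧
      (∀ (I O K I' O' K' : Type) [Finite I] [Finite O] [Finite K] [Finite I'] [Finite O']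
          [Finite K'] (B : Surface.{u} I O) (A : CurveSystem B K)
          (M : Surface.{u} (I ⊕ K) (O ⊕ K)) (q : Cut B A M)
          (B' : Surface.{u} I' O') (A' : CurveSystem B' K')
          (M' : Surface.{u} (I' ⊕ K') (O' ⊕ K')) (q' : Cut B' A' M')
          (f : LDiffeo B B') (h : LDiffeo M M'),
        (∀ x, q'.map (h.toDiffeo x) = f.toDiffeo (q.map x)) →
        ∀ v : ZSpace Γ B,
          (glVal (Z Γ M') (EObj.lin (Φ I' O' K' B' A' M' q').hom (ZSpace.push Γ f v)) :
              ZSpace Γ M') =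
            ZSpace.push Γ h (glVal (Z Γ M) (EObj.lin (Φ I O K B A M q).hom v)))) ∧
    -- (c) gluing of two surfaces along a common boundary
    (∃ Ξ : ∀ (I J L : Type) [Finite I] [Finite J] [Finite L] (B₁ : Surface.{u} I J)
        (B₂ : Surface.{u} J L) (B : Surface.{u} I L) (A : CurveSystem B J)
        (_ : Gluing B₁ B₂ B A), Z Γ B ≅ (glFunctor Γ I L J).obj (Z₂ Γ B₁ B₂),
      (∀ (I J L : Type) [Finite I] [Finite J] [Finite L] (B₁ : Surface.{u} I J)
          (B₂ : Surface.{u} J L) (B : Surface.{u} I L) (A : CurveSystem B J)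
          (q : Gluing B₁ B₂ B A),
        IsIsometric (Ξ I J L B₁ B₂ B A q).hom ∧
        ∀ (v : ZSpace Γ B) (τ : GBundle Γ B.carrier),
          coeff₂ (τ.pull q.right) (τ.pull q.left)
            (glVal (Z₂ Γ B₁ B₂) (EObj.lin (Ξ I J L B₁ B₂ B A q).hom v)) =
              ZSpace.coeff Γ B τ v) ∧
      (∀ (I J L I' J' L' : Type) [Finite I] [Finite J] [Finite L] [Finite I'] [Finite J']
          [Finite L'] (B₁ : Surface.{u} I J) (B₂ : Surface.{u} J L) (B : Surface.{u} I L)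
          (A : CurveSystem B J) (q : Gluing B₁ B₂ B A)
          (B₁' : Surface.{u} I' J') (B₂' : Surface.{u} J' L') (B' : Surface.{u} I' L')
          (A' : CurveSystem B' J') (q' : Gluing B₁' B₂' B' A')
          (f₁ : LDiffeo B₁ B₁') (f₂ : LDiffeo B₂ B₂') (f : LDiffeo B B'),
        (∀ x, q'.left (f₁.toDiffeo x) = f.toDiffeo (q.left x)) →
        (∀ x, q'.right (f₂.toDiffeo x) = f.toDiffeo (q.right x)) →
        ∀ v : ZSpace Γ B,
          (glVal (Z₂ Γ B₁' B₂')
              (EObj.lin (Ξ I' J' L' B₁' B₂' B' A' q').hom (ZSpace.push Γ f v)) :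
              ZSpace Γ B₂' ⊗[ℂ] ZSpace Γ B₁') =
            TensorProduct.map (ZSpace.push Γ f₂) (ZSpace.push Γ f₁)
              (glVal (Z₂ Γ B₁ B₂) (EObj.lin (Ξ I J L B₁ B₂ B A q).hom v)))) ∧
    (∀ (I J L : Type) [Finite I] [Finite J] [Finite L] (B₁ : Surface.{u} I J)
        (B₂ : Surface.{u} J L) (B : Surface.{u} I L) (A : CurveSystem B J),
      Gluing B₁ B₂ B A → Nonempty (ZHat Γ B ≅ ZHat Γ B₁ ⋙ ZHat Γ B₂)) := by
  refine ⟨fun I O I' O' _ _ _ _ B B' f => ⟨?_, f.exists_zHat_iso⟩,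
    fun I O _ _ B f hf => ZSpace.push_eq_id hf,
    fun I O I' O' I'' O'' _ _ _ _ _ _ B B' B'' f g h e => ZSpace.push_comp e, ?_,
    fun I O I' O' _ _ _ _ B B' => ZHat.isExtProduct, ?_, ?_,
    fun I J L _ _ _ B₁ B₂ B A q => q.nonempty_zHat_iso_comp⟩
  · exact ⟨EObj.isoOfBijective _ (f.pushHom_bijective (Γ := Γ)), f.isIsometric_pushHom,
      fun _ => rfl⟩
  · refine ⟨fun I O I' O' _ _ _ _ B B' => (B.sumDecomp B').iso Γ,
      fun I O I' O' _ _ _ _ B B' => ⟨(B.sumDecomp B').isIsometric_iso, fun v ρ => ?_⟩,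
      fun I O I' O' J P J' P' _ _ _ _ _ _ _ _ B B' C C' f f' h hf hf' v => ?_⟩
    · exact (B.sumDecomp B').coeff₂_iso v ρ
    · exact SumDecomp.iso_push (B.sumDecomp B') (C.sumDecomp C') hf hf' v
  -- Composed with `glVal`, the isometry is `Cut.transfer` by definition, so both the coefficient
  -- formula and naturality are statements about functions on classes.
  · refine ⟨fun I O K _ _ _ B A M q => q.glIso Γ,
      fun I O K _ _ _ B A M q => ⟨q.isIsometric_glHom, fun v τ => ?_⟩,
      fun I O K I' O' K' _ _ _ _ _ _ B A M q B' A' M' q' f h e v => Cut.transfer_push e v⟩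
    exact (q.rel_cls τ).transfer_apply v
  -- Here the composite with `glVal` is `transfer₂`, again by definition.
  · exact ⟨fun I J L _ _ _ B₁ B₂ B A q => q.glIso₂ Γ,
      fun I J L _ _ _ B₁ B₂ B A q => ⟨q.isIsometric_glIso₂, q.coeff₂_transfer₂⟩,
      fun I J L I' J' L' _ _ _ _ _ _ B₁ B₂ B A q B₁' B₂' B' A' q' f₁ f₂ f h₁ h₂ v =>
        Gluing.transfer₂_push h₁ h₂ v⟩
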